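/- Let $1<p<\infty$, let $I=(a,b)$ with $a<b$ and $|I|=b-a$; all functions and Banach spaces are real. Let $W$ be the space of all $u\in W^2_p(I)$ with $u(a)=u'(a)=0$ (values of the continuous representatives), normed by $\|u''\|_{p,I}$, and let $E_a:W\to L_p(I)$ be the embedding. Put $$\mathcal B(0,1)=\sup\left\{\frac{\|u-Ku\|_{p,(0,1)}}{\|u''\|_{p,(0,1)}}:\ u\in W^2_p(0,1),\ u''\neq0\right\},\qquad Ku(x)=u(0)+(u(1)-u(0))\,x .$$ For a bounded linear map $T:X\to Y$ of Banach spaces and $n\ge1$, let $a_n(T)=\inf\{\|T-F\|: F\in B(X,Y),\ \operatorname{rank}F<n\}$ be its approximation numbers and $b_n(T)=\sup_{X_n}\inf_{x\in X_n\setminus\{0\}}\|Tx\|/\|x\|$ its Bernstein numbers, the supremum being over all $n$-dimensional subspaces $X_n$ of $X$. Strict $s$-numbers are a rule $s$ that assigns to each bounded linear map $T$ between Banach spaces a sequence $(s_n(T))_{n\ge1}$ such that, for all $n\ge1$: (1) $\|T\|=s_1(T)\ge s_2(T)\ge\dots\ge0$; (2) $s_n(S+T)\le s_n(S)+\|T\|$;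 (3) $s_n(RTA)\le\|R\|\,s_n(T)\,\|A\|$; (4) $s_n(T)=0$ if $\operatorname{rank}T<n$; (5) $s_n(\mathrm{id}_X)=1$ for every Banach space $X$ with $\dim X\ge n$. They are injective if $s_n(JT)=s_n(T)$ for every $T:X\to Y$ and every linear $J:Y\to Z$ with $\|Jy\|=\|y\|$ for all $y\in Y$. **Theorem 3.6.** For all $n\ge1$, $$\left(\frac{|I|}{n}\right)^2\mathcal B(0,1)\le a_n(E_a)\le\left(\frac{|I|}{n-3/2}\right)^2\mathcal B(0,1),\qquad\text{and}\qquad \lim_{n\to\infty}n^2a_n(E_a)=|I|^2\,\mathcal B(0,1).$$ Moreover $b_n(E_a)\ge(|I|/n)^2\,\mathcal B(0,1)$ for all $n\ge1$, and for every choice of injective strict $s$-numbers $s$ the same two-sided estimate (for all $n\ge1$) and the same limit hold with $s_n(E_a)$ in place of $a_n(E_a)$. -/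

import Mathlib

open MeasureTheory Set Filter Topology
open scoped ENNReal ContDiff

noncomputable section

namespace EmbeddingNumbers

/-- Lebesgue measure on the open interval `(a, b)`. -/
abbrev intervalMeasure (a b : ℝ) : Measure ℝ := volume.restrict (Ioo a b)

/-- The real Lebesgue space `L_p(a, b)`. -/
abbrev LpInterval (p : ℝ≥0∞) (a b : ℝ) : Type := Lp ℝ p (intervalMeasure a b)

/-- `v` is the weak (distributional) derivative of `u` on `(a, b)`. -/
def IsWeakDeriv (a b : ℝ) (u v : ℝ → ℝ) : Prop :=
  ∀ φ : ℝ → ℝ, ContDiff ℝ ∞ φ → HasCompactSupport φ → tsupport φ ⊆ Ioo a b →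
    ∫ x in Ioo a b, u x * deriv φ x = -∫ x in Ioo a b, v x * φ x

/-- `u` belongs to the Sobolev space `W_p^2(a, b)` and has the first and second weak derivatives
`u'` and `u''`; here `u` and `u'` are the representatives that are continuous on `[a, b]`. -/
structure IsW2 (p : ℝ≥0∞) (a b : ℝ) (u u' u'' : ℝ → ℝ) : Prop where
  memLp : MemLp u p (intervalMeasure a b)
  memLp' : MemLp u' p (intervalMeasure a b)
  memLp'' : MemLp u'' p (intervalMeasure a b)
  weak : IsWeakDeriv a b u u'
  weak' : IsWeakDeriv a b u' u''
  cont : ContinuousOn u (Icc a b)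
  cont' : ContinuousOn u' (Icc a b)

section facts

theorem memLp_mul_test {p : ℝ≥0∞} [hp : Fact (1 ≤ p)] {a b : ℝ} {u φ : ℝ → ℝ}
    (hu : MemLp u p (intervalMeasure a b)) (hφ : Continuous φ) (hc : HasCompactSupport φ) :
    Integrable (fun x => u x * φ x) (intervalMeasure a b) := by
  have : IsFiniteMeasure (intervalMeasure a b) := ⟨by simp [intervalMeasure]⟩
  obtain ⟨C, hC⟩ := hφ.bounded_above_of_compact_support hc
  exact (hu.integrable hp.out).mul_bdd (c := C) hφ.aestronglyMeasurable
    (Eventually.of_forall hC)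

theorem isWeakDeriv_add {p : ℝ≥0∞} [Fact (1 ≤ p)] {a b : ℝ} {u v u' v' : ℝ → ℝ}
    (hu : MemLp u p (intervalMeasure a b)) (hu' : MemLp u' p (intervalMeasure a b))
    (hv : MemLp v p (intervalMeasure a b)) (hv' : MemLp v' p (intervalMeasure a b))
    (h : IsWeakDeriv a b u u') (k : IsWeakDeriv a b v v') :
    IsWeakDeriv a b (u + v) (u' + v') := by
  intro φ h1 h2 h3
  have hd : Continuous (deriv φ) := h1.continuous_deriv (by simp)
  simp only [Pi.add_apply, add_mul]
  rw [integral_add (memLp_mul_test hu hd h2.deriv) (memLp_mul_test hv hd h2.deriv),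
    integral_add (memLp_mul_test hu' h1.continuous h2) (memLp_mul_test hv' h1.continuous h2),
    h φ h1 h2 h3, k φ h1 h2 h3]
  ring

theorem isWeakDeriv_smul {a b : ℝ} {u u' : ℝ → ℝ} (c : ℝ)
    (h : IsWeakDeriv a b u u') : IsWeakDeriv a b (c • u) (c • u') := by
  intro φ h1 h2 h3
  simp only [Pi.smul_apply, smul_eq_mul, mul_assoc]
  rw [integral_const_mul, integral_const_mul, h φ h1 h2 h3]
  ring

theorem IsW2.add {p : ℝ≥0∞} [Fact (1 ≤ p)] {a b : ℝ} {u u' u'' v v' v'' : ℝ → ℝ}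
    (h : IsW2 p a b u u' u'') (k : IsW2 p a b v v' v'') :
    IsW2 p a b (u + v) (u' + v') (u'' + v'') where
  memLp := h.memLp.add k.memLp
  memLp' := h.memLp'.add k.memLp'
  memLp'' := h.memLp''.add k.memLp''
  weak := isWeakDeriv_add h.memLp h.memLp' k.memLp k.memLp' h.weak k.weak
  weak' := isWeakDeriv_add h.memLp' h.memLp'' k.memLp' k.memLp'' h.weak' k.weak'
  cont := h.cont.add k.cont
  cont' := h.cont'.add k.cont'

theorem IsW2.smul {p : ℝ≥0∞} {a b : ℝ} {u u' u'' : ℝ → ℝ} (c : ℝ)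
    (h : IsW2 p a b u u' u'') : IsW2 p a b (c • u) (c • u') (c • u'') where
  memLp := h.memLp.const_smul c
  memLp' := h.memLp'.const_smul c
  memLp'' := h.memLp''.const_smul c
  weak := isWeakDeriv_smul c h.weak
  weak' := isWeakDeriv_smul c h.weak'
  cont := h.cont.const_smul c
  cont' := h.cont'.const_smul c

theorem ae_eq_zero_of_test {p : ℝ≥0∞} [hp : Fact (1 ≤ p)] {a b : ℝ} {u : ℝ → ℝ}
    (hu : MemLp u p (intervalMeasure a b))
    (h : ∀ φ : ℝ → ℝ, ContDiff ℝ ∞ φ → HasCompactSupport φ → tsupport φ ⊆ Ioo a b →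
      ∫ x in Ioo a b, u x * φ x = 0) : u =ᵐ[intervalMeasure a b] 0 := by
  have : IsFiniteMeasure (intervalMeasure a b) := ⟨by simp [intervalMeasure]⟩
  have hint : IntegrableOn u (Ioo a b) := hu.integrable hp.out
  have := isOpen_Ioo.ae_eq_zero_of_integral_contDiff_smul_eq_zero hint.locallyIntegrableOn
    (fun g h1 h2 h3 => by
      rw [← h g h1 h2 h3, ← setIntegral_eq_integral_of_forall_compl_eq_zero (s := Ioo a b)]
      · simp [mul_comm]
      · intro x hx
        rw [image_eq_zero_of_notMem_tsupport (fun hx' => hx (h3 hx')), zero_smul])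
  exact (ae_restrict_iff' measurableSet_Ioo).2 this

/-- Weak derivatives are unique. -/
theorem isWeakDeriv_unique {p : ℝ≥0∞} [Fact (1 ≤ p)] {a b : ℝ} {u v w : ℝ → ℝ}
    (hv : MemLp v p (intervalMeasure a b)) (hw : MemLp w p (intervalMeasure a b))
    (h : IsWeakDeriv a b u v) (k : IsWeakDeriv a b u w) : v =ᵐ[intervalMeasure a b] w := by
  have : v - w =ᵐ[intervalMeasure a b] 0 := by
    refine ae_eq_zero_of_test (hv.sub hw) fun φ h1 h2 h3 => ?_
    simp only [Pi.sub_apply, sub_mul]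
    rw [integral_sub (memLp_mul_test hv h1.continuous h2) (memLp_mul_test hw h1.continuous h2)]
    linarith [h φ h1 h2 h3, k φ h1 h2 h3]
  filter_upwards [this] with x hx
  simpa [sub_eq_zero] using hx

/-- Every test function with integral zero is the derivative of a test function. -/
theorem exists_primitive_test {a b : ℝ} {θ : ℝ → ℝ} (h1 : ContDiff ℝ ∞ θ)
    (h2 : HasCompactSupport θ) (h3 : tsupport θ ⊆ Ioo a b) (h0 : ∫ x, θ x = 0) :
    ∃ φ : ℝ → ℝ, ContDiff ℝ ∞ φ ∧ HasCompactSupport φ ∧ tsupport φ ⊆ Ioo a b ∧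
      deriv φ = θ := by
  rcases (tsupport θ).eq_empty_or_nonempty with he | hne
  · have : θ = 0 := by simpa [tsupport_eq_empty_iff] using he
    exact ⟨0, contDiff_const, HasCompactSupport.zero, by simp [tsupport_eq_empty_iff.2],
      by subst this; ext; simp⟩
  have hK : IsCompact (tsupport θ) := h2
  obtain ⟨c, hc, hcm⟩ := hK.exists_isLeast hne
  obtain ⟨d, hd, hdm⟩ := hK.exists_isGreatest hne
  have hsupp : ∀ x, x ∉ Icc c d → θ x = 0 := fun x hx =>
    image_eq_zero_of_notMem_tsupport fun h => hx ⟨hcm h, hdm h⟩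
  have hθ : Continuous θ := h1.continuous
  have hder : ∀ x, HasDerivAt (fun y => ∫ t in c..y, θ t) (θ x) x := fun x =>
    intervalIntegral.integral_hasDerivAt_right (hθ.intervalIntegrable _ _)
      (hθ.stronglyMeasurableAtFilter _ _) hθ.continuousAt
  have hdφ : deriv (fun y => ∫ t in c..y, θ t) = θ := funext fun x => (hder x).deriv
  have hcd : c ≤ d := hcm hd
  have hz : ∀ x, x ∉ Icc c d → ∫ t in c..x, θ t = 0 := by
    intro x hx
    rcases lt_or_ge x c with hxc | hxc
    · rw [intervalIntegral.integral_symm, intervalIntegral.integral_of_le hxc.le,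
        ← integral_Ico_eq_integral_Ioc, setIntegral_eq_zero_of_forall_eq_zero, neg_zero]
      intro t ht
      exact hsupp t fun h => absurd h.1 (not_le.2 ht.2)
    · have hdx : d < x := by
        by_contra hh
        exact hx ⟨hxc, not_lt.1 hh⟩
      rw [intervalIntegral.integral_of_le hxc, ← integral_Icc_eq_integral_Ioc,
        setIntegral_eq_integral_of_forall_compl_eq_zero, h0]
      intro t ht
      exact hsupp t fun h => ht ⟨h.1, h.2.trans hdx.le⟩
  have hts : tsupport (fun y => ∫ t in c..y, θ t) ⊆ Icc c d :=
    closure_minimal (fun x hx => by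
      by_contra hh
      exact hx (hz x hh)) isClosed_Icc
  refine ⟨fun y => ∫ t in c..y, θ t, ?_, ?_, ?_, hdφ⟩
  · rw [contDiff_infty_iff_deriv, hdφ]
    exact ⟨fun x => (hder x).differentiableAt, h1⟩
  · exact HasCompactSupport.of_support_subset_isCompact isCompact_Icc
      ((subset_tsupport _).trans hts)
  · exact hts.trans fun x hx => ⟨(h3 hc).1.trans_le hx.1, hx.2.trans_lt (h3 hd).2⟩

/-- A continuous function with vanishing weak derivative is constant. -/
theorem eq_of_isWeakDeriv_zero {a b : ℝ} {u v : ℝ → ℝ}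
    (hu : ContinuousOn u (Icc a b)) (hv : v =ᵐ[intervalMeasure a b] 0)
    (h : IsWeakDeriv a b u v) : ∀ x ∈ Icc a b, u x = u a := by
  intro x hx
  rcases (hx.1.trans hx.2).eq_or_lt with hab | hab
  · have : x = a := le_antisymm (hab ▸ hx.2) hx.1
    rw [this]
  have hzero : ∀ φ : ℝ → ℝ, ContDiff ℝ ∞ φ → HasCompactSupport φ → tsupport φ ⊆ Ioo a b →
      ∫ x in Ioo a b, u x * deriv φ x = 0 := by
    intro φ h1 h2 h3
    rw [h φ h1 h2 h3, neg_eq_zero]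
    refine integral_eq_zero_of_ae ?_
    filter_upwards [hv] with y hy
    simp [hy]
  have hmid : (a + b) / 2 ∈ Ioo a b := ⟨by linarith, by linarith⟩
  obtain ⟨η, hη3, hη2, hη1, hηr, hηm⟩ :=
    exists_contDiff_tsupport_subset (n := ⊤) (isOpen_Ioo.mem_nhds hmid)
  have hηint : Integrable η := hη1.continuous.integrable_of_hasCompactSupport hη2
  have hηpos : 0 < ∫ x, η x := by
    refine hη1.continuous.integral_pos_of_hasCompactSupport_nonneg_nonzero hη2
      (fun y => (hηr (mem_range_self y)).1) (x := (a + b) / 2) (by rw [hηm]; exact one_ne_zero)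
  set I := ∫ x, η x with hI
  set c : ℝ := (∫ x in Ioo a b, u x * η x) / I with hc
  have huL : MemLp u 1 (intervalMeasure a b) := by
    rw [memLp_one_iff_integrable]
    exact hu.integrableOn_Icc.mono_set Ioo_subset_Icc_self
  have huc : MemLp (fun x => u x - c) 1 (intervalMeasure a b) := by
    have : IsFiniteMeasure (intervalMeasure a b) := ⟨by simp [intervalMeasure]⟩
    exact huL.sub (memLp_const c)
  have : Fact ((1 : ℝ≥0∞) ≤ 1) := ⟨le_rfl⟩
  have hae : (fun x => u x - c) =ᵐ[intervalMeasure a b] 0 := by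
    refine ae_eq_zero_of_test huc fun ψ h1 h2 h3 => ?_
    have hψint : Integrable ψ := h1.continuous.integrable_of_hasCompactSupport h2
    set k := (∫ x, ψ x) / I with hk
    have hts : tsupport (ψ - k • η) ⊆ Ioo a b := by
      refine (tsupport_sub _ _).trans (union_subset h3 ?_)
      exact (closure_mono (Function.support_const_smul_subset k η)).trans hη3
    obtain ⟨φ, f1, f2, f3, f4⟩ := exists_primitive_test (a := a) (b := b) (θ := ψ - k • η)
      (h1.sub (hη1.const_smul k)) (h2.sub (hη2.smul_left (f := fun _ => k))) hts (by
        simp only [Pi.sub_apply, Pi.smul_apply, smul_eq_mul]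
        rw [integral_sub hψint (hηint.const_mul k), integral_const_mul, ← hI, hk]
        field_simp
        ring)
    have e := hzero φ f1 f2 f3
    rw [f4] at e
    simp only [Pi.sub_apply, Pi.smul_apply, smul_eq_mul, mul_sub] at e
    have i1 := memLp_mul_test huL h1.continuous h2
    have i2 := memLp_mul_test huL hη1.continuous hη2
    have e2 : ∀ x, u x * (k * η x) = k * (u x * η x) := fun x => by ring
    simp only [e2] at e
    rw [integral_sub i1 (i2.const_mul k), integral_const_mul] at e
    simp only [sub_mul]
    rw [integral_sub i1 (hψint.const_mul c).integrableOn, integral_const_mul]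
    have e3 : ∫ x in Ioo a b, ψ x = ∫ x, ψ x := by
      refine setIntegral_eq_integral_of_forall_compl_eq_zero fun x hx => ?_
      exact image_eq_zero_of_notMem_tsupport fun h => hx (h3 h)
    rw [e3]
    have e4 : c * ∫ x, ψ x = k * ∫ x in Ioo a b, u x * η x := by
      rw [hc, hk]; ring
    rw [e4]; exact e
  have hIoo : EqOn u (fun _ => c) (Ioo a b) := by
    have : u =ᵐ[volume.restrict (Ioo a b)] fun _ => c := by
      filter_upwards [hae] with y hy
      exact sub_eq_zero.1 hy
    exact Measure.eqOn_open_of_ae_eq this isOpen_Ioo (hu.mono Ioo_subset_Icc_self)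
      continuousOn_const
  have hIcc : EqOn u (fun _ => c) (Icc a b) :=
    hIoo.of_subset_closure hu continuousOn_const Ioo_subset_Icc_self
      (by rw [closure_Ioo hab.ne])
  rw [hIcc hx, hIcc ⟨le_rfl, hab.le⟩]

/-- A function in `W_p^2` with `u'' = 0` and `u(a) = u'(a) = 0` vanishes. -/
theorem IsW2.eq_zero {p : ℝ≥0∞} {a b : ℝ} {u u' u'' : ℝ → ℝ}
    (h : IsW2 p a b u u' u'') (ha : u a = 0) (ha' : u' a = 0)
    (h0 : u'' =ᵐ[intervalMeasure a b] 0) : ∀ x ∈ Icc a b, u x = 0 := by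
  have h1 := eq_of_isWeakDeriv_zero h.cont' h0 h.weak'
  have h2 : u' =ᵐ[intervalMeasure a b] 0 := by
    refine (ae_restrict_iff' measurableSet_Ioo).2 (Eventually.of_forall fun x hx => ?_)
    rw [h1 x (Ioo_subset_Icc_self hx), ha']; rfl
  intro x hx
  rw [eq_of_isWeakDeriv_zero h.cont h2 h.weak x hx, ha]

/-- The primitive of an integrable function has this function as weak derivative. -/
theorem isWeakDeriv_primitive {a b : ℝ} (hab : a ≤ b) {f : ℝ → ℝ}
    (hf : IntervalIntegrable f volume a b) :
    IsWeakDeriv a b (fun x => ∫ t in a..x, f t) f := by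
  intro φ h1 h2 h3
  have hac := hf.absolutelyContinuousOnInterval_intervalIntegral (c := a) (by simp)
  have hφ : AbsolutelyContinuousOnInterval φ a b :=
    (h1.of_le (by simp)).contDiffOn.absolutelyContinuousOnInterval
  have e := hac.integral_mul_deriv_eq_deriv_mul hφ
  have hφb : φ b = 0 := image_eq_zero_of_notMem_tsupport fun h => lt_irrefl _ (h3 h).2
  rw [hφb, intervalIntegral.integral_same, mul_zero, zero_mul, sub_zero, zero_sub] at e
  have e2 : ∫ x in a..b, deriv (fun x => ∫ t in a..x, f t) x * φ x = ∫ x in a..b, f x * φ x := by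
    refine intervalIntegral.integral_congr_ae ?_
    filter_upwards [hf.ae_hasDerivAt_integral] with x hx hx'
    rw [(hx (uIoc_subset_uIcc hx') a (by simp)).deriv]
  rw [e2, intervalIntegral.integral_of_le hab, intervalIntegral.integral_of_le hab,
    integral_Ioc_eq_integral_Ioo, integral_Ioc_eq_integral_Ioo] at e
  exact e

/-- The twofold primitive of a function in `L_p` lies in `W_p^2`. -/
theorem isW2_primitive {p : ℝ≥0∞} [hp : Fact (1 ≤ p)] {a b : ℝ} (hab : a ≤ b) {f : ℝ → ℝ}
    (hf : MemLp f p (intervalMeasure a b)) :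
    IsW2 p a b (fun x => ∫ s in a..x, ∫ t in a..s, f t) (fun x => ∫ t in a..x, f t) f := by
  have : IsFiniteMeasure (intervalMeasure a b) := ⟨by simp [intervalMeasure]⟩
  have hfi : IntervalIntegrable f volume a b := by
    rw [intervalIntegrable_iff_integrableOn_Ioo_of_le hab]
    exact hf.integrable hp.out
  have hbd : ∀ g : ℝ → ℝ, ContinuousOn g (Icc a b) → MemLp g p (intervalMeasure a b) := by
    intro g hg
    obtain ⟨C, hC⟩ := isCompact_Icc.exists_bound_of_continuousOn hg
    refine MemLp.of_bound ((hg.mono Ioo_subset_Icc_self).aestronglyMeasurable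
      measurableSet_Ioo) C ?_
    exact (ae_restrict_iff' measurableSet_Ioo).2
      (Eventually.of_forall fun x hx => hC x (Ioo_subset_Icc_self hx))
  have hc1 : ContinuousOn (fun x => ∫ t in a..x, f t) (Icc a b) := by
    have := (hfi.absolutelyContinuousOnInterval_intervalIntegral (c := a) (by simp)).continuousOn
    rwa [uIcc_of_le hab] at this
  have hi1 : IntervalIntegrable (fun x => ∫ t in a..x, f t) volume a b :=
    ContinuousOn.intervalIntegrable (by rwa [uIcc_of_le hab])
  have hc2 : ContinuousOn (fun x => ∫ s in a..x, ∫ t in a..s, f t) (Icc a b) := by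
    have := (hi1.absolutelyContinuousOnInterval_intervalIntegral (c := a) (by simp)).continuousOn
    rwa [uIcc_of_le hab] at this
  exact ⟨hbd _ hc2, hbd _ hc1, hf, isWeakDeriv_primitive hab hi1, isWeakDeriv_primitive hab hfi,
    hc2, hc1⟩

theorem IsW2.zero (p : ℝ≥0∞) (a b : ℝ) : IsW2 p a b 0 0 0 where
  memLp := MemLp.zero
  memLp' := MemLp.zero
  memLp'' := MemLp.zero
  weak := fun φ _ _ _ => by simp
  weak' := fun φ _ _ _ => by simp
  cont := continuousOn_const
  cont' := continuousOn_const

/-- The second weak derivative of an element of `W_p^2` is unique. -/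
theorem IsW2.second_unique {p : ℝ≥0∞} [Fact (1 ≤ p)] {a b : ℝ} {u u' u'' v v' v'' : ℝ → ℝ}
    (h : IsW2 p a b u u' u'') (k : IsW2 p a b v v' v'') (e : u =ᵐ[intervalMeasure a b] v) :
    u'' =ᵐ[intervalMeasure a b] v'' := by
  have tr : ∀ {f g : ℝ → ℝ}, f =ᵐ[intervalMeasure a b] g → ∀ {w : ℝ → ℝ},
      IsWeakDeriv a b g w → IsWeakDeriv a b f w := by
    intro f g hfg w hw φ h1 h2 h3
    rw [← hw φ h1 h2 h3]
    refine integral_congr_ae ?_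
    filter_upwards [hfg] with x hx
    rw [hx]
  have e1 := isWeakDeriv_unique h.memLp' k.memLp' h.weak (tr e k.weak)
  exact isWeakDeriv_unique h.memLp'' k.memLp'' h.weak' (tr e1 k.weak')

theorem subsingleton_of_lt {p : ℝ≥0∞} {a b : ℝ} (hab : b < a) : Subsingleton (LpInterval p a b) := by
  refine ⟨fun f g => Lp.ext ?_⟩
  have : intervalMeasure a b = 0 := by simp [intervalMeasure, Ioo_eq_empty hab.le.not_gt]
  have h0 : ae (intervalMeasure a b) = ⊥ := ae_eq_bot.2 this
  simp only [EventuallyEq, h0, eventually_bot]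

end facts

/-- The subspace of `L_p(a, b)` of (classes of) functions `u` in `W_p^2(a, b)` that vanish at the
left endpoint `a` to the order `2`, that is, `u(a) = u'(a) = 0`. -/
def leftSubmodule (p : ℝ≥0∞) [Fact (1 ≤ p)] (a b : ℝ) : Submodule ℝ (LpInterval p a b) where
  carrier := {f | ∃ u u' u'' : ℝ → ℝ, IsW2 p a b u u' u'' ∧ u a = 0 ∧ u' a = 0 ∧
    f =ᵐ[intervalMeasure a b] u}
  zero_mem' := ⟨0, 0, 0, IsW2.zero p a b, rfl, rfl, Lp.coeFn_zero _ _ _⟩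
  add_mem' := by
    rintro f g ⟨u, u', u'', h, h0, h0', hf⟩ ⟨v, v', v'', k, k0, k0', hg⟩
    refine ⟨u + v, u' + v', u'' + v'', h.add k, by simp [h0, k0], by simp [h0', k0'], ?_⟩
    exact (Lp.coeFn_add f g).trans (hf.add hg)
  smul_mem' := by
    rintro c f ⟨u, u', u'', h, h0, h0', hf⟩
    refine ⟨c • u, c • u', c • u'', h.smul c, by simp [h0], by simp [h0'], ?_⟩
    exact (Lp.coeFn_smul c f).trans (hf.const_smul c)

/-- The Sobolev space of all `u` in `W_p^2(a, b)` with `u(a) = u'(a) = 0`. Its norm, introduced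
below, is `‖u''‖_p`, not the norm of `L_p(a, b)`. -/
def SobolevLeft (p : ℝ≥0∞) [Fact (1 ≤ p)] (a b : ℝ) : Type := leftSubmodule p a b

namespace SobolevLeft

variable (p : ℝ≥0∞) [Fact (1 ≤ p)] (a b : ℝ)

instance instAddCommGroup : AddCommGroup (SobolevLeft p a b) :=
  inferInstanceAs (AddCommGroup (leftSubmodule p a b))

instance instModule : Module ℝ (SobolevLeft p a b) :=
  inferInstanceAs (Module ℝ (leftSubmodule p a b))

/-- The inclusion of the Sobolev space in `L_p(a, b)` as a linear map. -/
def inclusion : SobolevLeft p a b →ₗ[ℝ] LpInterval p a b := (leftSubmodule p a b).subtype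

variable {p a b}

theorem exists_isW2 (u : SobolevLeft p a b) : ∃ (g : LpInterval p a b) (v v' : ℝ → ℝ),
    IsW2 p a b v v' g ∧ v a = 0 ∧ v' a = 0 ∧ inclusion p a b u =ᵐ[intervalMeasure a b] v := by
  obtain ⟨v, v', v'', h, h0, h0', e⟩ := u.2
  refine ⟨h.memLp''.toLp v'', v, v', ?_, h0, h0', e⟩
  have hae := h.memLp''.coeFn_toLp
  refine ⟨h.memLp, h.memLp', Lp.memLp _, h.weak, ?_, h.cont, h.cont'⟩
  intro φ h1 h2 h3
  rw [h.weak' φ h1 h2 h3, neg_inj]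
  refine integral_congr_ae ?_
  filter_upwards [hae] with x hx
  rw [hx]

variable (p a b)

/-- The second weak derivative `u ↦ u''` as a linear map into `L_p(a, b)`. -/
def secondDeriv : SobolevLeft p a b →ₗ[ℝ] LpInterval p a b where
  toFun u := (exists_isW2 u).choose
  map_add' u w := by
    obtain ⟨v, v', h, _, _, e⟩ := (exists_isW2 u).choose_spec
    obtain ⟨z, z', k, _, _, e'⟩ := (exists_isW2 w).choose_spec
    obtain ⟨y, y', l, _, _, e''⟩ := (exists_isW2 (u + w)).choose_spec
    refine Lp.ext (((l.second_unique (h.add k)) ?_).trans (Lp.coeFn_add _ _).symm)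
    rw [map_add] at e''
    exact e''.symm.trans ((Lp.coeFn_add _ _).trans (e.add e'))
  map_smul' c u := by
    obtain ⟨v, v', h, _, _, e⟩ := (exists_isW2 u).choose_spec
    obtain ⟨y, y', l, _, _, e''⟩ := (exists_isW2 (c • u)).choose_spec
    refine Lp.ext (((l.second_unique (h.smul c)) ?_).trans (Lp.coeFn_smul _ _).symm)
    rw [map_smul] at e''
    exact e''.symm.trans ((Lp.coeFn_smul _ _).trans (e.const_smul c))

variable {p a b}

theorem secondDeriv_spec (u : SobolevLeft p a b) : ∃ v v' : ℝ → ℝ,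
    IsW2 p a b v v' (secondDeriv p a b u) ∧ v a = 0 ∧ v' a = 0 ∧
      inclusion p a b u =ᵐ[intervalMeasure a b] v :=
  (exists_isW2 u).choose_spec

theorem inclusion_injective : Function.Injective (inclusion p a b) :=
  (leftSubmodule p a b).injective_subtype

theorem secondDeriv_injective : Function.Injective (secondDeriv p a b) := by
  rw [injective_iff_map_eq_zero]
  intro u hu
  obtain ⟨v, v', h, h0, h0', e⟩ := secondDeriv_spec u
  have hz : secondDeriv p a b u =ᵐ[intervalMeasure a b] 0 := by
    rw [hu]; exact Lp.coeFn_zero _ _ _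
  have hv := h.eq_zero h0 h0' hz
  apply inclusion_injective
  rw [map_zero]
  refine Lp.ext (e.trans (EventuallyEq.trans ?_ (Lp.coeFn_zero _ _ _).symm))
  exact (ae_restrict_iff' measurableSet_Ioo).2
    (Eventually.of_forall fun x hx => hv x (Ioo_subset_Icc_self hx))

theorem exists_primitive (hab : a ≤ b) (f : LpInterval p a b) : ∃ u : SobolevLeft p a b,
    secondDeriv p a b u = f ∧
      inclusion p a b u =ᵐ[intervalMeasure a b] fun x => ∫ s in a..x, ∫ t in a..s, f t := by
  have h := isW2_primitive hab (Lp.memLp f)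
  let u : SobolevLeft p a b := ⟨h.memLp.toLp _, _, _, _, h,
    intervalIntegral.integral_same, intervalIntegral.integral_same, h.memLp.coeFn_toLp⟩
  have hu : inclusion p a b u =ᵐ[intervalMeasure a b] fun x => ∫ s in a..x, ∫ t in a..s, f t :=
    h.memLp.coeFn_toLp
  refine ⟨u, ?_, hu⟩
  obtain ⟨v, v', k, _, _, e⟩ := secondDeriv_spec u
  exact Lp.ext (k.second_unique h (e.symm.trans hu))

theorem secondDeriv_surjective : Function.Surjective (secondDeriv p a b) := by
  intro f
  rcases le_or_gt a b with hab | hab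
  · obtain ⟨u, hu, _⟩ := exists_primitive hab f
    exact ⟨u, hu⟩
  · have := subsingleton_of_lt (p := p) hab
    exact ⟨0, Subsingleton.elim _ _⟩

variable (p a b)

/-- The norm `‖u''‖_p`. -/
instance instNormedAddCommGroup : NormedAddCommGroup (SobolevLeft p a b) :=
  NormedAddCommGroup.induced _ _ (secondDeriv p a b) secondDeriv_injective

variable {p a b}

theorem norm_def (u : SobolevLeft p a b) : ‖u‖ = ‖secondDeriv p a b u‖ := rfl

instance instNormedSpace : NormedSpace ℝ (SobolevLeft p a b) where
  norm_smul_le c u := by rw [norm_def, norm_def, map_smul, norm_smul]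

instance instCompleteSpace : CompleteSpace (SobolevLeft p a b) := by
  have hi : Isometry (secondDeriv p a b) := AddMonoidHomClass.isometry_of_norm _ fun u => rfl
  exact (IsometryEquiv.mk (Equiv.ofBijective _ ⟨secondDeriv_injective, secondDeriv_surjective⟩)
    hi).completeSpace

theorem exists_bound : ∃ C : ℝ, ∀ u : SobolevLeft p a b, ‖inclusion p a b u‖ ≤ C * ‖u‖ := by
  rcases lt_or_ge b a with hab | hab
  · have := subsingleton_of_lt (p := p) hab
    exact ⟨0, fun u => by rw [Subsingleton.elim (inclusion p a b u) 0]; simp⟩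
  have : IsFiniteMeasure (intervalMeasure a b) := ⟨by simp [intervalMeasure]⟩
  have hp : (1 : ℝ≥0∞) ≤ p := Fact.out
  set m := intervalMeasure a b univ with hm
  have hmt : m ≠ ⊤ := measure_ne_top _ _
  set A : ℝ≥0∞ := m ^ p.toReal⁻¹ with hA
  set B : ℝ≥0∞ := m ^ (1 / (1 : ℝ≥0∞).toReal - 1 / p.toReal) with hB
  have hAt : A ≠ ⊤ := ENNReal.rpow_ne_top_of_nonneg (by positivity) hmt
  have hBt : B ≠ ⊤ := by
    refine ENNReal.rpow_ne_top_of_nonneg ?_ hmt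
    rcases eq_or_ne p ⊤ with rfl | hpt
    · simp
    · have : 1 ≤ p.toReal := by simpa using ENNReal.toReal_mono hpt hp
      have : 1 / p.toReal ≤ 1 := by
        rw [div_le_one (by linarith)]; exact this
      simpa using this
  refine ⟨A.toReal * ((b - a) * B.toReal), fun u => ?_⟩
  set f := secondDeriv p a b u with hf
  obtain ⟨w, hw, hwe⟩ := exists_primitive hab f
  have hwu : w = u := secondDeriv_injective hw
  rw [hwu] at hwe
  have hfi : IntegrableOn f (Ioo a b) := (Lp.memLp f).integrable hp
  have hfI : IntegrableOn f (Ioc a b) := hfi.congr_set_ae Ioo_ae_eq_Ioc.symm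
  set N := ∫ x in Ioc a b, ‖f x‖ with hN
  have hN0 : 0 ≤ N := integral_nonneg fun _ => norm_nonneg _
  have hNle : N ≤ B.toReal * ‖f‖ := by
    have h1 := eLpNorm_le_eLpNorm_mul_rpow_measure_univ (μ := intervalMeasure a b) hp
      (Lp.aestronglyMeasurable f)
    have h2 := ENNReal.toReal_mono (ENNReal.mul_ne_top (Lp.eLpNorm_ne_top f) hBt) h1
    rw [ENNReal.toReal_mul, ← Lp.norm_def] at h2
    have h3 : (eLpNorm f 1 (intervalMeasure a b)).toReal = N := by
      rw [hN, integral_Ioc_eq_integral_Ioo, integral_norm_eq_lintegral_enorm hfi.1,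
        eLpNorm_one_eq_lintegral_enorm]
    rw [h3] at h2
    linarith
  have hb1 : ∀ s ∈ Icc a b, ‖∫ t in a..s, f t‖ ≤ N := by
    intro s hs
    rw [intervalIntegral.integral_of_le hs.1]
    refine (norm_integral_le_integral_norm _).trans ?_
    exact setIntegral_mono_set hfI.norm (Eventually.of_forall fun _ => norm_nonneg _)
      (Ioc_subset_Ioc_right hs.2).eventuallyLE
  have hb2 : ∀ x ∈ Icc a b, ‖∫ s in a..x, ∫ t in a..s, f t‖ ≤ (b - a) * N := by
    intro x hx
    have := intervalIntegral.norm_integral_le_of_norm_le_const (a := a) (b := x) (C := N)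
      (f := fun s => ∫ t in a..s, f t) (fun s hs => by
        rw [uIoc_of_le hx.1] at hs
        exact hb1 s ⟨hs.1.le, hs.2.trans hx.2⟩)
    refine this.trans ?_
    rw [abs_of_nonneg (by linarith [hx.1]), mul_comm]
    exact mul_le_mul_of_nonneg_right (by linarith [hx.2]) hN0
  have hae : ∀ᵐ x ∂intervalMeasure a b, ‖inclusion p a b u x‖ ≤ (b - a) * N := by
    filter_upwards [hwe, ae_restrict_mem measurableSet_Ioo] with x hx hx'
    rw [hx]
    exact hb2 x (Ioo_subset_Icc_self hx')
  have h4 := ENNReal.toReal_mono (ENNReal.mul_ne_top hAt ENNReal.ofReal_ne_top)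
    (eLpNorm_le_of_ae_bound (p := p) hae)
  rw [ENNReal.toReal_mul, ← Lp.norm_def,
    ENNReal.toReal_ofReal (mul_nonneg (by linarith) hN0)] at h4
  refine h4.trans ?_
  rw [norm_def, mul_assoc, mul_assoc]
  gcongr

variable (p a b)

/-- The embedding of the Sobolev space in `L_p(a, b)`. -/
def embedding : SobolevLeft p a b →L[ℝ] LpInterval p a b :=
  (inclusion p a b).mkContinuousOfExistsBound exists_bound

end SobolevLeft

/-- The affine function that interpolates `u` at the endpoints of `(c, d)`. -/
def affineInterp (c d : ℝ) (u : ℝ → ℝ) (x : ℝ) : ℝ := u c + (u d - u c) / (d - c) * (x - c)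

/-- The constant `B(c, d)`: the supremum of `‖u - K u‖_p / ‖u''‖_p` over all `u` in `W_p^2(c, d)`
with `u'' ≠ 0`, where `K u` interpolates `u` at the endpoints. -/
def interpConst (p : ℝ≥0∞) (c d : ℝ) : ℝ :=
  sSup {r | ∃ u u' u'' : ℝ → ℝ, IsW2 p c d u u' u'' ∧ ¬ u'' =ᵐ[intervalMeasure c d] 0 ∧
    r = (eLpNorm (u - affineInterp c d u) p (intervalMeasure c d)).toReal /
      (eLpNorm u'' p (intervalMeasure c d)).toReal}

/-- The `n`-th approximation number, for `n ≥ 1`. -/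
def approxNumber {X Y : Type*} [NormedAddCommGroup X] [NormedSpace ℝ X] [NormedAddCommGroup Y]
    [NormedSpace ℝ Y] (T : X →L[ℝ] Y) (n : ℕ) : ℝ :=
  sInf {r | ∃ F : X →L[ℝ] Y, LinearMap.rank (F : X →ₗ[ℝ] Y) < (n : Cardinal) ∧ r = ‖T - F‖}

/-- The `n`-th Bernstein number, for `n ≥ 1`. -/
def bernsteinNumber {X Y : Type*} [NormedAddCommGroup X] [NormedSpace ℝ X]
    [NormedAddCommGroup Y] [NormedSpace ℝ Y] (T : X →L[ℝ] Y) (n : ℕ) : ℝ :=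
  sSup {r | ∃ V : Submodule ℝ X, Module.rank ℝ V = (n : Cardinal) ∧
    r = sInf {t | ∃ x ∈ V, x ≠ 0 ∧ t = ‖T x‖ / ‖x‖}}

/-- A rule that assigns a sequence of real numbers to every bounded linear map between real Banach
spaces. The value at the index `0` carries no meaning. -/
abbrev OperatorSequence : Type 1 :=
  ∀ (X Y : Type) [NormedAddCommGroup X] [NormedSpace ℝ X] [CompleteSpace X]
    [NormedAddCommGroup Y] [NormedSpace ℝ Y] [CompleteSpace Y], (X →L[ℝ] Y) → ℕ → ℝ

/-- The axioms of strict `s`-numbers. The sum axiom is the weaker one of the two customary ones. -/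
structure IsStrictSNumber (s : OperatorSequence) : Prop where
  one : ∀ (X Y : Type) [NormedAddCommGroup X] [NormedSpace ℝ X] [CompleteSpace X]
    [NormedAddCommGroup Y] [NormedSpace ℝ Y] [CompleteSpace Y] (T : X →L[ℝ] Y),
    s X Y T 1 = ‖T‖
  anti : ∀ (X Y : Type) [NormedAddCommGroup X] [NormedSpace ℝ X] [CompleteSpace X]
    [NormedAddCommGroup Y] [NormedSpace ℝ Y] [CompleteSpace Y] (T : X →L[ℝ] Y) (n : ℕ),
    1 ≤ n → s X Y T (n + 1) ≤ s X Y T n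
  nonneg : ∀ (X Y : Type) [NormedAddCommGroup X] [NormedSpace ℝ X] [CompleteSpace X]
    [NormedAddCommGroup Y] [NormedSpace ℝ Y] [CompleteSpace Y] (T : X →L[ℝ] Y) (n : ℕ),
    1 ≤ n → 0 ≤ s X Y T n
  add_le : ∀ (X Y : Type) [NormedAddCommGroup X] [NormedSpace ℝ X] [CompleteSpace X]
    [NormedAddCommGroup Y] [NormedSpace ℝ Y] [CompleteSpace Y] (S T : X →L[ℝ] Y) (n : ℕ),
    1 ≤ n → s X Y (S + T) n ≤ s X Y S n + ‖T‖
  comp_le : ∀ (W X Y Z : Type) [NormedAddCommGroup W] [NormedSpace ℝ W] [CompleteSpace W]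
    [NormedAddCommGroup X] [NormedSpace ℝ X] [CompleteSpace X]
    [NormedAddCommGroup Y] [NormedSpace ℝ Y] [CompleteSpace Y]
    [NormedAddCommGroup Z] [NormedSpace ℝ Z] [CompleteSpace Z]
    (R : Y →L[ℝ] Z) (T : X →L[ℝ] Y) (A : W →L[ℝ] X) (n : ℕ),
    1 ≤ n → s W Z (R.comp (T.comp A)) n ≤ ‖R‖ * s X Y T n * ‖A‖
  rank_lt : ∀ (X Y : Type) [NormedAddCommGroup X] [NormedSpace ℝ X] [CompleteSpace X]
    [NormedAddCommGroup Y] [NormedSpace ℝ Y] [CompleteSpace Y] (T : X →L[ℝ] Y) (n : ℕ),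
    1 ≤ n → LinearMap.rank (T : X →ₗ[ℝ] Y) < (n : Cardinal) → s X Y T n = 0
  id_eq_one : ∀ (X : Type) [NormedAddCommGroup X] [NormedSpace ℝ X] [CompleteSpace X] (n : ℕ),
    1 ≤ n → (n : Cardinal) ≤ Module.rank ℝ X → s X X (ContinuousLinearMap.id ℝ X) n = 1

/-- Injectivity: the numbers do not change under a metric injection of the target space. -/
def IsInjectiveSNumber (s : OperatorSequence) : Prop :=
  ∀ (X Y Z : Type) [NormedAddCommGroup X] [NormedSpace ℝ X] [CompleteSpace X]
    [NormedAddCommGroup Y] [NormedSpace ℝ Y] [CompleteSpace Y]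
    [NormedAddCommGroup Z] [NormedSpace ℝ Z] [CompleteSpace Z]
    (T : X →L[ℝ] Y) (J : Y →L[ℝ] Z), (∀ y, ‖J y‖ = ‖y‖) → ∀ n : ℕ, 1 ≤ n →
    s X Z (J.comp T) n = s X Y T n

end EmbeddingNumbers

end

open EmbeddingNumbers

/-! A function `u` with `u(a) = u'(a) = 0` is the twofold primitive of `u''`, so the embedding is
the operator `prim2` on `L_p` in disguise. In the same way `u - Ku` is minus the solution of `-v'' =
u''`, `v(0) = v(1) = 0`, so `interpConst p 0 1` is the norm of the solution operator `navier` on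
`L_p(0, 1)`. Below, `B` is this constant and `r = p`.

Upper bound. Piecewise linear interpolation on `n - 1` equal cells has rank at most `n - 1`, because
the value at `a` is zero. On a cell of length `h` its error is `h ^ 2` times a rescaled Navier
solution (`integral_interp_error_rpow_le`), so the distance to the embedding is at most `(|I| / (n -
1)) ^ 2 B`. For `n = 1` the claim is the norm bound `4 |I| ^ 2 B`, which comes from a comparison of
kernels (`integral_prim2_rpow_le`).

Lower bound. For every `c < B` there is an `n`-dimensional space on which the embedding is bounded
below by `(|I| / n) ^ 2 c` (`hasLowerBoundOfDim_embedding`); this bounds the approximation numbers,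
the Bernstein numbers and all injective strict `s`-numbers at once. After rescaling to `(0, n)`, the
second derivatives are spanned by `n` disjoint bumps: half a bump on `(0, 1/2)` and full symmetric
bumps around `1, ..., n - 1`. Their twofold primitives are tested against dual bumps around `1, ...,
n - 1` and half a dual bump at the right end. Hölder's inequality on the disjoint supports of the
dual bumps reduces the claim to an `ℓ_r` lower bound for the matrix of pairings (`exists_chain`).
The shapes of the bumps are a nearly extremal pair for the Navier problem, whose pairing `l` is at
least `c` (`exists_halfBumps`); positivity of the Green function and Hölder's inequality on pairs of
reflected points allow nonnegative symmetric shapes.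

The matrix bound. With alternating signs inserted, the matrix has a nonnegative inverse: if the
pairings alternate in sign, so do, by a Rolle argument applied twice, the combination of bumps and
hence its coefficients (`blockMatrix_monotone`). For such a matrix a Schur test with explicit
vectors suffices (`sum_abs_rpow_le_of_monotone`), and there are vectors for which the interior rows
and columns produce exactly `l` (`sum_blockEntry_interior`). -/

namespace EmbeddingNumbers

/-! ### Finite-dimensional lower bounds and the numbers they control -/

section SNumbers

variable {X Y : Type*} [NormedAddCommGroup X] [NormedSpace ℝ X] [NormedAddCommGroup Y]
  [NormedSpace ℝ Y]

/-- `T` is bounded below by `c` on some subspace of dimension `n`. -/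
def HasLowerBoundOfDim (T : X →L[ℝ] Y) (n : ℕ) (c : ℝ) : Prop :=
  ∃ V : Submodule ℝ X, Module.rank ℝ V = (n : Cardinal) ∧ ∀ x ∈ V, c * ‖x‖ ≤ ‖T x‖

theorem HasLowerBoundOfDim.le_bernsteinNumber {T : X →L[ℝ] Y} {n : ℕ} {c : ℝ} (hn : 1 ≤ n)
    (h : HasLowerBoundOfDim T n c) : c ≤ bernsteinNumber T n := by
  have hne : ∀ V : Submodule ℝ X, Module.rank ℝ V = (n : Cardinal) → ∃ x ∈ V, x ≠ 0 := by
    intro V hV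
    have : 0 < Module.rank ℝ V := by rw [hV]; exact_mod_cast hn
    obtain ⟨x, hx⟩ := rank_pos_iff_exists_ne_zero.1 this
    exact ⟨x, x.2, by simpa using hx⟩
  obtain ⟨V, hV, hc⟩ := h
  -- An unbounded set of reals has supremum `0` by default, so boundedness is needed. One nonzero
  -- vector of each space suffices for it.
  have hb : BddAbove {r | ∃ V : Submodule ℝ X, Module.rank ℝ V = (n : Cardinal) ∧
      r = sInf {t | ∃ x ∈ V, x ≠ 0 ∧ t = ‖T x‖ / ‖x‖}} := by
    refine ⟨‖T‖, ?_⟩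
    rintro r ⟨U, hU, rfl⟩
    obtain ⟨x, hx, hx0⟩ := hne U hU
    have h0 : BddBelow {t | ∃ x ∈ U, x ≠ 0 ∧ t = ‖T x‖ / ‖x‖} := by
      refine ⟨0, ?_⟩
      rintro t ⟨y, _, _, rfl⟩
      positivity
    exact (csInf_le h0 ⟨x, hx, hx0, rfl⟩).trans (T.ratio_le_opNorm x)
  refine le_trans ?_ (le_csSup hb ⟨V, hV, rfl⟩)
  obtain ⟨x, hx, hx0⟩ := hne V hV
  refine le_csInf ⟨_, x, hx, hx0, rfl⟩ ?_
  rintro t ⟨y, hy, hy0, rfl⟩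
  rw [le_div_iff₀ (norm_pos_iff.2 hy0)]
  exact hc y hy

/-- A map `F` of rank below `n` kills a nonzero vector of the `n`-dimensional space, and at this
vector `T - F` agrees with `T`. -/
theorem HasLowerBoundOfDim.le_approxNumber {T : X →L[ℝ] Y} {n : ℕ} {c : ℝ} (hn : 1 ≤ n)
    (h : HasLowerBoundOfDim T n c) : c ≤ approxNumber T n := by
  obtain ⟨V, hV, hc⟩ := h
  refine le_csInf ⟨_, 0, ?_, rfl⟩ ?_
  · have : ((0 : X →L[ℝ] Y) : X →ₗ[ℝ] Y) = 0 := rfl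
    rw [this, LinearMap.rank_zero]
    exact_mod_cast hn
  rintro r ⟨F, hF, rfl⟩
  have hni : ¬ Function.Injective ((F : X →ₗ[ℝ] Y).comp V.subtype) := by
    intro hi
    have h1 := LinearMap.lift_rank_le_of_injective _
      ((LinearMap.injective_rangeRestrict_iff _).2 hi)
    have h2 : LinearMap.rank ((F : X →ₗ[ℝ] Y).comp V.subtype) < (n : Cardinal) :=
      (Submodule.rank_mono (LinearMap.range_comp_le_range _ _)).trans_lt hF
    have h3 := Cardinal.lift_lt.2 h2
    rw [hV, Cardinal.lift_natCast] at h1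
    rw [Cardinal.lift_natCast] at h3
    exact h1.not_gt h3
  rw [injective_iff_map_eq_zero] at hni
  push Not at hni
  obtain ⟨x, hx, hx0⟩ := hni
  have hFx : F x = 0 := hx
  have h1 := (T - F).le_opNorm x
  have h2 := hc x x.2
  have : (T - F) x = T x := by simp [hFx]
  rw [this] at h1
  have hpos : 0 < ‖(x : X)‖ := norm_pos_iff.2 (by simpa using hx0)
  exact le_of_mul_le_mul_right (h2.trans h1) hpos

theorem approxNumber_le {T : X →L[ℝ] Y} {n : ℕ} (F : X →L[ℝ] Y)
    (hF : LinearMap.rank (F : X →ₗ[ℝ] Y) < (n : Cardinal)) : approxNumber T n ≤ ‖T - F‖ :=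
  csInf_le ⟨0, by rintro r ⟨F, _, rfl⟩; positivity⟩ ⟨F, hF, rfl⟩

end SNumbers

section StrictSNumbers

variable {X Y : Type} [NormedAddCommGroup X] [NormedSpace ℝ X] [CompleteSpace X]
  [NormedAddCommGroup Y] [NormedSpace ℝ Y] [CompleteSpace Y] {s : OperatorSequence}

theorem IsStrictSNumber.le_norm_sub (hs : IsStrictSNumber s) {T : X →L[ℝ] Y} {n : ℕ}
    (hn : 1 ≤ n) (F : X →L[ℝ] Y) (hF : LinearMap.rank (F : X →ₗ[ℝ] Y) < (n : Cardinal)) :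
    s X Y T n ≤ ‖T - F‖ := by
  have := hs.add_le X Y F (T - F) n hn
  rwa [add_sub_cancel, hs.rank_lt X Y F n hn hF, zero_add] at this

/-- The restriction `S` of `T` to `V`, with its image `U` as target, has an inverse of norm at most
`c⁻¹`. As `id_V` factors through `S`, this gives `c ≤ s_n(S)`. Injectivity of `s` enlarges the
target from `U` to `Y`, and the composition axiom enlarges the domain from `V` to `X`. -/
theorem HasLowerBoundOfDim.le_sNumber (hs : IsStrictSNumber s) (hi : IsInjectiveSNumber s)
    {T : X →L[ℝ] Y} {n : ℕ} {c : ℝ} (hn : 1 ≤ n) (h : HasLowerBoundOfDim T n c) :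
    c ≤ s X Y T n := by
  rcases le_or_gt c 0 with hc0 | hc0
  · exact hc0.trans (hs.nonneg X Y T n hn)
  obtain ⟨V, hV, hc⟩ := h
  have hfin : FiniteDimensional ℝ V :=
    Module.rank_lt_aleph0_iff.1 (by rw [hV]; exact Cardinal.natCast_lt_aleph0)
  have hcV : CompleteSpace V := FiniteDimensional.complete ℝ V
  let U : Submodule ℝ Y := V.map (T : X →ₗ[ℝ] Y)
  have hfinU : FiniteDimensional ℝ U := inferInstance
  have hcU : CompleteSpace U := FiniteDimensional.complete ℝ U
  let S : V →L[ℝ] U := (T.comp V.subtypeL).codRestrict U fun x => ⟨x, x.2, rfl⟩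
  have hS : ∀ x : V, c * ‖x‖ ≤ ‖S x‖ := fun x => hc x x.2
  have hinj : Function.Injective S := by
    rw [injective_iff_map_eq_zero]
    intro x hx
    have := hS x
    rw [hx, norm_zero] at this
    exact norm_le_zero_iff.1 (by nlinarith [norm_nonneg x])
  have hsurj : Function.Surjective S := by
    rintro ⟨_, x, hx, rfl⟩
    exact ⟨⟨x, hx⟩, rfl⟩
  let e : V ≃ₗ[ℝ] U := LinearEquiv.ofBijective (S : V →ₗ[ℝ] U) ⟨hinj, hsurj⟩
  have he : ∀ y : U, ‖(e.symm : U →ₗ[ℝ] V) y‖ ≤ c⁻¹ * ‖y‖ := by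
    intro y
    have h1 := hS (e.symm y)
    have h2 : S (e.symm y) = y := e.apply_symm_apply y
    rw [h2] at h1
    rw [inv_mul_eq_div, le_div_iff₀ hc0, mul_comm]
    exact h1
  let R : U →L[ℝ] V := (e.symm : U →ₗ[ℝ] V).mkContinuous c⁻¹ he
  have hRn : ‖R‖ ≤ c⁻¹ := LinearMap.mkContinuous_norm_le _ (by positivity) _
  have hRS : R.comp (S.comp (ContinuousLinearMap.id ℝ V)) = ContinuousLinearMap.id ℝ V := by
    ext x
    simp only [ContinuousLinearMap.comp_apply, ContinuousLinearMap.id_apply]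
    exact congrArg _ (e.symm_apply_apply x)
  have h1 : 1 ≤ c⁻¹ * s V U S n := by
    have h2 := hs.comp_le V V U V R S (ContinuousLinearMap.id ℝ V) n hn
    rw [hRS, hs.id_eq_one V n hn hV.ge] at h2
    have h3 : ‖ContinuousLinearMap.id ℝ V‖ ≤ 1 := ContinuousLinearMap.norm_id_le
    have h4 := hs.nonneg V U S n hn
    calc (1 : ℝ) ≤ ‖R‖ * s V U S n * ‖ContinuousLinearMap.id ℝ V‖ := h2
      _ ≤ ‖R‖ * s V U S n * 1 := by gcongr
      _ ≤ c⁻¹ * s V U S n := by rw [mul_one]; gcongr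
  have h5 : s V U S n = s V Y (T.comp V.subtypeL) n := by
    rw [← hi V U Y S U.subtypeL (fun y => rfl) n hn]
    rfl
  have h6 : s V Y (T.comp V.subtypeL) n ≤ s X Y T n := by
    have h7 := hs.comp_le V X Y Y (ContinuousLinearMap.id ℝ Y) T V.subtypeL n hn
    rw [ContinuousLinearMap.id_comp] at h7
    have h3 : ‖ContinuousLinearMap.id ℝ Y‖ ≤ 1 := ContinuousLinearMap.norm_id_le
    have h8 : ‖V.subtypeL‖ ≤ 1 := V.norm_subtypeL_le
    have h4 := hs.nonneg X Y T n hn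
    calc _ ≤ _ := h7
      _ ≤ 1 * s X Y T n * 1 := by gcongr
      _ = _ := by ring
  rw [inv_mul_eq_div, le_div_iff₀ hc0, one_mul, h5] at h1
  exact h1.trans h6

end StrictSNumbers

/-! ### A Schur test for matrices with nonnegative inverse -/

section MonotoneMatrix

open Matrix

/-- A lower `ℓ_r` bound for a matrix whose inverse is nonnegative, by the Schur test. -/
theorem sum_abs_rpow_le_of_monotone {n : ℕ} {M : Matrix (Fin n) (Fin n) ℝ} {r l : ℝ}
    (hr : 1 < r) (hl : 0 < l)
    (hmono : ∀ c, (∀ j, 0 < (M *ᵥ c) j) → ∀ i, 0 < c i) {d θ : Fin n → ℝ}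
    (hη : ∀ j, 0 < (M *ᵥ d) j) (hδ : ∀ i, d i ^ (r - 1) ≤ (θ ᵥ* M) i)
    (hθ : ∀ j, l ^ r * θ j ≤ (M *ᵥ d) j ^ (r - 1)) (c : Fin n → ℝ) :
    l ^ r * ∑ i, |c i| ^ r ≤ ∑ j, |(M *ᵥ c) j| ^ r := by
  have hd : ∀ i, 0 < d i := hmono d hη
  -- Weak inequalities reduce to strict ones by adding a small multiple of `d`, whose image is
  -- positive.
  have hmono' : ∀ c, (∀ j, 0 ≤ (M *ᵥ c) j) → ∀ i, 0 ≤ c i := by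
    intro c hc i
    refine le_of_forall_pos_lt_add fun ε hε => ?_
    have h1 := hmono (c + (ε / d i) • d) (fun j => by
      rw [mulVec_add, mulVec_smul]
      have := hη j
      have h2 : 0 < ε / d i := div_pos hε (hd i)
      simp only [Pi.add_apply, Pi.smul_apply, smul_eq_mul]
      have := hc j
      positivity) i
    simpa [(hd i).ne'] using h1
  have hinj : Function.Injective M.mulVec := by
    intro x y hxy
    have h0 : ∀ j, (M *ᵥ (x - y)) j = 0 := fun j => by
      have : M *ᵥ x = M *ᵥ y := hxy
      rw [mulVec_sub, this, sub_self]; rfl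
    ext i
    have h1 := hmono' (x - y) (fun j => (h0 j).ge) i
    have h2 := hmono' (-(x - y)) (fun j => by rw [mulVec_neg, Pi.neg_apply, h0 j, neg_zero]) i
    simp only [Pi.sub_apply, Pi.neg_apply] at h1 h2
    linarith
  have hu : IsUnit M := mulVec_injective_iff_isUnit.1 hinj
  have hdet : IsUnit M.det := (isUnit_iff_isUnit_det M).1 hu
  set N := M⁻¹ with hN
  have hNM : N * M = 1 := nonsing_inv_mul M hdet
  have hMN : M * N = 1 := mul_nonsing_inv M hdet
  -- `M` maps the columns of `N` to the unit vectors, which are nonnegative.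
  have hN0 : ∀ i j, 0 ≤ N i j := by
    intro i j
    refine hmono' (fun k => N k j) (fun k => ?_) i
    have : (M *ᵥ fun k => N k j) k = (M * N) k j := rfl
    rw [this, hMN, one_apply]
    split_ifs <;> norm_num
  set η := M *ᵥ d with hηd
  set x := M *ᵥ c with hx
  have hNη : ∀ i, ∑ j, N i j * η j = d i := fun i => by
    have : N *ᵥ η = d := by rw [hηd, mulVec_mulVec, hNM, one_mulVec]
    exact congrFun this i
  have hNx : ∀ i, ∑ j, N i j * x j = c i := fun i => by
    have : N *ᵥ x = c := by rw [hx, mulVec_mulVec, hNM, one_mulVec]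
    exact congrFun this i
  have hNδ : ∀ j, ∑ i, (θ ᵥ* M) i * N i j = θ j := fun j => by
    have : (θ ᵥ* M) ᵥ* N = θ := by rw [vecMul_vecMul, hMN, vecMul_one]
    exact congrFun this j
  -- Jensen's inequality with the weights `N i j * η j / d i`, whose sum over `j` is `1` because `N
  -- η = d`.
  have key : ∀ i, |c i| ^ r ≤ ∑ j, (|x j| / η j) ^ r * η j * (d i ^ (r - 1) * N i j) := by
    intro i
    have h1 : |c i| ≤ ∑ j, N i j * |x j| := by
      rw [← hNx i]
      refine (Finset.abs_sum_le_sum_abs _ _).trans (le_of_eq ?_)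
      exact Finset.sum_congr rfl fun j _ => by rw [abs_mul, abs_of_nonneg (hN0 i j)]
    have h2 := Real.rpow_arith_mean_le_arith_mean_rpow Finset.univ
      (fun j => N i j * η j / d i) (fun j => |x j| / η j)
      (fun j _ => div_nonneg (mul_nonneg (hN0 i j) (hη j).le) (hd i).le)
      (by rw [← Finset.sum_div, hNη, div_self (hd i).ne'])
      (fun j _ => div_nonneg (abs_nonneg _) (hη j).le) hr.le
    have h3 : ∑ j, N i j * η j / d i * (|x j| / η j) = (∑ j, N i j * |x j|) / d i := by
      rw [Finset.sum_div]
      refine Finset.sum_congr rfl fun j _ => ?_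
      have := (hη j).ne'
      field_simp
    rw [h3, Real.div_rpow (Finset.sum_nonneg fun j _ => mul_nonneg (hN0 i j) (abs_nonneg _))
      (hd i).le, div_le_iff₀ (Real.rpow_pos_of_pos (hd i) _)] at h2
    refine (Real.rpow_le_rpow (abs_nonneg _) h1 (by linarith)).trans (h2.trans (le_of_eq ?_))
    rw [Finset.sum_mul]
    refine Finset.sum_congr rfl fun j _ => ?_
    have h4 : d i ^ r = d i ^ (r - 1) * d i := by
      rw [← Real.rpow_add_one (hd i).ne']; ring_nf
    rw [h4]
    have := (hd i).ne'
    field_simp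
  have hlr : 0 < l ^ r := Real.rpow_pos_of_pos hl r
  -- After summation over `i`, the bound of `d i ^ (r - 1)` by `(θ M) i` and `(θ M) N = θ` leave `θ
  -- j`, which the last hypothesis absorbs into `η j ^ (r - 1)`.
  calc l ^ r * ∑ i, |c i| ^ r
      ≤ l ^ r * ∑ i, ∑ j, (|x j| / η j) ^ r * η j * (d i ^ (r - 1) * N i j) := by
        gcongr with i; exact key i
    _ = l ^ r * ∑ j, (|x j| / η j) ^ r * η j * ∑ i, d i ^ (r - 1) * N i j := by
        rw [Finset.sum_comm]; simp only [Finset.mul_sum]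
    _ ≤ l ^ r * ∑ j, (|x j| / η j) ^ r * η j * θ j := by
        gcongr with j
        · exact mul_nonneg (Real.rpow_nonneg (div_nonneg (abs_nonneg _) (hη j).le) _) (hη j).le
        · rw [← hNδ j]
          gcongr with i
          · exact hN0 i j
          · exact hδ i
    _ = ∑ j, (|x j| / η j) ^ r * η j * (l ^ r * θ j) := by
        rw [Finset.mul_sum]; exact Finset.sum_congr rfl fun j _ => by ring
    _ ≤ ∑ j, (|x j| / η j) ^ r * η j * η j ^ (r - 1) := by
        gcongr with j
        · exact mul_nonneg (Real.rpow_nonneg (div_nonneg (abs_nonneg _) (hη j).le) _) (hη j).le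
        · exact hθ j
    _ = ∑ j, |x j| ^ r := by
        refine Finset.sum_congr rfl fun j _ => ?_
        have h4 : η j * η j ^ (r - 1) = η j ^ r := by
          rw [mul_comm, ← Real.rpow_add_one (hη j).ne']; ring_nf
        rw [mul_assoc, h4, Real.div_rpow (abs_nonneg _) (hη j).le,
          div_mul_cancel₀ _ (Real.rpow_pos_of_pos (hη j) _).ne']

end MonotoneMatrix

/-! ### The matrix of pairings and the vectors for its Schur test -/

section BlockMatrix

/-- The pairings of the twofold primitives of the bumps of a chain with the test functions of the
dual chain: `κ`, `A` and `ν`, `A'` are the masses and first moments of the half bumps. -/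
noncomputable def blockEntry (κ ν A A' P Q l : ℝ) (m j i : ℕ) : ℝ :=
  if i = 0 then
    if j < m then P * (2 * ν) * (A + κ * (j + 1 / 2)) else 2 * ν * A + 2 * κ * A' + 2 * κ * ν * m
  else
    if j < m then
      if i ≤ j then 4 * κ * ν * (j + 1 - i) else if i = j + 1 then κ * ν - l else 0
    else Q * (2 * κ) * (A' + ν * (m - i + 1 / 2))

/-- Transposing the matrix and reversing both index orders amounts to exchanging the two half bumps.
Column sums are thereby reduced to row sums. -/
theorem blockEntry_reverse (κ ν A A' P Q l : ℝ) {m j i : ℕ} (hj : j ≤ m) (hi : i ≤ m) :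
    blockEntry ν κ A' A Q P l m (m - i) (m - j) = blockEntry κ ν A A' P Q l m j i := by
  unfold blockEntry
  have c1 : ((m - j : ℕ) : ℝ) = m - j := Nat.cast_sub hj
  have c2 : ((m - i : ℕ) : ℝ) = m - i := Nat.cast_sub hi
  rcases Nat.eq_zero_or_pos i with rfl | hi0
  · rcases hj.eq_or_lt with rfl | hj'
    · simp; ring
    · have h1 : m - j ≠ 0 := by omega
      simp only [h1, if_false, if_true, hj', Nat.sub_zero, lt_irrefl, c1]
      ring
  · have h2 : m - i < m := by omega
    rcases hj.eq_or_lt with rfl | hj'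
    · simp only [h2, if_true, Nat.sub_self, hi0.ne', if_false, lt_irrefl, c2]
    · have h1 : m - j ≠ 0 := by omega
      simp only [h1, h2, hj', hi0.ne', if_true, if_false]
      rcases lt_trichotomy i (j + 1) with h | h | h
      · rw [if_pos (by omega), if_pos (by omega), c1, c2]; ring
      · rw [if_neg (by omega), if_pos (by omega), if_neg (by omega), if_pos h]; ring
      · rw [if_neg (by omega), if_neg (by omega), if_neg (by omega), if_neg (by omega)]

/-- The comparison vector for the matrix `blockEntry`. -/
noncomputable def blockVec (κ A P : ℝ) (i : ℕ) : ℝ :=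
  if i = 0 then κ / (2 * A + κ) / P else if i = 1 then (A + κ) / (2 * A + κ) else 1

/-- Away from column `0` the rows `j < m` form a Toeplitz matrix. The alternating sum from column
`2` on in row `j + 1` is therefore its first term minus the sum in row `j`, and row `0` has no
nonzero entry there. The condition `j ≤ M` ensures that no nonzero entry is cut off. -/
theorem sum_alternating_interior (κ ν A A' P Q l : ℝ) {m j M : ℕ} (hj : 1 ≤ j) (hjm : j < m)
    (hM : j ≤ M) :
    ∑ i ∈ Finset.range M, (-1 : ℝ) ^ i * blockEntry κ ν A A' P Q l m j (i + 2) =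
      2 * κ * ν * (j - 1 / 2 + (-1) ^ j / 2) - (-1) ^ j * (κ * ν - l) := by
  have hz : ∀ M, ∑ i ∈ Finset.range M, (-1 : ℝ) ^ i * blockEntry κ ν A A' P Q l m 0 (i + 2) = 0 := by
    intro M
    refine Finset.sum_eq_zero fun i _ => ?_
    unfold blockEntry
    rw [if_neg (by omega), if_pos (by omega), if_neg (by omega), if_neg (by omega), mul_zero]
  have hs : ∀ j M, j + 1 < m → ∑ i ∈ Finset.range (M + 1),
      (-1 : ℝ) ^ i * blockEntry κ ν A A' P Q l m (j + 1) (i + 2) =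
      blockEntry κ ν A A' P Q l m (j + 1) 2 -
      ∑ i ∈ Finset.range M, (-1 : ℝ) ^ i * blockEntry κ ν A A' P Q l m j (i + 2) := by
    intro j M hj
    rw [Finset.sum_range_succ', add_comm, sub_eq_add_neg, ← Finset.sum_neg_distrib]
    congr 1
    · simp
    · refine Finset.sum_congr rfl fun i _ => ?_
      have : blockEntry κ ν A A' P Q l m (j + 1) (i + 1 + 2) =
          blockEntry κ ν A A' P Q l m j (i + 2) := by
        unfold blockEntry
        have hj' : j < m := by omega
        have n1 : i + 1 + 2 ≠ 0 := by omega
        have n2 : i + 2 ≠ 0 := by omega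
        have e1 : (i + 1 + 2 ≤ j + 1) = (i + 2 ≤ j) := by rw [eq_iff_iff]; omega
        have e2 : (i + 1 + 2 = j + 1 + 1) = (i + 2 = j + 1) := by rw [eq_iff_iff]; omega
        simp only [e1, e2, hj, hj', n1, n2, if_true, if_false]
        push_cast
        congr 1
        ring
      rw [this]; ring
  induction j, hj using Nat.le_induction generalizing M with
  | base =>
    obtain ⟨M, rfl⟩ := Nat.exists_eq_add_of_le' hM
    rw [hs 0 M hjm, hz]
    unfold blockEntry
    rw [if_neg (by omega), if_pos hjm, if_neg (by omega), if_pos (by omega)]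
    norm_num
  | succ j hj ih =>
    obtain ⟨M, rfl⟩ := Nat.exists_eq_add_of_le' (show 1 ≤ M by omega)
    rw [hs j M hjm, ih (by omega) (by omega)]
    unfold blockEntry
    rw [if_neg (by omega), if_pos hjm, if_pos (by omega)]
    push_cast
    ring

/-- The sum extends over the last `M` columns, so that each induction step adds a column on the left
and reverses the other signs. -/
theorem sum_alternating_last (κ ν A A' P Q l : ℝ) (m : ℕ) (M : ℕ) (hM : M + 1 ≤ m) :
    ∑ i ∈ Finset.range M, (-1 : ℝ) ^ i * blockEntry κ ν A A' P Q l m m (i + (m + 1 - M)) =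
      Q * (2 * κ) * (A' * (1 - (-1) ^ M) / 2 + ν * M / 2) := by
  induction M with
  | zero => simp
  | succ M ih =>
    rw [Finset.sum_range_succ']
    have h1 : ∀ i, (-1 : ℝ) ^ (i + 1) *
        blockEntry κ ν A A' P Q l m m (i + 1 + (m + 1 - (M + 1))) =
        -((-1) ^ i * blockEntry κ ν A A' P Q l m m (i + (m + 1 - M))) := by
      intro i
      rw [show i + 1 + (m + 1 - (M + 1)) = i + (m + 1 - M) by omega]
      ring
    simp only [h1]
    rw [Finset.sum_neg_distrib, ih (by omega)]
    have h2 : blockEntry κ ν A A' P Q l m m (0 + (m + 1 - (M + 1))) =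
        Q * (2 * κ) * (A' + ν * (M + 1 / 2)) := by
      unfold blockEntry
      rw [if_neg (by omega), if_neg (by omega),
        show (0 + (m + 1 - (M + 1))) = m - M by omega, Nat.cast_sub (by omega)]
      ring
    rw [h2]
    push_cast
    ring

variable {κ ν A A' P Q l : ℝ} {m : ℕ}

theorem sum_blockEntry_zero (hκ : 0 < κ) (hA : 0 < A) (hP : 0 < P) (hm : 1 ≤ m) :
    ∑ i ∈ Finset.range (m + 1), (-1 : ℝ) ^ (i + 0) * blockEntry κ ν A A' P Q l m 0 i *
      blockVec κ A P i = (κ * ν * A + l * (A + κ)) / (2 * A + κ) := by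
  obtain ⟨M, rfl⟩ := Nat.exists_eq_add_of_le' hm
  rw [Finset.sum_range_succ', Finset.sum_range_succ', Finset.sum_eq_zero]
  · have : (2 * A + κ) ≠ 0 := by positivity
    simp [blockEntry, blockVec]
    field_simp
    ring
  · intro i _
    unfold blockEntry
    rw [if_neg (by omega), if_pos (by omega), if_neg (by omega), if_neg (by omega)]
    ring

/-- The first two entries of `blockVec` are chosen for this identity: they cancel the terms that are
constant and linear in `j`, up to the sign `(-1) ^ j`, and only `l` survives. -/
theorem sum_blockEntry_interior (hκ : 0 < κ) (hA : 0 < A) (hP : 0 < P) {j : ℕ} (hj : 1 ≤ j)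
    (hjm : j < m) :
    ∑ i ∈ Finset.range (m + 1), (-1 : ℝ) ^ (i + j) * blockEntry κ ν A A' P Q l m j i *
      blockVec κ A P i = l := by
  obtain ⟨M, rfl⟩ := Nat.exists_eq_add_of_le' (show 1 ≤ m by omega)
  have h0 : (2 * A + κ) ≠ 0 := by positivity
  have h1 : ∀ i, (-1 : ℝ) ^ (i + 1 + 1 + j) * blockEntry κ ν A A' P Q l (M + 1) j (i + 1 + 1) *
      blockVec κ A P (i + 1 + 1) =
      (-1) ^ j * ((-1 : ℝ) ^ i * blockEntry κ ν A A' P Q l (M + 1) j (i + 2)) := by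
    intro i
    rw [blockVec, if_neg (by omega), if_neg (by omega)]
    ring
  rw [Finset.sum_range_succ', Finset.sum_range_succ']
  simp only [h1]
  rw [← Finset.mul_sum, sum_alternating_interior κ ν A A' P Q l hj hjm (by omega)]
  have h2 : ((-1 : ℝ) ^ j) ^ 2 = 1 := by rw [← pow_mul, mul_comm, pow_mul]; simp
  have h3 : blockEntry κ ν A A' P Q l (M + 1) j (0 + 1) = 4 * κ * ν * j := by
    simp [blockEntry, hjm, hj]
  have h4 : blockEntry κ ν A A' P Q l (M + 1) j 0 = P * (2 * ν) * (A + κ * (j + 1 / 2)) := by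
    simp [blockEntry, hjm]
  rw [h3, h4]
  simp only [blockVec, if_true, zero_add, one_ne_zero, if_false]
  rw [pow_add]
  generalize (-1 : ℝ) ^ j = e at h2 ⊢
  field_simp
  linear_combination (l * (2 * A + κ)) * h2

theorem sum_blockEntry_last (hκ : 0 < κ) (hA : 0 < A) (hP : 0 < P) (hPQ : P * Q = 2)
    (hm : 1 ≤ m) :
    ∑ i ∈ Finset.range (m + 1), (-1 : ℝ) ^ (i + m) * blockEntry κ ν A A' P Q l m m i *
      blockVec κ A P i = Q * κ * A' := by
  obtain ⟨M, rfl⟩ := Nat.exists_eq_add_of_le' hm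
  have h0 : (2 * A + κ) ≠ 0 := by positivity
  have h1 : ∀ i, (-1 : ℝ) ^ (i + 1 + 1 + (M + 1)) *
      blockEntry κ ν A A' P Q l (M + 1) (M + 1) (i + 1 + 1) * blockVec κ A P (i + 1 + 1) =
      -(-1) ^ M * ((-1 : ℝ) ^ i * blockEntry κ ν A A' P Q l (M + 1) (M + 1)
        (i + (M + 1 + 1 - M))) := by
    intro i
    rw [blockVec, if_neg (by omega), if_neg (by omega), show M + 1 + 1 - M = 2 by omega]
    ring
  rw [Finset.sum_range_succ', Finset.sum_range_succ']
  simp only [h1]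
  rw [← Finset.mul_sum, sum_alternating_last κ ν A A' P Q l (M + 1) M le_rfl]
  have h2 : ((-1 : ℝ) ^ M) ^ 2 = 1 := by rw [← pow_mul, mul_comm, pow_mul]; simp
  have hQ : Q = 2 / P := by field_simp; linarith
  simp only [blockEntry, blockVec, if_true, zero_add, one_ne_zero, if_false, lt_irrefl]
  rw [hQ]
  push_cast
  rw [pow_add, pow_add]
  generalize (-1 : ℝ) ^ M = e at h2 ⊢
  field_simp
  linear_combination (A' * (2 * A + κ)) * h2

theorem blockVec_nonneg (hκ : 0 < κ) (hA : 0 < A) (hP : 0 < P) (i : ℕ) : 0 ≤ blockVec κ A P i := by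
  unfold blockVec
  split_ifs <;> positivity

theorem blockVec_zero_le (hκ : 0 < κ) (hA : 0 < A) (hP : 0 < P) : blockVec κ A P 0 ≤ 1 / P := by
  unfold blockVec
  rw [if_pos rfl]
  gcongr
  rw [div_le_one (by positivity)]
  linarith

theorem blockVec_le_one (hκ : 0 < κ) (hA : 0 < A) {i : ℕ} (hi : i ≠ 0) : blockVec κ A P i ≤ 1 := by
  unfold blockVec
  rw [if_neg hi]
  split_ifs
  · rw [div_le_one (by positivity)]
    linarith
  · exact le_rfl

theorem le_sum_blockEntry (hκ : 0 < κ) (hA : 0 < A) (hP : 0 < P) (hl : l ≤ κ * ν) {j : ℕ}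
    (hjm : j < m) :
    l ≤ ∑ i ∈ Finset.range (m + 1), (-1 : ℝ) ^ (i + j) * blockEntry κ ν A A' P Q l m j i *
      blockVec κ A P i := by
  rcases Nat.eq_zero_or_pos j with rfl | hj
  -- Row `0` gives the mean of `κ ν` and `l` with weights `A / (2 A + κ)` and `(A + κ) / (2 A + κ)`.
  · rw [sum_blockEntry_zero hκ hA hP hjm, le_div_iff₀ (by positivity)]
    nlinarith
  · rw [sum_blockEntry_interior hκ hA hP hj hjm]

/-- The matrix `blockEntry` with alternating signs. -/
noncomputable def blockMatrix (κ ν A A' P Q l : ℝ) (m : ℕ) : Matrix (Fin (m + 1)) (Fin (m + 1)) ℝ :=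
  fun j i => (-1 : ℝ) ^ (i + j : ℕ) * blockEntry κ ν A A' P Q l m j i

-- The Schur test is applied with `blockVec` for the rows and, divided by `l`, with the reversed
-- vector of the dual chain for the columns. All rows but the last give at least `l`, and all
-- columns but the first at least `1`. The two exceptions belong to the half bumps; there `P ^ (r -
-- 1) = Q` and the bounds of `l` by the first moments `A` and `A'` come in.
open Matrix in
theorem blockMatrix_lower_bound {r : ℝ} (hr : 1 < r) (hκ : 0 < κ) (hν : 0 < ν) (hl : 0 < l)
    (h1 : l ≤ κ * ν) (h2 : l ≤ 2 * ν * A) (h3 : l ≤ 2 * κ * A') (hP : 0 < P) (hPr : P ^ r = 2)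
    (hPQ : P * Q = 2)
    (hmono : ∀ c, (∀ j, 0 < (blockMatrix κ ν A A' P Q l m *ᵥ c) j) → ∀ i, 0 < c i)
    (c : Fin (m + 1) → ℝ) :
    l ^ r * ∑ i, |c i| ^ r ≤ ∑ j, |(blockMatrix κ ν A A' P Q l m *ᵥ c) j| ^ r := by
  have hA : 0 < A := by
    by_contra h
    nlinarith
  have hA' : 0 < A' := by
    by_contra h
    nlinarith
  have hQ : 0 < Q := by
    by_contra h
    nlinarith
  -- For `m = 0` the only entry pairs the two half bumps, and the row formulas do not apply.
  rcases Nat.eq_zero_or_pos m with rfl | hm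
  · have e : blockMatrix κ ν A A' P Q l 0 0 0 = 2 * ν * A + 2 * κ * A' := by
      simp [blockMatrix, blockEntry]
    have e2 : (blockMatrix κ ν A A' P Q l 0 *ᵥ c) 0 = (2 * ν * A + 2 * κ * A') * c 0 := by
      simp [mulVec, dotProduct, e]
    have e3 : ∀ f : Fin (0 + 1) → ℝ, ∑ i, f i = f 0 := fun f => Fin.sum_univ_one (f : Fin 1 → ℝ)
    rw [e3, e3, e2, abs_mul, Real.mul_rpow (abs_nonneg _) (abs_nonneg _)]
    gcongr
    rw [abs_of_nonneg (by positivity)]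
    linarith
  have hPr1 : P ^ (r - 1) = Q := by
    rw [Real.rpow_sub_one hP.ne', hPr]
    field_simp
    linarith
  have hη : ∀ j : Fin (m + 1), (blockMatrix κ ν A A' P Q l m *ᵥ fun i => blockVec κ A P i) j =
      ∑ i ∈ Finset.range (m + 1), (-1 : ℝ) ^ (i + j : ℕ) * blockEntry κ ν A A' P Q l m j i *
        blockVec κ A P i := fun j => by
    rw [Finset.sum_range]; rfl
  have hδ : ∀ i : Fin (m + 1),
      ((fun j : Fin (m + 1) => l⁻¹ * blockVec ν A' Q (m - j)) ᵥ* blockMatrix κ ν A A' P Q l m) i =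
      l⁻¹ * ∑ j ∈ Finset.range (m + 1), (-1 : ℝ) ^ (j + (m - i) : ℕ) *
        blockEntry ν κ A' A Q P l m (m - i) j * blockVec ν A' Q j := fun i => by
    rw [← Finset.sum_range_reflect, Finset.mul_sum, Finset.sum_range]
    rw [vecMul, dotProduct]
    refine Finset.sum_congr rfl fun j _ => ?_
    have hj := Nat.lt_succ_iff.1 j.2
    have hi := Nat.lt_succ_iff.1 i.2
    rw [show m + 1 - 1 - (j : ℕ) = m - j by omega, blockEntry_reverse _ _ _ _ _ _ _ hj hi]
    have : (-1 : ℝ) ^ (m - j + (m - i) : ℕ) = (-1) ^ (i + j : ℕ) := by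
      have e1 : (-1 : ℝ) ^ (m - j + (m - i) : ℕ) * (-1) ^ (i + j : ℕ) = 1 := by
        rw [← pow_add, show m - (j : ℕ) + (m - i) + (i + j) = 2 * m by omega, pow_mul]
        simp
      have e2 : (-1 : ℝ) ^ (i + j : ℕ) * (-1) ^ (i + j : ℕ) = 1 := by
        rw [← pow_add, ← two_mul, pow_mul]; simp
      exact mul_right_cancel₀ (fun h => by rw [h] at e2; simp at e2) (e1.trans e2.symm)
    rw [this]
    simp only [blockMatrix]
    ring
  have hlast := sum_blockEntry_last (κ := κ) (ν := ν) (A := A) (A' := A') (l := l) hκ hA hP hPQ hm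
  have hlast' := sum_blockEntry_last (κ := ν) (ν := κ) (A := A') (A' := A) (P := Q) (Q := P) (l := l) hν hA' hQ
    (by linarith) hm
  have hcases : ∀ j : Fin (m + 1), (j : ℕ) < m ∨ (j : ℕ) = m := fun j => by omega
  refine sum_abs_rpow_le_of_monotone hr hl hmono (d := fun i => blockVec κ A P i)
    (θ := fun j => l⁻¹ * blockVec ν A' Q (m - j)) (fun j => ?_) (fun i => ?_) (fun j => ?_) c
  · rw [hη]
    rcases hcases j with hj | hj
    · exact hl.trans_le (le_sum_blockEntry hκ hA hP h1 hj)
    · rw [hj, hlast]; positivity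
  · rw [hδ]
    rcases Nat.eq_zero_or_pos (i : ℕ) with hi | hi
    · rw [hi, Nat.sub_zero, hlast']
      calc blockVec κ A P 0 ^ (r - 1) ≤ (1 / P) ^ (r - 1) :=
            Real.rpow_le_rpow (blockVec_nonneg hκ hA hP _) (blockVec_zero_le hκ hA hP)
              (by linarith)
        _ = 1 / Q := by rw [Real.div_rpow zero_le_one hP.le, Real.one_rpow, hPr1]
        _ = P / 2 := by field_simp; linarith
        _ ≤ l⁻¹ * (P * ν * A) := by
            rw [inv_mul_eq_div, le_div_iff₀ hl]
            nlinarith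
    · have hmi : m - (i : ℕ) < m := by omega
      have h4 := le_sum_blockEntry (κ := ν) (ν := κ) (A := A') (A' := A) (P := Q) (Q := P)
        (l := l) hν hA' hQ (by linarith) hmi
      calc blockVec κ A P i ^ (r - 1) ≤ 1 :=
            Real.rpow_le_one (blockVec_nonneg hκ hA hP _) (blockVec_le_one hκ hA hi.ne')
              (by linarith)
        _ = l⁻¹ * l := by field_simp
        _ ≤ _ := by gcongr
  · rw [hη]
    have hlr : l ^ r = l ^ (r - 1) * l := by
      rw [← Real.rpow_add_one hl.ne']; ring_nf
    have e1 : l ^ r * (l⁻¹ * blockVec ν A' Q (m - j)) = l ^ (r - 1) * blockVec ν A' Q (m - j) := by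
      rw [hlr]; field_simp
    rw [e1]
    have hl0 : 0 ≤ l ^ (r - 1) := by positivity
    rcases hcases j with hj | hj
    · calc l ^ (r - 1) * blockVec ν A' Q (m - j) ≤ l ^ (r - 1) * 1 := by
            gcongr
            exact blockVec_le_one hν hA' (by omega)
        _ ≤ _ := by
            rw [mul_one]
            exact Real.rpow_le_rpow hl.le (le_sum_blockEntry hκ hA hP h1 hj) (by linarith)
    · rw [hj, hlast, Nat.sub_self]
      calc l ^ (r - 1) * blockVec ν A' Q 0 ≤ l ^ (r - 1) * (1 / Q) := by
            gcongr
            exact blockVec_zero_le hν hA' hQ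
        _ = (l / P) ^ (r - 1) := by
            rw [Real.div_rpow hl.le hP.le, hPr1]; ring
        _ ≤ (Q * κ * A') ^ (r - 1) := by
            refine Real.rpow_le_rpow (by positivity) ?_ (by linarith)
            rw [div_le_iff₀ hP]
            nlinarith

end BlockMatrix

/-! ### Sign changes of primitives and of combinations of bumps -/

section Alternation

theorem exists_pos_of_integral_pos {g : ℝ → ℝ} {c d : ℝ} (hcd : c ≤ d)
    (h : 0 < ∫ t in c..d, g t) : ∃ t ∈ Ioo c d, 0 < g t := by
  by_contra! hn
  rw [intervalIntegral.integral_of_le hcd, integral_Ioc_eq_integral_Ioo] at h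
  exact h.not_ge (setIntegral_nonpos measurableSet_Ioo hn)

/-- If a primitive that vanishes at `a` alternates in sign at `n` points, so does the function. -/
theorem exists_alternating {f : ℝ → ℝ} (hf : ∀ x y, IntervalIntegrable f volume x y) {a : ℝ}
    {n : ℕ} {x : ℕ → ℝ} (h0 : a < x 0) (hx : ∀ j, j + 1 < n → x j < x (j + 1))
    (hs : ∀ j < n, 0 < (-1) ^ j * ∫ t in a..x j, f t) :
    ∃ ξ : ℕ → ℝ, (0 < n → a < ξ 0) ∧ (∀ j, j + 1 < n → ξ j < ξ (j + 1)) ∧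
      ∀ j < n, 0 < (-1) ^ j * f (ξ j) := by
  -- The zero `a` of the primitive is put in front, so that `n` alternating values give `n`
  -- increments of alternating sign.
  set y : ℕ → ℝ := fun j => if j = 0 then a else x (j - 1) with hy
  have hy0 : y 0 = a := rfl
  have hys : ∀ j, y (j + 1) = x j := fun j => rfl
  have hmono : ∀ j < n, y j < y (j + 1) := by
    intro j hj
    rcases j with _ | j
    · exact h0
    · rw [hys, hys]; exact hx j hj
  have hpos : ∀ j < n, 0 < ∫ t in y j..y (j + 1), (-1) ^ j * f t := by
    intro j hj
    rw [intervalIntegral.integral_const_mul, hys]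
    rcases j with _ | j
    · exact hs 0 hj
    · rw [hys, ← intervalIntegral.integral_interval_sub_left (hf a _) (hf a _), mul_sub]
      have h1 := hs (j + 1) hj
      have h2 := hs j (by omega)
      rw [pow_succ] at h1 ⊢
      linarith
  have hex : ∀ j, ∃ ξ, j < n → ξ ∈ Ioo (y j) (y (j + 1)) ∧ 0 < (-1) ^ j * f ξ := by
    intro j
    by_cases hj : j < n
    · obtain ⟨t, ht, ht'⟩ := exists_pos_of_integral_pos (hmono j hj).le (hpos j hj)
      exact ⟨t, fun _ => ⟨ht, ht'⟩⟩
    · exact ⟨0, fun h => absurd h hj⟩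
  choose ξ hξ using hex
  refine ⟨ξ, fun hn => (hξ 0 hn).1.1, fun j hj => ?_, fun j hj => (hξ j hj).2⟩
  exact (hξ j (by omega)).1.2.trans (hξ (j + 1) hj).1.1

/-- A strictly increasing self-map satisfies `i ≤ σ i`; for its conjugate under `Fin.rev` this is
the opposite inequality. -/
theorem strictMono_fin_eq {n : ℕ} {σ : Fin n → Fin n} (h : StrictMono σ) (i : Fin n) : σ i = i := by
  have h1 : i ≤ σ i := h.le_apply
  have h2 : StrictMono (fun k => Fin.rev (σ (Fin.rev k))) := fun a b hab =>
    Fin.rev_lt_rev.2 (h (Fin.rev_lt_rev.2 hab))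
  have h3 : Fin.rev i ≤ Fin.rev (σ (Fin.rev (Fin.rev i))) := h2.le_apply
  rw [Fin.rev_rev, Fin.rev_le_rev] at h3
  exact le_antisymm h3 h1

/-- A combination of nonnegative functions with consecutive supports that alternates in sign at as
many points has coefficients that alternate in sign. -/
theorem coeff_pos_of_alternating {n : ℕ} {F : Fin n → ℝ → ℝ} (hF : ∀ i t, 0 ≤ F i t)
    (hsupp : ∀ i j, i < j → ∀ s t, F i s ≠ 0 → F j t ≠ 0 → s < t) {c : Fin n → ℝ} {ξ : ℕ → ℝ}
    (hξ : ∀ j, j + 1 < n → ξ j < ξ (j + 1))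
    (hs : ∀ j < n, 0 < (-1) ^ j * ∑ i, c i * F i (ξ j)) (i : Fin n) :
    0 < (-1) ^ (i : ℕ) * c i := by
  have hex : ∀ j : Fin n, ∃ i, F i (ξ j) ≠ 0 ∧ 0 < (-1) ^ (j : ℕ) * c i := by
    intro j
    have := hs j j.2
    rw [Finset.mul_sum] at this
    obtain ⟨i, _, hi⟩ := Finset.exists_lt_of_sum_lt (f := fun _ => (0 : ℝ)) (s := Finset.univ)
      (by simpa using this)
    have hi' : 0 < (-1) ^ (j : ℕ) * c i * F i (ξ j) := by linarith
    exact ⟨i, fun h => by simp [h] at hi', pos_of_mul_pos_left hi' (hF i _)⟩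
  choose σ hσ using hex
  -- `σ j` is the index of a bump that is nonzero at `ξ j` and whose coefficient has the sign `(-1)
  -- ^ j`. The order of the supports prevents a decrease of `σ`, and the change of sign prevents
  -- equality.
  have hstep : ∀ j k : Fin n, (k : ℕ) = j + 1 → σ j < σ k := by
    intro j k hjk
    have hlt : ξ j < ξ k := by rw [hjk]; exact hξ j (by omega)
    rcases lt_trichotomy (σ j) (σ k) with h | h | h
    · exact h
    · have h1 := (hσ j).2
      have h2 := (hσ k).2
      rw [hjk, ← h, pow_succ] at h2
      linarith
    · exact absurd (hsupp _ _ h _ _ (hσ k).1 (hσ j).1) hlt.not_gt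
  have hmono : StrictMono σ := by
    rcases n with _ | n
    · exact fun a => a.elim0
    · exact Fin.strictMono_iff_lt_succ.2 fun i => hstep _ _ (by simp)
  have := (hσ i).2
  rwa [strictMono_fin_eq hmono i] at this

end Alternation

/-! ### Twofold primitives as integrals with a kernel -/

section TwofoldPrimitive

/-- The twofold primitive of `f` that vanishes to second order at `a`. -/
noncomputable def prim2 (a : ℝ) (f : ℝ → ℝ) (x : ℝ) : ℝ := ∫ s in a..x, ∫ t in a..s, f t

/-- Integration by parts with `s - x`, the primitive of `1` that vanishes at the upper limit. -/
theorem prim2_eq {a x : ℝ} {f : ℝ → ℝ} (hf : IntervalIntegrable f volume a x) :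
    prim2 a f x = ∫ t in a..x, (x - t) * f t := by
  have hac := hf.absolutelyContinuousOnInterval_intervalIntegral (c := a) (by simp)
  have hφ : AbsolutelyContinuousOnInterval (fun s => s - x) a x := by
    have : ContDiffOn ℝ 1 (fun s : ℝ => s - x) (uIcc a x) := by fun_prop
    exact this.absolutelyContinuousOnInterval
  have e := hac.integral_mul_deriv_eq_deriv_mul hφ
  have h1 : ∀ s : ℝ, deriv (fun s => s - x) s = 1 := fun s => by simp
  simp only [h1, mul_one, sub_self, mul_zero, intervalIntegral.integral_same, zero_mul,
    zero_sub] at e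
  rw [prim2, e, ← intervalIntegral.integral_neg]
  refine intervalIntegral.integral_congr_ae ?_
  filter_upwards [hf.ae_hasDerivAt_integral] with t ht ht'
  rw [(ht (uIoc_subset_uIcc ht') a (by simp)).deriv]
  ring

theorem prim2_comp_affine {c h : ℝ} (hh : h ≠ 0) (F : ℝ → ℝ) (x : ℝ) :
    prim2 0 (fun s => F (h * s + c)) x = (h ^ 2)⁻¹ * prim2 c F (h * x + c) := by
  unfold prim2
  simp only [intervalIntegral.integral_comp_mul_add _ hh, smul_eq_mul, mul_zero, zero_add]
  rw [intervalIntegral.integral_const_mul,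
    intervalIntegral.integral_comp_mul_add (fun y => ∫ t in c..y, F t) hh, smul_eq_mul, mul_zero,
    zero_add]
  ring

variable {f g : ℝ → ℝ} {a : ℝ}

theorem prim2_continuous (hf : Integrable f) : Continuous (prim2 a f) :=
  intervalIntegral.continuous_primitive (fun _ _ => Continuous.intervalIntegrable
    (intervalIntegral.continuous_primitive (fun _ _ => hf.intervalIntegrable) _) _ _) _

theorem prim2_sum {ι : Type*} (s : Finset ι) (F : ι → ℝ → ℝ) (c : ι → ℝ)
    (hF : ∀ i ∈ s, Integrable (F i)) (x : ℝ) :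
    prim2 a (fun t => ∑ i ∈ s, c i * F i t) x = ∑ i ∈ s, c i * prim2 a (F i) x := by
  unfold prim2
  have h1 : ∀ y, ∫ t in a..y, ∑ i ∈ s, c i * F i t = ∑ i ∈ s, c i * ∫ t in a..y, F i t := by
    intro y
    rw [intervalIntegral.integral_finsetSum fun i hi => ((hF i hi).const_mul _).intervalIntegrable]
    simp only [intervalIntegral.integral_const_mul]
  simp only [h1]
  rw [intervalIntegral.integral_finsetSum fun i hi => (Continuous.intervalIntegrable
    ((intervalIntegral.continuous_primitive (fun _ _ => (hF i hi).intervalIntegrable) _).const_mul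
      (c i)) _ _)]
  simp only [intervalIntegral.integral_const_mul]

/-- The twofold primitive as an integral over the line. -/
theorem prim2_eq_integral (hf : Integrable f) (h0 : ∀ t ≤ a, f t = 0) (x : ℝ) :
    prim2 a f x = ∫ t, max (x - t) 0 * f t := by
  rw [prim2_eq hf.intervalIntegrable]
  rcases le_total a x with hx | hx
  · rw [intervalIntegral.integral_of_le hx]
    have h1 : ∀ t, t ∉ Ioc a x → max (x - t) 0 * f t = 0 := by
      intro t ht
      rcases le_or_gt t a with h | h
      · rw [h0 t h, mul_zero]
      · have : x < t := by
          by_contra hh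
          exact ht ⟨h, not_lt.1 hh⟩
        rw [max_eq_right (by linarith), zero_mul]
    rw [← setIntegral_eq_integral_of_forall_compl_eq_zero h1]
    refine setIntegral_congr_fun measurableSet_Ioc fun t ht => ?_
    have : 0 ≤ x - t := by linarith [ht.2]
    simp only [max_eq_left this]
  · rw [intervalIntegral.integral_zero_ae, integral_eq_zero_of_ae]
    · refine Eventually.of_forall fun t => ?_
      rcases le_or_gt t a with h | h
      · simp [h0 t h]
      · simp only [Pi.zero_apply]
        rw [max_eq_right (by linarith), zero_mul]
    · refine Eventually.of_forall fun t ht => ?_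
      rw [uIoc_of_ge hx] at ht
      rw [h0 t ht.2, mul_zero]

end TwofoldPrimitive

/-! ### Half bumps, symmetric bumps and potentials -/

/-- A nonnegative integrable function that vanishes outside `(0, 1/2)`. -/
structure IsHalfBump (f : ℝ → ℝ) : Prop where
  integrable : Integrable f
  nonneg : ∀ t, 0 ≤ f t
  mem_of_ne_zero : ∀ t, f t ≠ 0 → t ∈ Ioo (0 : ℝ) (1 / 2)

/-- The symmetric function on `(0, 1)` that extends a half bump. -/
def symmBump (f : ℝ → ℝ) (t : ℝ) : ℝ := f t + f (1 - t)

namespace IsHalfBump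

variable {f g : ℝ → ℝ}

theorem mul_integrable (hf : IsHalfBump f) {k : ℝ → ℝ} (hk : Continuous k) :
    Integrable fun t => f t * k t := by
  obtain ⟨C, hC⟩ := (isCompact_Icc (a := (0 : ℝ)) (b := 1 / 2)).exists_bound_of_continuousOn
    hk.continuousOn
  refine Integrable.mono' (hf.integrable.const_mul C)
    (hf.integrable.1.mul hk.aestronglyMeasurable) (Eventually.of_forall fun t => ?_)
  by_cases ht : f t = 0
  · simp [ht]
  · rw [norm_mul, Real.norm_of_nonneg (hf.nonneg t), mul_comm]
    exact mul_le_mul_of_nonneg_right (hC t (Ioo_subset_Icc_self (hf.mem_of_ne_zero t ht)))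
      (hf.nonneg t)

theorem integral_congr (hf : IsHalfBump f) {k k' : ℝ → ℝ}
    (h : ∀ t ∈ Ioo (0 : ℝ) (1 / 2), k t = k' t) : ∫ t, f t * k t = ∫ t, f t * k' t := by
  refine integral_congr_ae (Eventually.of_forall fun t => ?_)
  by_cases ht : f t = 0
  · simp [ht]
  · simp only [h t (hf.mem_of_ne_zero t ht)]

theorem integral_mono (hf : IsHalfBump f) {k k' : ℝ → ℝ} (hk : Continuous k) (hk' : Continuous k')
    (h : ∀ t ∈ Ioo (0 : ℝ) (1 / 2), k t ≤ k' t) : ∫ t, f t * k t ≤ ∫ t, f t * k' t := by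
  refine MeasureTheory.integral_mono (hf.mul_integrable hk) (hf.mul_integrable hk') fun t => ?_
  by_cases ht : f t = 0
  · simp [ht]
  · exact mul_le_mul_of_nonneg_left (h t (hf.mem_of_ne_zero t ht)) (hf.nonneg t)

theorem symmBump_nonneg (hf : IsHalfBump f) (t : ℝ) : 0 ≤ symmBump f t :=
  add_nonneg (hf.nonneg _) (hf.nonneg _)

theorem symmBump_mem (hf : IsHalfBump f) {t : ℝ} (h : symmBump f t ≠ 0) : t ∈ Ioo (0 : ℝ) 1 := by
  by_cases ht : f t = 0
  · have h1 : f (1 - t) ≠ 0 := fun h' => h (by simp [symmBump, ht, h'])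
    have := hf.mem_of_ne_zero _ h1
    exact ⟨by linarith [this.2], by linarith [this.1]⟩
  · have := hf.mem_of_ne_zero _ ht
    exact ⟨this.1, by linarith [this.2]⟩

theorem symmBump_integrable (hf : IsHalfBump f) : Integrable (symmBump f) :=
  hf.integrable.add (hf.integrable.comp_sub_left 1)

theorem integral_symmBump_mul (hf : IsHalfBump f) {k : ℝ → ℝ} (hk : Continuous k) (s : ℝ) :
    ∫ x, symmBump f (x - s) * k x = ∫ t, f t * (k (t + s) + k (1 - t + s)) := by
  have h1 : ∫ x, symmBump f (x - s) * k x = ∫ x, symmBump f x * k (x + s) := by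
    rw [← integral_add_right_eq_self _ s]
    simp
  have i1 : Integrable fun t => f t * k (t + s) := hf.mul_integrable (by fun_prop)
  have i2 : Integrable fun t => f t * k (1 - t + s) := hf.mul_integrable (by fun_prop)
  rw [h1]
  simp only [symmBump, add_mul, mul_add]
  rw [integral_add i1, integral_add i1 i2]
  · congr 1
    rw [← integral_sub_left_eq_self _ volume 1]
    simp
  · have := i2.comp_sub_left 1
    simpa using this

/-- The potential `∫ min(x, t) f(t) dt` of a half bump. -/
noncomputable def potential (f : ℝ → ℝ) (x : ℝ) : ℝ := ∫ t, f t * min x t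

theorem potential_eq (hf : IsHalfBump f) (x : ℝ) :
    potential f x = (∫ t, f t) * x - prim2 0 f x := by
  have h0 : ∀ t ≤ 0, f t = 0 := by
    intro t ht
    by_contra h
    linarith [(hf.mem_of_ne_zero t h).1]
  rw [prim2_eq_integral hf.integrable h0, potential, ← integral_mul_const]
  simp_rw [mul_comm (max _ _)]
  rw [← integral_sub (hf.integrable.mul_const _) (hf.mul_integrable (by fun_prop))]
  refine integral_congr_ae (Eventually.of_forall fun t => ?_)
  simp only
  rcases le_total x t with h | h
  · rw [min_eq_left h, max_eq_right (by linarith)]; ring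
  · rw [min_eq_right h, max_eq_left (by linarith)]; ring

theorem potential_continuous (hf : IsHalfBump f) : Continuous (potential f) := by
  rw [funext hf.potential_eq]
  exact (continuous_const.mul continuous_id).sub (prim2_continuous hf.integrable)

theorem potential_nonneg (hf : IsHalfBump f) {x : ℝ} (hx : 0 ≤ x) : 0 ≤ potential f x := by
  have := hf.integral_mono (k := fun _ => 0) (k' := fun t => min x t) continuous_const
    (by fun_prop) fun t ht => le_min hx ht.1.le
  simpa [potential] using this

theorem potential_le_moment (hf : IsHalfBump f) (x : ℝ) : potential f x ≤ ∫ t, f t * t :=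
  hf.integral_mono (by fun_prop) (by fun_prop) fun t _ => min_le_right _ _

theorem potential_le_mul (hf : IsHalfBump f) (x : ℝ) : potential f x ≤ (∫ t, f t) * x := by
  rw [← integral_mul_const]
  exact hf.integral_mono (by fun_prop) (by fun_prop) fun t _ => min_le_left _ _

theorem prim2_symmBump (hf : IsHalfBump f) {s x : ℝ} (hs : 0 ≤ s) :
    prim2 0 (fun t => symmBump f (t - s)) x =
      ∫ t, f t * (max (x - (t + s)) 0 + max (x - (1 - t + s)) 0) := by
  rw [prim2_eq_integral (hf.symmBump_integrable.comp_sub_right s)]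
  · simp_rw [mul_comm (max _ _)]
    exact hf.integral_symmBump_mul (by fun_prop) s
  · intro t ht
    by_contra h
    linarith [(hf.symmBump_mem h).1]

theorem prim2_symmBump_of_le (hf : IsHalfBump f) {s x : ℝ} (hs : 0 ≤ s) (hx : x ≤ s) :
    prim2 0 (fun t => symmBump f (t - s)) x = 0 := by
  rw [hf.prim2_symmBump hs, hf.integral_congr (k' := fun _ => 0)]
  · simp
  · intro t ht
    rw [max_eq_right (by linarith [ht.1]), max_eq_right (by linarith [ht.2]), add_zero]

/-- To the right of its support a symmetric bump acts like a point mass `2 ∫ f` at the centre `s + 1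
/ 2`. -/
theorem prim2_symmBump_of_ge (hf : IsHalfBump f) {s x : ℝ} (hs : 0 ≤ s) (hx : s + 1 ≤ x) :
    prim2 0 (fun t => symmBump f (t - s)) x = (∫ t, f t) * (2 * (x - s) - 1) := by
  rw [hf.prim2_symmBump hs, hf.integral_congr (k' := fun _ => 2 * (x - s) - 1), integral_mul_const]
  intro t ht
  rw [max_eq_left (by linarith [ht.2]), max_eq_left (by linarith [ht.1])]
  ring

/-- Here `y` is the distance to the left end of the support, in `prim2_symmBump_right` the distance
to the right end. The affine parts of the two formulas add up to the constant `∫ f`, so that a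
symmetric test function only sees this constant and the potential. -/
theorem prim2_symmBump_left (hf : IsHalfBump f) {s y : ℝ} (hs : 0 ≤ s)
    (hy : y ∈ Ioo (0 : ℝ) (1 / 2)) :
    prim2 0 (fun t => symmBump f (t - s)) (y + s) = (∫ t, f t) * y - potential f y := by
  rw [hf.prim2_symmBump hs, hf.integral_congr (k' := fun t => y - min y t)]
  · simp only [mul_sub]
    rw [integral_sub (hf.integrable.mul_const _) (hf.mul_integrable (by fun_prop)),
      integral_mul_const, potential]
  · intro t ht
    rw [max_eq_right (a := y + s - (1 - t + s)) (by linarith [ht.2, hy.2])]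
    rcases le_total y t with h | h
    · rw [min_eq_left h, max_eq_right (by linarith)]; ring
    · rw [min_eq_right h, max_eq_left (by linarith)]; ring

theorem prim2_symmBump_right (hf : IsHalfBump f) {s y : ℝ} (hs : 0 ≤ s)
    (hy : y ∈ Ioo (0 : ℝ) (1 / 2)) :
    prim2 0 (fun t => symmBump f (t - s)) (1 - y + s) =
      (∫ t, f t) * (1 - y) - potential f y := by
  rw [hf.prim2_symmBump hs, hf.integral_congr (k' := fun t => (1 - y) - min y t)]
  · have : ∀ t, f t * (1 - y - min y t) = f t * (1 - y) - f t * min y t := fun t => mul_sub _ _ _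
    simp only [this]
    rw [integral_sub (hf.integrable.mul_const _) (hf.mul_integrable (by fun_prop)),
      integral_mul_const, potential]
  · intro t ht
    rw [max_eq_left (a := 1 - y + s - (t + s)) (by linarith [ht.2, hy.2])]
    rcases le_total y t with h | h
    · rw [min_eq_left h, max_eq_left (by linarith)]; ring
    · rw [min_eq_right h, max_eq_right (by linarith)]; ring

/-- Reflection of a half bump, followed by scaling. -/
theorem prim2_reflect (hf : IsHalfBump f) (P : ℝ) {x : ℝ} (hx : 1 / 2 ≤ x) :
    prim2 0 (fun t => P * f (1 / 2 - t)) x =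
      P * ((∫ t, f t) * (x - 1 / 2) + ∫ t, f t * t) := by
  have hi : Integrable fun t => P * f (1 / 2 - t) := (hf.integrable.comp_sub_left _).const_mul P
  rw [prim2_eq_integral hi]
  · have h1 : ∫ t, max (x - t) 0 * (P * f (1 / 2 - t)) = P * ∫ t, f t * max (x - (1 / 2 - t)) 0 := by
      rw [← integral_const_mul, ← integral_sub_left_eq_self _ volume (1 / 2)]
      refine integral_congr_ae (Eventually.of_forall fun t => ?_)
      simp only [sub_sub_cancel]
      ring
    rw [h1, hf.integral_congr (k' := fun t => (x - 1 / 2) + t)]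
    · simp only [mul_add]
      rw [integral_add (hf.integrable.mul_const _) (hf.mul_integrable (k := fun t => t)
        continuous_id), integral_mul_const, mul_add]
    · intro t ht
      rw [max_eq_left (by linarith [ht.1])]
      ring
  · intro t ht
    by_contra h
    have h1 : f (1 / 2 - t) ≠ 0 := fun h' => h (by rw [h', mul_zero])
    linarith [(hf.mem_of_ne_zero _ h1).2]

end IsHalfBump

open IsHalfBump

/-! ### The two chains of bumps and their pairings -/

theorem abs_sum_rpow_of_disjoint {ι : Type*} [Fintype ι] {a : ι → ℝ} {r : ℝ} (hr : r ≠ 0)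
    (h : ∀ i j, a i ≠ 0 → a j ≠ 0 → i = j) : |∑ i, a i| ^ r = ∑ i, |a i| ^ r := by
  by_cases hz : ∃ i, a i ≠ 0
  · obtain ⟨i, hi⟩ := hz
    have h1 : ∀ j, j ≠ i → a j = 0 := fun j hj => by
      by_contra h2
      exact hj (h j i h2 hi)
    rw [Finset.sum_eq_single i (fun j _ hj => h1 j hj) (by simp),
      Finset.sum_eq_single i (fun j _ hj => by rw [h1 j hj, abs_zero, Real.zero_rpow hr]) (by simp)]
  · push Not at hz
    simp [hz, Real.zero_rpow hr]

/-- The bumps of a chain: a reflected half bump on `(0, 1/2)`, then translates of the symmetric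
bump on the intervals `(i - 1/2, i + 1/2)`. -/
noncomputable def chainBump (f : ℝ → ℝ) (P : ℝ) (i : ℕ) (t : ℝ) : ℝ :=
  if i = 0 then P * f (1 / 2 - t) else symmBump f (t - (i - 1 / 2))

/-- The bumps of the dual chain: translates of the symmetric bump on the intervals
`(j + 1/2, j + 3/2)` for `j < m`, then a half bump on `(m + 1/2, m + 1)`. -/
noncomputable def dualBump (g : ℝ → ℝ) (Q : ℝ) (m j : ℕ) (x : ℝ) : ℝ :=
  if j < m then symmBump g (x - (j + 1 / 2)) else Q * g (x - (m + 1 / 2))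

section Chain

variable {f g : ℝ → ℝ} {P Q : ℝ}

theorem chainBump_integrable (hf : IsHalfBump f) (i : ℕ) : Integrable (chainBump f P i) := by
  unfold chainBump
  split_ifs
  · exact (hf.integrable.comp_sub_left _).const_mul P
  · exact hf.symmBump_integrable.comp_sub_right _

theorem dualBump_integrable (hg : IsHalfBump g) (m j : ℕ) : Integrable (dualBump g Q m j) := by
  unfold dualBump
  split_ifs
  · exact hg.symmBump_integrable.comp_sub_right _
  · exact (hg.integrable.comp_sub_right _).const_mul Q

theorem chainBump_nonneg (hf : IsHalfBump f) (hP : 0 < P) (i : ℕ) (t : ℝ) :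
    0 ≤ chainBump f P i t := by
  unfold chainBump
  split_ifs
  · exact mul_nonneg hP.le (hf.nonneg _)
  · exact hf.symmBump_nonneg _

theorem dualBump_nonneg (hg : IsHalfBump g) (hQ : 0 < Q) (m j : ℕ) (x : ℝ) :
    0 ≤ dualBump g Q m j x := by
  unfold dualBump
  split_ifs
  · exact hg.symmBump_nonneg _
  · exact mul_nonneg hQ.le (hg.nonneg _)

theorem chainBump_mem (hf : IsHalfBump f) {i : ℕ} {t : ℝ} (h : chainBump f P i t ≠ 0) :
    0 < t ∧ (i : ℝ) - 1 / 2 < t ∧ t < i + 1 / 2 := by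
  unfold chainBump at h
  split_ifs at h with hi
  · have := hf.mem_of_ne_zero _ (right_ne_zero_of_mul h)
    subst hi
    exact ⟨by linarith [this.2], by push_cast; linarith [this.2], by push_cast; linarith [this.1]⟩
  · have := hf.symmBump_mem h
    have h1 : (1 : ℝ) ≤ i := by exact_mod_cast Nat.one_le_iff_ne_zero.2 hi
    exact ⟨by linarith [this.1], by linarith [this.1], by linarith [this.2]⟩

theorem dualBump_mem (hg : IsHalfBump g) {m j : ℕ} (hj : j ≤ m) {x : ℝ}
    (h : dualBump g Q m j x ≠ 0) : (j : ℝ) + 1 / 2 < x ∧ x < j + 3 / 2 ∧ x < m + 1 := by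
  unfold dualBump at h
  split_ifs at h with hi
  · have := hg.symmBump_mem h
    have h1 : (j : ℝ) + 1 ≤ m := by exact_mod_cast hi
    exact ⟨by linarith [this.1], by linarith [this.2], by linarith [this.2]⟩
  · have := hg.mem_of_ne_zero _ (right_ne_zero_of_mul h)
    obtain rfl : j = m := by omega
    exact ⟨by linarith [this.1], by linarith [this.2], by linarith [this.2]⟩

theorem symmBump_rpow (hf : IsHalfBump f) {r : ℝ} (hr : 0 < r) :
    (fun t => symmBump f t ^ r) = symmBump fun t => f t ^ r := by
  funext t
  unfold symmBump
  by_cases h0 : f t = 0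
  · simp [h0, Real.zero_rpow hr.ne']
  · have : f (1 - t) = 0 := by
      by_contra h2
      have h3 := hf.mem_of_ne_zero _ h0
      have h4 := hf.mem_of_ne_zero _ h2
      linarith [h3.2, h4.2]
    simp [this, Real.zero_rpow hr.ne']

theorem integrable_symmBump_rpow (hf : IsHalfBump f) {r : ℝ} (hr : 0 < r)
    (hi : Integrable fun t => f t ^ r) : Integrable fun t => symmBump f t ^ r := by
  rw [symmBump_rpow hf hr]
  exact hi.add (hi.comp_sub_left 1)

theorem integral_symmBump_rpow (hf : IsHalfBump f) {r : ℝ} (hr : 0 < r)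
    (hi : Integrable fun t => f t ^ r) : ∫ t, symmBump f t ^ r = 2 * ∫ t, f t ^ r := by
  rw [symmBump_rpow hf hr]
  unfold symmBump
  rw [integral_add hi (hi.comp_sub_left 1), integral_sub_left_eq_self (fun t => f t ^ r) volume 1]
  ring

theorem integrable_of_integral_ne_zero {k : ℝ → ℝ} (h : ∫ t, k t ≠ 0) : Integrable k := by
  by_contra hn
  exact h (integral_undef hn)

theorem integral_chainBump_rpow (hf : IsHalfBump f) {r : ℝ} (hr : 0 < r)
    (h : ∫ t, f t ^ r = 1 / 2) (hP : 0 < P) (hPr : P ^ r = 2) (i : ℕ) :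
    ∫ t, chainBump f P i t ^ r = 1 := by
  unfold chainBump
  split_ifs
  · simp_rw [Real.mul_rpow hP.le (hf.nonneg _)]
    rw [integral_const_mul, integral_sub_left_eq_self (fun t => f t ^ r) volume (1 / 2), h, hPr]
    norm_num
  · rw [integral_sub_right_eq_self (fun t => symmBump f t ^ r)]
    rw [integral_symmBump_rpow hf hr (integrable_of_integral_ne_zero (by rw [h]; norm_num)), h]
    norm_num

theorem integral_dualBump_rpow (hg : IsHalfBump g) {q : ℝ} (hq : 0 < q)
    (h : ∫ t, g t ^ q = 1 / 2) (hQ : 0 < Q) (hQr : Q ^ q = 2) (m j : ℕ) :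
    ∫ t, dualBump g Q m j t ^ q = 1 := by
  unfold dualBump
  split_ifs
  · rw [integral_sub_right_eq_self (fun t => symmBump g t ^ q)]
    rw [integral_symmBump_rpow hg hq (integrable_of_integral_ne_zero (by rw [h]; norm_num)), h]
    norm_num
  · simp_rw [Real.mul_rpow hQ.le (hg.nonneg _)]
    rw [integral_const_mul, integral_sub_right_eq_self (fun t => g t ^ q), h, hQr]
    norm_num

/-- Full bumps with index `i` are centred at `i`, full dual bumps with index `j` at `j + 1`, so the
supports meet only for `i = j + 1`. A bump further to the right contributes nothing. One further to
the left has an affine primitive on the support of the dual bump, so that only masses and first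
moments enter. On a common support the potentials produce `κ ν - l`. -/
theorem integral_dualBump_mul_prim2 (hf : IsHalfBump f) (hg : IsHalfBump g) (hPQ : P * Q = 2)
    {m j i : ℕ} (hj : j ≤ m) (hi : i ≤ m) :
    ∫ x, dualBump g Q m j x * prim2 0 (chainBump f P i) x =
      blockEntry (∫ t, f t) (∫ t, g t) (∫ t, f t * t) (∫ t, g t * t) P Q
        (2 * ∫ t, g t * potential f t) m j i := by
  have hc : Continuous (prim2 0 (chainBump f P i)) := prim2_continuous (chainBump_integrable hf i)
  have hlin : ∀ a b : ℝ, ∫ t, g t * (a + b * t) = (∫ t, g t) * a + b * ∫ t, g t * t := by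
    intro a b
    have : ∀ t, g t * (a + b * t) = g t * a + b * (g t * t) := fun t => by ring
    simp only [this]
    rw [integral_add (hg.integrable.mul_const _)
      ((hg.mul_integrable (k := fun t => t) continuous_id).const_mul _), integral_mul_const,
      integral_const_mul]
  rcases hj.lt_or_eq with hjm | rfl
  · have h1 : ∫ x, dualBump g Q m j x * prim2 0 (chainBump f P i) x =
        ∫ t, g t * (prim2 0 (chainBump f P i) (t + (j + 1 / 2)) +
          prim2 0 (chainBump f P i) (1 - t + (j + 1 / 2))) := by
      unfold dualBump
      simp only [hjm, if_true]
      exact hg.integral_symmBump_mul hc _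
    have hj0 : (0 : ℝ) ≤ j := Nat.cast_nonneg j
    rw [h1]
    unfold blockEntry
    rcases Nat.eq_zero_or_pos i with rfl | hi0
    · simp only [if_true, hjm]
      rw [hg.integral_congr (k' := fun t => P * (2 * ((∫ t, f t * t) +
        (∫ t, f t) * (j + 1 / 2)))), integral_mul_const]
      · ring
      · intro t ht
        unfold chainBump
        simp only [if_true]
        rw [hf.prim2_reflect P (by linarith [ht.1]), hf.prim2_reflect P (by linarith [ht.2])]
        ring
    · simp only [hi0.ne', if_false, hjm, if_true]
      have hi1 : (1 : ℝ) ≤ i := by exact_mod_cast hi0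
      have e : chainBump f P i = fun t => symmBump f (t - (i - 1 / 2)) := by
        funext t; simp [chainBump, hi0.ne']
      rw [e]
      split_ifs with h2 h3
      · have h2' : (i : ℝ) ≤ j := by exact_mod_cast h2
        rw [hg.integral_congr (k' := fun t => 4 * (∫ t, f t) * (j + 1 - i)), integral_mul_const]
        · ring
        · intro t ht
          rw [hf.prim2_symmBump_of_ge (by linarith) (by linarith [ht.1]),
            hf.prim2_symmBump_of_ge (by linarith) (by linarith [ht.2])]
          ring
      · have h3' : (i : ℝ) - 1 / 2 = j + 1 / 2 := by rw [h3]; push_cast; ring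
        rw [h3', hg.integral_congr (k' := fun t => (∫ t, f t) - 2 * potential f t)]
        · have : ∀ t, g t * ((∫ t, f t) - 2 * potential f t) =
              g t * (∫ t, f t) - 2 * (g t * potential f t) := fun t => by ring
          simp only [this]
          rw [integral_sub (hg.integrable.mul_const _)
            ((hg.mul_integrable hf.potential_continuous).const_mul _), integral_mul_const,
            integral_const_mul]
          ring
        · intro t ht
          rw [hf.prim2_symmBump_left (by linarith) ht, hf.prim2_symmBump_right (by linarith) ht]
          ring
      · have h4 : (j : ℝ) + 2 ≤ i := by exact_mod_cast (show j + 2 ≤ i by omega)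
        rw [hg.integral_congr (k' := fun _ => 0)]
        · simp
        · intro t ht
          rw [hf.prim2_symmBump_of_le (by linarith) (by linarith [ht.2]),
            hf.prim2_symmBump_of_le (by linarith) (by linarith [ht.1]), add_zero]
  · have h1 : ∫ x, dualBump g Q j j x * prim2 0 (chainBump f P i) x =
        Q * ∫ t, g t * prim2 0 (chainBump f P i) (t + (j + 1 / 2)) := by
      unfold dualBump
      simp only [lt_irrefl, if_false]
      rw [← integral_add_right_eq_self _ ((j : ℝ) + 1 / 2), ← integral_const_mul]
      simp only [add_sub_cancel_right, mul_assoc]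
    have hj0 : (0 : ℝ) ≤ j := Nat.cast_nonneg j
    rw [h1]
    unfold blockEntry
    rcases Nat.eq_zero_or_pos i with rfl | hi0
    · simp only [if_true, lt_irrefl, if_false]
      rw [hg.integral_congr (k' := fun t => P * ((∫ t, f t) * j + ∫ t, f t * t) +
        (P * ∫ t, f t) * t), hlin]
      · linear_combination ((∫ t, g t) * ((∫ t, f t) * j + ∫ t, f t * t) +
          (∫ t, f t) * ∫ t, g t * t) * hPQ
      · intro t ht
        unfold chainBump
        simp only [if_true]
        rw [hf.prim2_reflect P (by linarith [ht.1])]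
        ring
    · simp only [hi0.ne', if_false, lt_irrefl]
      have hi1 : (1 : ℝ) ≤ i := by exact_mod_cast hi0
      have hi2 : (i : ℝ) ≤ j := by exact_mod_cast hi
      have e : chainBump f P i = fun t => symmBump f (t - (i - 1 / 2)) := by
        funext t; simp [chainBump, hi0.ne']
      rw [e, hg.integral_congr (k' := fun t => (∫ t, f t) * (2 * (j - i) + 1) +
        (2 * ∫ t, f t) * t), hlin]
      · ring
      · intro t ht
        rw [hf.prim2_symmBump_of_ge (by linarith) (by linarith [ht.1])]
        ring

open Matrix in
/-- The pairings of the twofold primitive of a combination of the chain with the dual chain. -/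
theorem integral_dualBump_mul_prim2_sum (hf : IsHalfBump f) (hg : IsHalfBump g) (hPQ : P * Q = 2)
    {m : ℕ} (c : Fin (m + 1) → ℝ) (j : Fin (m + 1)) :
    ∫ x, dualBump g Q m j x *
      prim2 0 (fun t => ∑ i : Fin (m + 1), ((-1) ^ (i : ℕ) * c i) * chainBump f P i t) x =
      (-1) ^ (j : ℕ) * (blockMatrix (∫ t, f t) (∫ t, g t) (∫ t, f t * t) (∫ t, g t * t) P Q
        (2 * ∫ t, g t * potential f t) m *ᵥ c) j := by
  have hj := Nat.lt_succ_iff.1 j.2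
  have h1 : ∀ x, dualBump g Q m j x *
      prim2 0 (fun t => ∑ i : Fin (m + 1), ((-1) ^ (i : ℕ) * c i) * chainBump f P i t) x =
      ∑ i : Fin (m + 1), ((-1) ^ (i : ℕ) * c i) *
        (dualBump g Q m j x * prim2 0 (chainBump f P i) x) := by
    intro x
    rw [prim2_sum _ (fun i : Fin (m + 1) => chainBump f P i) _
      (fun i _ => chainBump_integrable hf i), Finset.mul_sum]
    exact Finset.sum_congr rfl fun i _ => by ring
  have hint : ∀ i : Fin (m + 1), Integrable fun x =>
      dualBump g Q m j x * prim2 0 (chainBump f P i) x := by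
    intro i
    have hc : Continuous (prim2 0 (chainBump f P i)) := prim2_continuous (chainBump_integrable hf i)
    obtain ⟨C, hC⟩ := (isCompact_Icc (a := (j : ℝ) + 1 / 2) (b := j + 3 / 2)).exists_bound_of_continuousOn
      hc.continuousOn
    refine Integrable.mono' ((dualBump_integrable (Q := Q) hg m j).norm.mul_const C)
      ((dualBump_integrable hg m j).1.mul hc.aestronglyMeasurable) (Eventually.of_forall fun x => ?_)
    rw [norm_mul]
    by_cases hx : dualBump g Q m j x = 0
    · simp [hx]
    · have := dualBump_mem hg hj hx
      exact mul_le_mul_of_nonneg_left (hC x ⟨this.1.le, this.2.1.le⟩) (norm_nonneg _)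
  simp only [h1]
  rw [integral_finsetSum _ fun i _ => (hint i).const_mul _, mulVec, dotProduct, Finset.mul_sum]
  refine Finset.sum_congr rfl fun i _ => ?_
  rw [integral_const_mul, integral_dualBump_mul_prim2 hf hg hPQ hj (Nat.lt_succ_iff.1 i.2),
    blockMatrix, pow_add]
  have : ((-1 : ℝ) ^ (j : ℕ)) * (-1) ^ (j : ℕ) = 1 := by rw [← pow_add, ← two_mul, pow_mul]; simp
  linear_combination (-(-1 : ℝ) ^ (i : ℕ) * c i *
    blockEntry (∫ t, f t) (∫ t, g t) (∫ t, f t * t) (∫ t, g t * t) P Q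
        (2 * ∫ t, g t * potential f t) m j i) * this

end Chain

open IsHalfBump

section Chain

variable {f g : ℝ → ℝ} {P Q : ℝ}

-- Pairings of alternating sign force the twofold primitive to alternate at points of the
-- consecutive dual supports. As it vanishes at `0` together with its derivative,
-- `exists_alternating` applies twice without loss of a sign change and yields `m + 1` alternations
-- of the combination of bumps. Since the bumps have ordered supports, the coefficients alternate as
-- well.
open Matrix in
theorem blockMatrix_monotone (hf : IsHalfBump f) (hg : IsHalfBump g) (hP : 0 < P) (hQ : 0 < Q)
    (hPQ : P * Q = 2) {m : ℕ} (c : Fin (m + 1) → ℝ)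
    (hc : ∀ j, 0 < (blockMatrix (∫ t, f t) (∫ t, g t) (∫ t, f t * t) (∫ t, g t * t) P Q
      (2 * ∫ t, g t * potential f t) m *ᵥ c) j) (i : Fin (m + 1)) : 0 < c i := by
  set F : ℝ → ℝ := fun t => ∑ i : Fin (m + 1), ((-1) ^ (i : ℕ) * c i) * chainBump f P i t with hF
  have hsq : ∀ k : ℕ, ((-1 : ℝ)) ^ k * (-1) ^ k = 1 := fun k => by
    rw [← pow_add, ← two_mul, pow_mul]; simp
  have hFi : Integrable F := integrable_finsetSum _ fun i _ =>
    (chainBump_integrable hf i).const_mul _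
  have hex : ∀ j : ℕ, ∃ x, j < m + 1 → ((j : ℝ) + 1 / 2 < x ∧ x < j + 3 / 2) ∧
      0 < (-1) ^ j * prim2 0 F x := by
    intro j
    by_cases hj : j < m + 1
    · have h1 := integral_dualBump_mul_prim2_sum hf hg hPQ c ⟨j, hj⟩
      have h2 : 0 < ∫ x, (-1) ^ j * (dualBump g Q m j x * prim2 0 F x) := by
        rw [integral_const_mul, h1, ← mul_assoc, hsq, one_mul]
        exact hc _
      have h3 : ∃ x, 0 < (-1) ^ j * (dualBump g Q m j x * prim2 0 F x) := by
        by_contra! hn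
        exact h2.not_ge (integral_nonpos hn)
      obtain ⟨x, hx⟩ := h3
      have h4 : 0 < dualBump g Q m j x * ((-1) ^ j * prim2 0 F x) := by linarith
      have h5 : dualBump g Q m j x ≠ 0 := fun h => by simp [h] at h4
      have h6 := dualBump_mem hg (Nat.lt_succ_iff.1 hj) h5
      exact ⟨x, fun _ => ⟨⟨h6.1, h6.2.1⟩, pos_of_mul_pos_right h4 (dualBump_nonneg hg hQ _ _ _)⟩⟩
    · exact ⟨0, fun h => absurd h hj⟩
  choose x hx using hex
  have hx0 : 0 < x 0 := by
    have := (hx 0 (by omega)).1.1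
    push_cast at this
    linarith
  obtain ⟨ξ, hξ0, hξ, hξs⟩ := exists_alternating (f := fun s => ∫ t in 0..s, F t) (a := 0)
    (n := m + 1) (x := x) (fun _ _ => Continuous.intervalIntegrable
      (intervalIntegral.continuous_primitive (fun _ _ => hFi.intervalIntegrable) _) _ _) hx0
    (fun j hj => by
      have h1 := (hx j (by omega)).1.2
      have h2 := (hx (j + 1) hj).1.1
      push_cast at h2
      linarith) (fun j hj => (hx j hj).2)
  obtain ⟨ζ, _, hζ, hζs⟩ := exists_alternating (f := F) (a := 0) (n := m + 1) (x := ξ)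
    (fun _ _ => hFi.intervalIntegrable) (hξ0 (by omega)) hξ hξs
  have := coeff_pos_of_alternating (F := fun i : Fin (m + 1) => chainBump f P i)
    (fun i t => chainBump_nonneg hf hP i t) (fun i j hij s t hs ht => by
      have h1 := chainBump_mem hf hs
      have h2 := chainBump_mem hf ht
      have h3 : ((i : ℕ) : ℝ) + 1 ≤ (j : ℕ) := by exact_mod_cast Fin.lt_def.1 hij
      linarith [h1.2.2, h2.2.1]) hζ hζs i
  rwa [← mul_assoc, hsq, one_mul] at this

theorem abs_integral_mul_rpow_le {r q : ℝ} (hrq : r.HolderConjugate q) {G U : ℝ → ℝ}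
    (hG : AEStronglyMeasurable G) (hG0 : ∀ x, 0 ≤ G x) (hGq : ∫ x, G x ^ q = 1)
    (hU : Continuous U) {J : Set ℝ}
    (hJ : IntegrableOn (fun x => |U x| ^ r) J) (hGJ : ∀ x, G x ≠ 0 → x ∈ J) :
    |∫ x, G x * U x| ^ r ≤ ∫ x in J, |U x| ^ r := by
  have hr := hrq.pos
  have hq := hrq.symm.pos
  have hGi : Integrable fun x => G x ^ q := by
    by_contra hn
    rw [integral_undef hn] at hGq
    norm_num at hGq
  have hM1 : MemLp (fun x => |U x|) (ENNReal.ofReal r) (volume.restrict J) := by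
    rw [← integrable_norm_rpow_iff hU.abs.aestronglyMeasurable
      (by simpa using hr) ENNReal.ofReal_ne_top, ENNReal.toReal_ofReal hr.le]
    simpa [IntegrableOn] using hJ
  have hM2 : MemLp G (ENNReal.ofReal q) (volume.restrict J) := by
    rw [← integrable_norm_rpow_iff hG.restrict (by simpa using hq) ENNReal.ofReal_ne_top,
      ENNReal.toReal_ofReal hq.le]
    simp_rw [Real.norm_of_nonneg (hG0 _)]
    exact hGi.integrableOn
  have h1 : ∫ x, G x * U x = ∫ x in J, G x * U x := by
    refine (setIntegral_eq_integral_of_forall_compl_eq_zero fun x hx => ?_).symm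
    have : G x = 0 := by
      by_contra h
      exact hx (hGJ x h)
    rw [this, zero_mul]
  have h2 : |∫ x in J, G x * U x| ≤ ∫ x in J, |U x| * G x := by
    refine (abs_integral_le_integral_abs).trans (le_of_eq ?_)
    refine integral_congr_ae (Eventually.of_forall fun x => ?_)
    simp only [abs_mul, abs_of_nonneg (hG0 x), mul_comm]
  have h3 := integral_mul_le_Lp_mul_Lq_of_nonneg hrq (μ := volume.restrict J)
    (Eventually.of_forall fun x => abs_nonneg (U x)) (Eventually.of_forall hG0) hM1 hM2
  have h4 : (∫ x in J, G x ^ q) ^ (1 / q) ≤ 1 := by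
    refine Real.rpow_le_one (integral_nonneg fun x => Real.rpow_nonneg (hG0 x) _) ?_ (by positivity)
    rw [← hGq]
    exact setIntegral_le_integral hGi (Eventually.of_forall fun x => Real.rpow_nonneg (hG0 x) _)
  have h0 : 0 ≤ ∫ x in J, |U x| ^ r := integral_nonneg fun x => Real.rpow_nonneg (abs_nonneg _) _
  have h5 : |∫ x, G x * U x| ≤ (∫ x in J, |U x| ^ r) ^ (1 / r) := by
    rw [h1]
    refine h2.trans (h3.trans ?_)
    exact mul_le_of_le_one_right (Real.rpow_nonneg h0 _) h4
  calc _ ≤ ((∫ x in J, |U x| ^ r) ^ (1 / r)) ^ r := Real.rpow_le_rpow (abs_nonneg _) h5 hr.le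
    _ = _ := by rw [← Real.rpow_mul h0, one_div_mul_cancel hr.ne', Real.rpow_one]

open Matrix in
/-- On the span of the chain, the twofold primitive is bounded below by the pairing of the two
half bumps. -/
theorem exists_chain {r q : ℝ} (hrq : r.HolderConjugate q) (hf : IsHalfBump f) (hg : IsHalfBump g)
    (hfr : ∫ t, f t ^ r = 1 / 2) (hgq : ∫ t, g t ^ q = 1 / 2)
    (hl : 0 < 2 * ∫ t, g t * potential f t) (m : ℕ) :
    ∃ F : Fin (m + 1) → ℝ → ℝ, (∀ i, Integrable (F i)) ∧ (∀ i t, F i t ≠ 0 → t ∈ Ioo 0 (m + 1 : ℝ)) ∧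
      ∀ c : Fin (m + 1) → ℝ, Integrable (fun t => |∑ i, c i * F i t| ^ r) ∧
        ∫ t, |∑ i, c i * F i t| ^ r = ∑ i, |c i| ^ r ∧
        (2 * ∫ t, g t * potential f t) ^ r * ∑ i, |c i| ^ r ≤
          ∫ x in Ioo 0 (m + 1 : ℝ), |prim2 0 (fun t => ∑ i, c i * F i t) x| ^ r := by
  have hr := hrq.pos
  have hr1 := hrq.lt
  have hq := hrq.symm.pos
  -- These factors give the half bumps at the ends the same norm as the full bumps; `P Q = 2`
  -- because the exponents are conjugate.
  set P : ℝ := 2 ^ (1 / r) with hPd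
  set Q : ℝ := 2 ^ (1 / q) with hQd
  have hP : 0 < P := by positivity
  have hQ : 0 < Q := by positivity
  have hPr : P ^ r = 2 := by
    rw [hPd, ← Real.rpow_mul two_pos.le, one_div_mul_cancel hr.ne', Real.rpow_one]
  have hQq : Q ^ q = 2 := by
    rw [hQd, ← Real.rpow_mul two_pos.le, one_div_mul_cancel hq.ne', Real.rpow_one]
  have hPQ : P * Q = 2 := by
    rw [hPd, hQd, ← Real.rpow_add two_pos, one_div, one_div, hrq.inv_add_inv_eq_one, Real.rpow_one]
  have hint : ∀ i, Integrable fun t => chainBump f P i t ^ r := by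
    intro i
    by_contra hn
    have := integral_chainBump_rpow hf hr hfr hP hPr i
    rw [integral_undef hn] at this
    norm_num at this
  refine ⟨fun i => chainBump f P i, fun i => chainBump_integrable hf i, fun i t ht => ?_, fun c => ?_⟩
  · have h1 := chainBump_mem hf ht
    have h2 : ((i : ℕ) : ℝ) ≤ m := by exact_mod_cast Nat.lt_succ_iff.1 i.2
    exact ⟨h1.1, by linarith [h1.2.2]⟩
  have hdis : ∀ t, |∑ i : Fin (m + 1), c i * chainBump f P i t| ^ r =
      ∑ i : Fin (m + 1), |c i| ^ r * chainBump f P i t ^ r := by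
    intro t
    rw [abs_sum_rpow_of_disjoint hr.ne']
    · refine Finset.sum_congr rfl fun i _ => ?_
      rw [abs_mul, Real.mul_rpow (abs_nonneg _) (abs_nonneg _),
        abs_of_nonneg (chainBump_nonneg hf hP i t)]
    · intro i j hi hj
      have h1 := chainBump_mem hf (right_ne_zero_of_mul hi)
      have h2 := chainBump_mem hf (right_ne_zero_of_mul hj)
      by_contra hne
      rcases lt_or_gt_of_ne hne with h | h
      · have h3 : ((i : ℕ) : ℝ) + 1 ≤ (j : ℕ) := by exact_mod_cast Fin.lt_def.1 h
        linarith [h1.2.2, h2.2.1]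
      · have h3 : ((j : ℕ) : ℝ) + 1 ≤ (i : ℕ) := by exact_mod_cast Fin.lt_def.1 h
        linarith [h2.2.2, h1.2.1]
  refine ⟨?_, ?_, ?_⟩
  · simp only [hdis]
    exact integrable_finsetSum _ fun i _ => (hint i).const_mul _
  · simp only [hdis]
    rw [integral_finsetSum (f := fun (i : Fin (m + 1)) t => |c i| ^ r * chainBump f P i t ^ r) _
      fun i _ => (hint i).const_mul _]
    refine Finset.sum_congr rfl fun i _ => ?_
    rw [integral_const_mul, integral_chainBump_rpow hf hr hfr hP hPr, mul_one]
  set κ := ∫ t, f t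
  set ν := ∫ t, g t
  set A := ∫ t, f t * t
  set A' := ∫ t, g t * t
  set l := 2 * ∫ t, g t * potential f t with hld
  have hν0 : 0 ≤ ν := integral_nonneg hg.nonneg
  have hκ0 : 0 ≤ κ := integral_nonneg hf.nonneg
  -- On `(0, 1/2)` the potential at `t` is at most `κ t ≤ κ / 2`, and also at most `A`. Integration
  -- against `g` gives the three bounds of `l` that the matrix estimate requires.
  have e1 : l ≤ κ * ν := by
    have := hg.integral_mono hf.potential_continuous (k' := fun _ => κ * (1 / 2)) continuous_const
      fun t ht => (hf.potential_le_mul t).trans (mul_le_mul_of_nonneg_left ht.2.le hκ0)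
    rw [integral_mul_const] at this
    change _ ≤ ν * _ at this
    linarith
  have e2 : l ≤ 2 * ν * A := by
    have := hg.integral_mono hf.potential_continuous (k' := fun _ => A) continuous_const
      fun t ht => hf.potential_le_moment t
    rw [integral_mul_const] at this
    change _ ≤ ν * _ at this
    linarith
  have e3 : l ≤ 2 * κ * A' := by
    have := hg.integral_mono hf.potential_continuous (k' := fun t => κ * t) (by fun_prop)
      fun t ht => hf.potential_le_mul t
    have h : ∀ t, g t * (κ * t) = κ * (g t * t) := fun t => by ring
    simp only [h] at this
    rw [integral_const_mul] at this
    change _ ≤ κ * A' at this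
    linarith
  have hν : 0 < ν := hν0.lt_of_ne fun h => by rw [← h] at e1; linarith
  have hκ : 0 < κ := hκ0.lt_of_ne fun h => by rw [← h] at e1; linarith
  have hsq : ∀ k : ℕ, ((-1 : ℝ)) ^ k * (-1) ^ k = 1 := fun k => by
    rw [← pow_add, ← two_mul, pow_mul]; simp
  have habs : ∀ k : ℕ, |((-1 : ℝ)) ^ k| = 1 := fun k => by simp
  have hmain := blockMatrix_lower_bound hr1 hκ hν hl e1 e2 e3 hP hPr hPQ
    (blockMatrix_monotone hf hg hP hQ hPQ) (fun i : Fin (m + 1) => (-1) ^ (i : ℕ) * c i)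
  have h1 : ∀ i : Fin (m + 1), |(-1) ^ (i : ℕ) * c i| = |c i| := fun i => by
    rw [abs_mul, habs, one_mul]
  simp only [h1] at hmain
  refine hmain.trans ?_
  set U := prim2 0 fun t => ∑ i : Fin (m + 1), c i * chainBump f P i t with hUd
  have hU : Continuous U := prim2_continuous (integrable_finsetSum _ fun i _ =>
    (chainBump_integrable hf i).const_mul _)
  have hUr : Continuous fun x => |U x| ^ r := hU.abs.rpow_const fun _ => Or.inr hr.le
  have hUi : IntegrableOn (fun x => |U x| ^ r) (Ioo 0 (m + 1 : ℝ)) :=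
    (hUr.continuousOn.integrableOn_Icc).mono_set Ioo_subset_Icc_self
  -- The dual bump `j` vanishes outside `J j`. These sets are disjoint, so the bounds from Hölder's
  -- inequality on each of them add up.
  set J : Fin (m + 1) → Set ℝ := fun j =>
    Ioo ((j : ℕ) + 1 / 2 : ℝ) ((j : ℕ) + 3 / 2) ∩ Ioo 0 (m + 1 : ℝ) with hJ
  have hJm : ∀ j, MeasurableSet (J j) := fun j => measurableSet_Ioo.inter measurableSet_Ioo
  have hJd : Pairwise (Function.onFun Disjoint J) := by
    intro i j hij
    rw [Function.onFun, Set.disjoint_left]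
    intro x hx hy
    rcases lt_or_gt_of_ne hij with h | h
    · have h3 : ((i : ℕ) : ℝ) + 1 ≤ (j : ℕ) := by exact_mod_cast Fin.lt_def.1 h
      linarith [hx.1.2, hy.1.1]
    · have h3 : ((j : ℕ) : ℝ) + 1 ≤ (i : ℕ) := by exact_mod_cast Fin.lt_def.1 h
      linarith [hx.1.1, hy.1.2]
  calc _ ≤ ∑ j, ∫ x in J j, |U x| ^ r := by
        refine Finset.sum_le_sum fun j _ => ?_
        have h2 := integral_dualBump_mul_prim2_sum (P := P) (Q := Q) hf hg hPQ
          (fun i : Fin (m + 1) => (-1) ^ (i : ℕ) * c i) j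
        simp only [← mul_assoc, hsq, one_mul] at h2
        have h3 := abs_integral_mul_rpow_le (J := J j) hrq
          (dualBump_integrable (Q := Q) hg m j).1
          (dualBump_nonneg hg hQ m j) (integral_dualBump_rpow hg hq hgq hQ hQq m j) hU
          (hUi.mono_set inter_subset_right) (fun x hx => by
            have h4 := dualBump_mem hg (Nat.lt_succ_iff.1 j.2) hx
            have h5 : (0 : ℝ) ≤ (j : ℕ) := Nat.cast_nonneg _
            exact ⟨⟨h4.1, h4.2.1⟩, by linarith [h4.1], h4.2.2⟩)
        rw [h2, abs_mul, habs, one_mul] at h3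
        exact h3
    _ = ∫ x in ⋃ j, J j, |U x| ^ r := by
        rw [integral_iUnion_fintype hJm hJd fun j => hUi.mono_set inter_subset_right]
    _ ≤ _ := setIntegral_mono_set hUi
        (Eventually.of_forall fun x => Real.rpow_nonneg (abs_nonneg _) _)
        (iUnion_subset fun j => inter_subset_right).eventuallyLE

end Chain

/-! ### Norms as integrals of powers -/

section Norms

variable {p : ℝ≥0∞} [hp1 : Fact (1 ≤ p)] {a b : ℝ} {f : ℝ → ℝ}

instance isFiniteMeasure_intervalMeasure (a b : ℝ) : IsFiniteMeasure (intervalMeasure a b) :=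
  ⟨by simp [intervalMeasure]⟩

theorem toReal_eLpNorm_eq (hp : p ≠ ⊤) (hf : MemLp f p (intervalMeasure a b)) :
    (eLpNorm f p (intervalMeasure a b)).toReal =
      (∫ x in Ioo a b, |f x| ^ p.toReal) ^ (1 / p.toReal) := by
  have h0 : p ≠ 0 := (zero_lt_one.trans_le hp1.out).ne'
  rw [hf.eLpNorm_eq_integral_rpow_norm h0 hp, ENNReal.toReal_ofReal, one_div]
  · rfl
  · exact Real.rpow_nonneg (integral_nonneg fun x => Real.rpow_nonneg (norm_nonneg _) _) _

theorem integrableOn_rpow_of_memLp (hp : p ≠ ⊤) (hf : MemLp f p (intervalMeasure a b)) :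
    IntegrableOn (fun x => |f x| ^ p.toReal) (Ioo a b) :=
  (integrable_norm_rpow_iff hf.1 (zero_lt_one.trans_le hp1.out).ne' hp).2 hf

theorem memLp_of_integrableOn_rpow (hp : p ≠ ⊤) (hm : AEStronglyMeasurable f (intervalMeasure a b))
    (hf : IntegrableOn (fun x => |f x| ^ p.toReal) (Ioo a b)) : MemLp f p (intervalMeasure a b) :=
  (integrable_norm_rpow_iff hm (zero_lt_one.trans_le hp1.out).ne' hp).1 hf

theorem integral_rpow_eq_zero_iff (hp : p ≠ ⊤) (hf : MemLp f p (intervalMeasure a b)) :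
    ∫ x in Ioo a b, |f x| ^ p.toReal = 0 ↔ f =ᵐ[intervalMeasure a b] 0 := by
  have hr : p.toReal ≠ 0 := (ENNReal.toReal_pos (zero_lt_one.trans_le hp1.out).ne' hp).ne'
  rw [integral_eq_zero_iff_of_nonneg (fun x => Real.rpow_nonneg (abs_nonneg _) _)
    (integrableOn_rpow_of_memLp hp hf)]
  constructor <;> intro h <;> filter_upwards [h] with x hx
  · simpa [Real.rpow_eq_zero (abs_nonneg _) hr] using hx
  · simp [hx, Real.zero_rpow hr]

theorem memLp_of_continuousOn {p : ℝ≥0∞} (hf : ContinuousOn f (Icc a b)) : MemLp f p (intervalMeasure a b) := by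
  obtain ⟨C, hC⟩ := isCompact_Icc.exists_bound_of_continuousOn hf
  refine MemLp.of_bound ((hf.mono Ioo_subset_Icc_self).aestronglyMeasurable measurableSet_Ioo) C ?_
  exact (ae_restrict_iff' measurableSet_Ioo).2
    (Eventually.of_forall fun x hx => hC x (Ioo_subset_Icc_self hx))

theorem intervalIntegrable_of_memLp (hab : a ≤ b) (hf : MemLp f p (intervalMeasure a b)) :
    IntervalIntegrable f volume a b := by
  rw [intervalIntegrable_iff_integrableOn_Ioo_of_le hab]
  exact hf.integrable hp1.out

end Norms

/-! ### The interpolation constant as the norm of the Navier solution operator -/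

section Navier

/-- The solution of `-u'' = f` on `(0, 1)` with `u(0) = u(1) = 0`. -/
noncomputable def navier (f : ℝ → ℝ) (x : ℝ) : ℝ := x * prim2 0 f 1 - prim2 0 f x

theorem prim2_congr_ae {a b : ℝ} {f g : ℝ → ℝ} (h : f =ᵐ[intervalMeasure a b] g) {x : ℝ}
    (hx : x ∈ Icc a b) : prim2 a f x = prim2 a g x := by
  have h1 : ∀ s ∈ Icc a b, ∫ t in a..s, f t = ∫ t in a..s, g t := by
    intro s hs
    rw [intervalIntegral.integral_of_le hs.1, intervalIntegral.integral_of_le hs.1,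
      integral_Ioc_eq_integral_Ioo, integral_Ioc_eq_integral_Ioo]
    exact integral_congr_ae (ae_restrict_of_ae_restrict_of_subset (Ioo_subset_Ioo_right hs.2) h)
  refine intervalIntegral.integral_congr fun s hs => ?_
  rw [uIcc_of_le hx.1] at hs
  exact h1 s ⟨hs.1, hs.2.trans hx.2⟩

variable {p : ℝ≥0∞} [hp1 : Fact (1 ≤ p)]

/-- After subtraction of the twofold primitive, the first derivative has weak derivative zero and is
constant; subtracting the linear function with this slope and repeating the argument leaves a
constant. -/
theorem IsW2.eq_prim2 {a b : ℝ} (hab : a ≤ b) {u u' u'' : ℝ → ℝ} (h : IsW2 p a b u u' u'') :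
    ∃ c, ∀ x ∈ Icc a b, u x = u a + c * (x - a) + prim2 a u'' x := by
  have k := isW2_primitive hab h.memLp''
  have hv := h.add (k.smul (-1))
  have hz : u'' + (-1 : ℝ) • u'' =ᵐ[intervalMeasure a b] 0 :=
    Eventually.of_forall fun x => by simp
  set v := u + (-1 : ℝ) • fun x => ∫ s in a..x, ∫ t in a..s, u'' t with hvd
  set v' := u' + (-1 : ℝ) • fun x => ∫ t in a..x, u'' t with hvd'
  have h1 := eq_of_isWeakDeriv_zero hv.cont' hz hv.weak'
  refine ⟨v' a, fun x hx => ?_⟩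
  have hlin : IsWeakDeriv a b (fun x => ∫ t in a..x, v' a) (fun _ => v' a) :=
    isWeakDeriv_primitive hab (by simp)
  have hlc : ContinuousOn (fun x => ∫ t in a..x, v' a) (Icc a b) := by
    simp only [intervalIntegral.integral_const]
    fun_prop
  have h2 := isWeakDeriv_add (p := p) hv.memLp hv.memLp' ((memLp_of_continuousOn hlc).const_smul (-1))
    ((memLp_const (v' a)).const_smul (-1)) hv.weak (isWeakDeriv_smul (-1) hlin)
  have h3 : v' + (-1 : ℝ) • (fun _ => v' a) =ᵐ[intervalMeasure a b] 0 := by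
    refine (ae_restrict_iff' measurableSet_Ioo).2 (Eventually.of_forall fun x hx => ?_)
    simp [h1 x (Ioo_subset_Icc_self hx)]
  have h4 := eq_of_isWeakDeriv_zero (hv.cont.add (hlc.const_smul (-1))) h3 h2 x hx
  have h5 : prim2 a u'' a = 0 := intervalIntegral.integral_same
  have h6 : v x = u x - prim2 a u'' x := by simp [hvd, prim2]; ring
  have h7 : v a = u a := by simp [hvd]
  simp only [Pi.add_apply, Pi.smul_apply, smul_eq_mul, intervalIntegral.integral_const, sub_self,
    zero_mul, mul_zero, add_zero] at h4
  rw [h6, h7] at h4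
  linarith

theorem IsW2.sub_affineInterp {u u' u'' : ℝ → ℝ} (h : IsW2 p 0 1 u u' u'') {x : ℝ}
    (hx : x ∈ Icc (0 : ℝ) 1) : (u - affineInterp 0 1 u) x = -navier u'' x := by
  obtain ⟨c, hc⟩ := h.eq_prim2 zero_le_one
  have h1 := hc x hx
  have h2 := hc 1 (by simp)
  simp only [Pi.sub_apply, affineInterp, navier, h1, h2]
  ring

theorem abs_prim2_le {f : ℝ → ℝ} (hf : MemLp f p (intervalMeasure 0 1)) {x : ℝ}
    (hx : x ∈ Icc (0 : ℝ) 1) : |prim2 0 f x| ≤ ∫ t in Ioo (0 : ℝ) 1, |f t| := by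
  have hi := intervalIntegrable_of_memLp zero_le_one hf
  have hix : IntervalIntegrable f volume 0 x :=
    hi.mono_set (by rw [uIcc_of_le hx.1, uIcc_of_le zero_le_one]; exact Icc_subset_Icc_right hx.2)
  have hf1 : IntegrableOn (fun t => |f t|) (Ioo 0 1) := (hf.integrable hp1.out).abs
  rw [prim2_eq hix, intervalIntegral.integral_of_le hx.1, integral_Ioc_eq_integral_Ioo]
  refine abs_integral_le_integral_abs.trans ?_
  refine (integral_mono_of_nonneg (g := fun t => |f t|) (Eventually.of_forall fun t => abs_nonneg _)
    (hf1.mono_set (Ioo_subset_Ioo_right hx.2)) ?_).trans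
    (setIntegral_mono_set hf1 (Eventually.of_forall fun t => abs_nonneg _)
      (Ioo_subset_Ioo_right hx.2).eventuallyLE)
  refine (ae_restrict_iff' measurableSet_Ioo).2 (Eventually.of_forall fun t ht => ?_)
  simp only
  rw [abs_mul]
  refine mul_le_of_le_one_left (abs_nonneg _) ?_
  rw [abs_of_nonneg (by linarith [ht.2])]
  linarith [ht.1, hx.2]

theorem navier_continuousOn {f : ℝ → ℝ} (hf : MemLp f p (intervalMeasure 0 1)) :
    ContinuousOn (navier f) (Icc 0 1) :=
  (continuousOn_id.mul continuousOn_const).sub (isW2_primitive zero_le_one hf).cont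

/-- The value of the constant is irrelevant. The main purpose is that the supremum in `interpConst`
is over a bounded set, hence not the default value `0`. -/
theorem toReal_eLpNorm_navier_le {f : ℝ → ℝ} (hf : MemLp f p (intervalMeasure 0 1)) :
    (eLpNorm (navier f) p (intervalMeasure 0 1)).toReal ≤
      2 * (eLpNorm f p (intervalMeasure 0 1)).toReal := by
  have hu : intervalMeasure 0 1 univ = 1 := by simp [intervalMeasure]
  have : IsProbabilityMeasure (intervalMeasure 0 1) := ⟨hu⟩
  have h1 := eLpNorm_le_eLpNorm_of_exponent_le hp1.out hf.1
  have h2 := ENNReal.toReal_mono hf.2.ne h1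
  have h3 : (eLpNorm f 1 (intervalMeasure 0 1)).toReal = ∫ t in Ioo (0 : ℝ) 1, |f t| := by
    rw [eLpNorm_one_eq_lintegral_enorm, ← integral_norm_eq_lintegral_enorm hf.1]; rfl
  rw [h3] at h2
  have h0 : 0 ≤ ∫ t in Ioo (0 : ℝ) 1, |f t| := integral_nonneg fun t => abs_nonneg _
  have h4 : ∀ᵐ x ∂intervalMeasure 0 1, ‖navier f x‖ ≤ 2 * ∫ t in Ioo (0 : ℝ) 1, |f t| := by
    refine (ae_restrict_iff' measurableSet_Ioo).2 (Eventually.of_forall fun x hx => ?_)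
    have h5 := abs_prim2_le hf (Ioo_subset_Icc_self hx)
    have h6 := abs_prim2_le hf (x := 1) (by simp)
    rw [Real.norm_eq_abs, navier]
    refine (abs_sub _ _).trans ?_
    rw [abs_mul, abs_of_pos hx.1]
    nlinarith [hx.2, hx.1, abs_nonneg (prim2 0 f 1)]
  have h7 := eLpNorm_le_of_ae_bound (p := p) h4
  rw [hu, ENNReal.one_rpow, one_mul] at h7
  have h8 := ENNReal.toReal_mono ENNReal.ofReal_ne_top h7
  rw [ENNReal.toReal_ofReal (by positivity)] at h8
  linarith

/-- The error `u - Ku` depends on `u''` only, and every function in `L_p` is the second derivative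
of its twofold primitive. -/
theorem interpConst_eq_sSup : interpConst p 0 1 =
    sSup {s | ∃ f : ℝ → ℝ, MemLp f p (intervalMeasure 0 1) ∧ ¬ f =ᵐ[intervalMeasure 0 1] 0 ∧
      s = (eLpNorm (navier f) p (intervalMeasure 0 1)).toReal /
        (eLpNorm f p (intervalMeasure 0 1)).toReal} := by
  have key : ∀ u u' u'' : ℝ → ℝ, IsW2 p 0 1 u u' u'' →
      eLpNorm (u - affineInterp 0 1 u) p (intervalMeasure 0 1) =
        eLpNorm (navier u'') p (intervalMeasure 0 1) := by
    intro u u' u'' h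
    rw [← eLpNorm_neg (navier u'')]
    refine eLpNorm_congr_ae ?_
    exact (ae_restrict_iff' measurableSet_Ioo).2
      (Eventually.of_forall fun x hx => h.sub_affineInterp (Ioo_subset_Icc_self hx))
  unfold interpConst
  congr 1
  ext s
  constructor
  · rintro ⟨u, u', u'', h, hne, rfl⟩
    exact ⟨u'', h.memLp'', hne, by rw [key u u' u'' h]⟩
  · rintro ⟨f, hf, hne, rfl⟩
    have h := isW2_primitive zero_le_one hf
    exact ⟨_, _, _, h, hne, by rw [key _ _ _ h]⟩

theorem interpConst_nonneg {p : ℝ≥0∞} : 0 ≤ interpConst p 0 1 := by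
  refine Real.sSup_nonneg ?_
  rintro s ⟨u, u', u'', _, _, rfl⟩
  positivity

theorem integral_navier_rpow_le (hp : p ≠ ⊤) {f : ℝ → ℝ} (hf : MemLp f p (intervalMeasure 0 1)) :
    ∫ x in Ioo (0 : ℝ) 1, |navier f x| ^ p.toReal ≤
      interpConst p 0 1 ^ p.toReal * ∫ x in Ioo (0 : ℝ) 1, |f x| ^ p.toReal := by
  have hr : 0 < p.toReal := ENNReal.toReal_pos (zero_lt_one.trans_le hp1.out).ne' hp
  have hN : MemLp (navier f) p (intervalMeasure 0 1) := memLp_of_continuousOn (navier_continuousOn hf)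
  have h0 : ∀ g : ℝ → ℝ, 0 ≤ ∫ x in Ioo (0 : ℝ) 1, |g x| ^ p.toReal := fun g =>
    integral_nonneg fun x => Real.rpow_nonneg (abs_nonneg _) _
  have h1 : (eLpNorm (navier f) p (intervalMeasure 0 1)).toReal ≤
      interpConst p 0 1 * (eLpNorm f p (intervalMeasure 0 1)).toReal := by
    by_cases hz : f =ᵐ[intervalMeasure 0 1] 0
    · have := toReal_eLpNorm_navier_le hf
      rw [eLpNorm_congr_ae hz, eLpNorm_zero] at this ⊢
      simpa using this
    have hpos : 0 < (eLpNorm f p (intervalMeasure 0 1)).toReal :=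
      ENNReal.toReal_pos (fun h => hz ((eLpNorm_eq_zero_iff hf.1
        (zero_lt_one.trans_le hp1.out).ne').1 h)) hf.2.ne
    rw [← div_le_iff₀ hpos, interpConst_eq_sSup]
    refine le_csSup ⟨2, ?_⟩ ⟨f, hf, hz, rfl⟩
    rintro s ⟨g, hg, _, rfl⟩
    exact div_le_of_le_mul₀ ENNReal.toReal_nonneg two_pos.le (toReal_eLpNorm_navier_le hg)
  rw [toReal_eLpNorm_eq hp hf, toReal_eLpNorm_eq hp hN] at h1
  have h2 := Real.rpow_le_rpow (Real.rpow_nonneg (h0 _) _) h1 hr.le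
  rwa [Real.mul_rpow interpConst_nonneg (Real.rpow_nonneg (h0 _) _), ← Real.rpow_mul (h0 _),
    ← Real.rpow_mul (h0 _), one_div_mul_cancel hr.ne', Real.rpow_one, Real.rpow_one] at h2

theorem exists_navier_gt (hp : p ≠ ⊤) {c : ℝ} (hc0 : 0 ≤ c) (hc : c < interpConst p 0 1) :
    ∃ f : ℝ → ℝ, MemLp f p (intervalMeasure 0 1) ∧ 0 < ∫ x in Ioo (0 : ℝ) 1, |f x| ^ p.toReal ∧
      c ^ p.toReal * ∫ x in Ioo (0 : ℝ) 1, |f x| ^ p.toReal ≤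
        ∫ x in Ioo (0 : ℝ) 1, |navier f x| ^ p.toReal := by
  have hr : 0 < p.toReal := ENNReal.toReal_pos (zero_lt_one.trans_le hp1.out).ne' hp
  rw [interpConst_eq_sSup] at hc
  have hne : {s | ∃ f : ℝ → ℝ, MemLp f p (intervalMeasure 0 1) ∧ ¬ f =ᵐ[intervalMeasure 0 1] 0 ∧
      s = (eLpNorm (navier f) p (intervalMeasure 0 1)).toReal /
        (eLpNorm f p (intervalMeasure 0 1)).toReal}.Nonempty := by
    by_contra h
    rw [not_nonempty_iff_eq_empty] at h
    rw [h, Real.sSup_empty] at hc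
    linarith
  obtain ⟨s, ⟨f, hf, hz, rfl⟩, hs⟩ := exists_lt_of_lt_csSup hne hc
  have hN : MemLp (navier f) p (intervalMeasure 0 1) := memLp_of_continuousOn (navier_continuousOn hf)
  have h0 : ∀ g : ℝ → ℝ, 0 ≤ ∫ x in Ioo (0 : ℝ) 1, |g x| ^ p.toReal := fun g =>
    integral_nonneg fun x => Real.rpow_nonneg (abs_nonneg _) _
  have hpos : 0 < (eLpNorm f p (intervalMeasure 0 1)).toReal :=
    ENNReal.toReal_pos (fun h => hz ((eLpNorm_eq_zero_iff hf.1
      (zero_lt_one.trans_le hp1.out).ne').1 h)) hf.2.ne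
  rw [lt_div_iff₀ hpos, toReal_eLpNorm_eq hp hf, toReal_eLpNorm_eq hp hN] at hs
  refine ⟨f, hf, (h0 f).lt_of_ne fun h => hz ((integral_rpow_eq_zero_iff hp hf).1 h.symm), ?_⟩
  have h2 := Real.rpow_le_rpow (mul_nonneg hc0 (Real.rpow_nonneg (h0 _) _)) hs.le hr.le
  rwa [Real.mul_rpow hc0 (Real.rpow_nonneg (h0 _) _), ← Real.rpow_mul (h0 _),
    ← Real.rpow_mul (h0 _), one_div_mul_cancel hr.ne', Real.rpow_one, Real.rpow_one] at h2

end Navier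

open IsHalfBump

/-! ### The Green function and symmetrization of nearly extremal functions -/

/-- The Green function of `-u''` on `(0, 1)` with `u(0) = u(1) = 0`. -/
noncomputable def green (x t : ℝ) : ℝ := min x t * (1 - max x t)

theorem green_nonneg {x t : ℝ} (hx : x ∈ Icc (0 : ℝ) 1) (ht : t ∈ Icc (0 : ℝ) 1) : 0 ≤ green x t :=
  mul_nonneg (le_min hx.1 ht.1) (by linarith [max_le hx.2 ht.2])

theorem green_eq (x t : ℝ) : green x t = x * (1 - t) - max (x - t) 0 := by
  unfold green
  rcases le_total x t with h | h
  · rw [min_eq_left h, max_eq_right h, max_eq_right (by linarith)]; ring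
  · rw [min_eq_right h, max_eq_left h, max_eq_left (by linarith)]; ring

theorem green_reflect (x t : ℝ) : green (1 - x) (1 - t) = green x t := by
  unfold green
  rcases le_total x t with h | h
  · rw [min_eq_left h, max_eq_right h, min_eq_right (by linarith), max_eq_left (by linarith)]; ring
  · rw [min_eq_right h, max_eq_left h, min_eq_left (by linarith), max_eq_right (by linarith)]; ring

/-- For symmetric data the solution has derivative zero at `1 / 2`; folding the Green function onto
the left half gives `min x t`, the kernel for a Dirichlet condition at `0` and a Neumann condition
at `1 / 2`. -/
theorem green_add_green_reflect {x t : ℝ} (hx : x ≤ 1 / 2) (ht : t ≤ 1 / 2) :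
    green x t + green x (1 - t) = min x t := by
  unfold green
  rw [min_eq_left (a := x) (b := 1 - t) (by linarith), max_eq_right (a := x) (b := 1 - t)
    (by linarith)]
  rcases le_total x t with h | h
  · rw [min_eq_left h, max_eq_right h]; ring
  · rw [min_eq_right h, max_eq_left h]; ring

theorem green_continuous (x : ℝ) : Continuous (green x) := by
  unfold green; fun_prop

theorem navier_eq {f : ℝ → ℝ} (hf : IntegrableOn f (Ioo 0 1)) {x : ℝ} (hx : x ∈ Icc (0 : ℝ) 1) :
    navier f x = ∫ t in Ioo (0 : ℝ) 1, green x t * f t := by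
  have hfi : Integrable ((Ioo (0 : ℝ) 1).indicator f) := (integrable_indicator_iff measurableSet_Ioo).2 hf
  have hae : f =ᵐ[intervalMeasure 0 1] (Ioo (0 : ℝ) 1).indicator f :=
    (indicator_ae_eq_restrict measurableSet_Ioo).symm
  have h0 : ∀ t ≤ 0, (Ioo (0 : ℝ) 1).indicator f t = 0 := fun t ht =>
    indicator_of_notMem (fun h => ht.not_gt h.1) _
  have hp : ∀ y ∈ Icc (0 : ℝ) 1, prim2 0 f y = ∫ t in Ioo (0 : ℝ) 1, max (y - t) 0 * f t := by
    intro y hy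
    rw [prim2_congr_ae hae hy, prim2_eq_integral hfi h0, ← integral_indicator measurableSet_Ioo]
    refine integral_congr_ae (Eventually.of_forall fun t => ?_)
    by_cases ht : t ∈ Ioo (0 : ℝ) 1 <;> simp [ht]
  have hb : ∀ y ∈ Icc (0 : ℝ) 1, IntegrableOn (fun t => max (y - t) 0 * f t) (Ioo 0 1) := by
    intro y hy
    refine Integrable.bdd_mul (c := 1) hf (by fun_prop) ?_
    refine (ae_restrict_iff' measurableSet_Ioo).2 (Eventually.of_forall fun t ht => ?_)
    rw [Real.norm_of_nonneg (le_max_right _ _)]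
    exact max_le (by linarith [ht.1, hy.2]) zero_le_one
  rw [navier, hp 1 (by simp), hp x hx, ← integral_const_mul,
    ← integral_sub ((hb 1 (by simp)).const_mul x) (hb x hx)]
  refine setIntegral_congr_fun measurableSet_Ioo fun t ht => ?_
  rw [green_eq, max_eq_left (a := 1 - t) (by linarith [ht.2])]
  ring

theorem two_term_holder {r q : ℝ} (hrq : r.HolderConjugate q) {α β a b : ℝ} (hα : 0 ≤ α)
    (hβ : 0 ≤ β) (ha : 0 ≤ a) (hb : 0 ≤ b) :
    α * a + β * b ≤ (α ^ q + β ^ q) ^ (1 / q) * (a ^ r + b ^ r) ^ (1 / r) := by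
  have := Real.inner_le_Lp_mul_Lq_of_nonneg (Finset.univ : Finset (Fin 2)) (f := ![α, β])
    (g := ![a, b]) hrq.symm (by intro i _; fin_cases i <;> simpa) (by intro i _; fin_cases i <;> simpa)
  simpa [Fin.sum_univ_two] using this

theorem integral_Ioo_fold {h : ℝ → ℝ} (hh : IntegrableOn h (Ioo 0 1)) :
    ∫ t in Ioo (0 : ℝ) 1, h t = ∫ t in Ioo (0 : ℝ) (1 / 2), (h t + h (1 - t)) ∧
      IntegrableOn (fun t => h (1 - t)) (Ioo 0 (1 / 2)) := by
  have h1 : IntervalIntegrable h volume 0 1 :=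
    (intervalIntegrable_iff_integrableOn_Ioo_of_le zero_le_one).2 hh
  have h2 : IntervalIntegrable h volume 0 (1 / 2) :=
    h1.mono_set (by
      rw [uIcc_of_le (by norm_num), uIcc_of_le (by norm_num)]
      exact Icc_subset_Icc_right (by norm_num))
  have h3 : IntervalIntegrable h volume (1 / 2) 1 :=
    h1.mono_set (by
      rw [uIcc_of_le (by norm_num), uIcc_of_le (by norm_num)]
      exact Icc_subset_Icc_left (by norm_num))
  have h4 : IntervalIntegrable (fun t => h (1 - t)) volume 0 (1 / 2) := by
    have := h3.comp_sub_left 1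
    norm_num at this
    simpa using this.symm
  refine ⟨?_, (intervalIntegrable_iff_integrableOn_Ioo_of_le (by norm_num)).1 h4⟩
  rw [← integral_Ioc_eq_integral_Ioo, ← integral_Ioc_eq_integral_Ioo,
    ← intervalIntegral.integral_of_le zero_le_one, ← intervalIntegral.integral_of_le (by norm_num),
    intervalIntegral.integral_add h2 h4, intervalIntegral.integral_comp_sub_left,
    ← intervalIntegral.integral_add_adjacent_intervals h2 h3]
  norm_num

/-- The symmetrization of a function on `(0, 1)` in the sense of `r`-th powers, restricted to the
left half. -/
noncomputable def powerSymm (r : ℝ) (f : ℝ → ℝ) : ℝ → ℝ :=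
  (Ioo (0 : ℝ) (1 / 2)).indicator fun t => ((f t ^ r + f (1 - t) ^ r) / 2) ^ (1 / r)

section PowerSymm

variable {r q : ℝ} {f : ℝ → ℝ}

theorem isHalfBump_powerSymm (hr : 1 ≤ r) (hm : Measurable f) (h0 : ∀ t, 0 ≤ f t)
    (hi : IntegrableOn f (Ioo 0 1)) : IsHalfBump (powerSymm r f) := by
  have hr0 : 0 < r := by linarith
  refine ⟨?_, fun t => ?_, fun t ht => ?_⟩
  · refine (integrable_indicator_iff measurableSet_Ioo).2 ?_
    refine Integrable.mono' ((hi.mono_set (Ioo_subset_Ioo_right (by norm_num))).add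
      (integral_Ioo_fold hi).2) ?_ (Eventually.of_forall fun t => ?_)
    · have : Measurable fun t => ((f t ^ r + f (1 - t) ^ r) / 2) ^ (1 / r) := by
        have h2 : Measurable fun t => f (1 - t) := hm.comp (by fun_prop)
        fun_prop
      exact this.aestronglyMeasurable
    · have h1 : 0 ≤ (f t ^ r + f (1 - t) ^ r) / 2 := by
        have := Real.rpow_nonneg (h0 t) r
        have := Real.rpow_nonneg (h0 (1 - t)) r
        positivity
      rw [Real.norm_of_nonneg (Real.rpow_nonneg h1 _)]
      have h2 : (f t ^ r + f (1 - t) ^ r) / 2 ≤ (f t + f (1 - t)) ^ r := by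
        have := Real.add_rpow_le_rpow_add (h0 t) (h0 (1 - t)) hr
        linarith
      refine (Real.rpow_le_rpow h1 h2 (by positivity)).trans (le_of_eq ?_)
      rw [← Real.rpow_mul (add_nonneg (h0 _) (h0 _)), mul_one_div_cancel hr0.ne', Real.rpow_one]
      rfl
  · refine indicator_nonneg (fun t _ => Real.rpow_nonneg ?_ _) t
    have := Real.rpow_nonneg (h0 t) r
    have := Real.rpow_nonneg (h0 (1 - t)) r
    positivity
  · by_contra h
    exact ht (indicator_of_notMem h _)

theorem integral_powerSymm_rpow (hr : 0 < r) (h0 : ∀ t, 0 ≤ f t)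
    (hi : IntegrableOn (fun t => f t ^ r) (Ioo 0 1)) :
    ∫ t, powerSymm r f t ^ r = (∫ t in Ioo (0 : ℝ) 1, f t ^ r) / 2 := by
  rw [(integral_Ioo_fold hi).1, ← integral_div, ← integral_indicator measurableSet_Ioo]
  refine integral_congr_ae (Eventually.of_forall fun t => ?_)
  unfold powerSymm
  by_cases ht : t ∈ Ioo (0 : ℝ) (1 / 2)
  · have h1 : 0 ≤ (f t ^ r + f (1 - t) ^ r) / 2 := by
      have := Real.rpow_nonneg (h0 t) r
      have := Real.rpow_nonneg (h0 (1 - t)) r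
      positivity
    simp only [indicator_of_mem ht]
    rw [← Real.rpow_mul h1, one_div_mul_cancel hr.ne', Real.rpow_one]
  · simp only [indicator_of_notMem ht, Real.zero_rpow hr.ne']

/-- Symmetrization by `r`-th power means does not decrease the `L_r` norm of the solution. The
values at `x` and `1 - x` are tested with their dual vector. Since the kernel is invariant under
reflection, Hölder's inequality for two terms replaces the values of `f` at `t` and `1 - t` by their
power mean under the integral, and the kernels combine to `min x t`. -/
theorem navier_rpow_add_le (hrq : r.HolderConjugate q) (hm : Measurable f) (h0 : ∀ t, 0 ≤ f t)
    (hi : IntegrableOn f (Ioo 0 1)) {x : ℝ} (hx : x ∈ Ioo (0 : ℝ) (1 / 2)) :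
    navier f x ^ r + navier f (1 - x) ^ r ≤ 2 * potential (powerSymm r f) x ^ r := by
  have hr := hrq.pos
  have hq := hrq.symm.pos
  have hhb := isHalfBump_powerSymm hrq.lt.le hm h0 hi
  have hx1 : x ∈ Icc (0 : ℝ) 1 := ⟨hx.1.le, by linarith [hx.2]⟩
  have hx2 : 1 - x ∈ Icc (0 : ℝ) 1 := ⟨by linarith [hx.2], by linarith [hx.1]⟩
  have hnn : ∀ y ∈ Icc (0 : ℝ) 1, 0 ≤ navier f y := by
    intro y hy
    rw [navier_eq hi hy]
    exact setIntegral_nonneg measurableSet_Ioo fun t ht =>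
      mul_nonneg (green_nonneg hy (Ioo_subset_Icc_self ht)) (h0 t)
  have hgi : ∀ y ∈ Icc (0 : ℝ) 1, IntegrableOn (fun t => green y t * f t) (Ioo 0 1) := by
    intro y hy
    refine Integrable.bdd_mul (c := 1) hi (green_continuous y).aestronglyMeasurable ?_
    refine (ae_restrict_iff' measurableSet_Ioo).2 (Eventually.of_forall fun t ht => ?_)
    rw [Real.norm_of_nonneg (green_nonneg hy (Ioo_subset_Icc_self ht)), green_eq]
    have h1 : 0 ≤ max (y - t) 0 := le_max_right _ _
    nlinarith [hy.1, hy.2, ht.1, ht.2]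
  set v := navier f x with hv
  set v' := navier f (1 - x) with hv'
  have hv0 : 0 ≤ v := hnn x hx1
  have hv0' : 0 ≤ v' := hnn _ hx2
  -- `(α, β)` is the Hölder dual of `(v, v')`: both `α v + β v'` and `α ^ q + β ^ q` equal `S`.
  set α := v ^ (r - 1) with hα
  set β := v' ^ (r - 1) with hβ
  have hα0 : 0 ≤ α := Real.rpow_nonneg hv0 _
  have hβ0 : 0 ≤ β := Real.rpow_nonneg hv0' _
  have hαq : α ^ q = v ^ r := by
    rw [hα, ← Real.rpow_mul hv0, hrq.sub_one_mul_conj]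
  have hβq : β ^ q = v' ^ r := by
    rw [hβ, ← Real.rpow_mul hv0', hrq.sub_one_mul_conj]
  have hαv : α * v = v ^ r := by
    rw [hα]
    rcases hv0.eq_or_lt with h | h
    · rw [← h, mul_zero, Real.zero_rpow hr.ne']
    · rw [← Real.rpow_add_one h.ne']; ring_nf
  have hβv : β * v' = v' ^ r := by
    rw [hβ]
    rcases hv0'.eq_or_lt with h | h
    · rw [← h, mul_zero, Real.zero_rpow hr.ne']
    · rw [← Real.rpow_add_one h.ne']; ring_nf
  set S := v ^ r + v' ^ r with hS
  have hS0 : 0 ≤ S := add_nonneg (Real.rpow_nonneg hv0 _) (Real.rpow_nonneg hv0' _)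
  set w := potential (powerSymm r f) x with hw
  have hw0 : 0 ≤ w := hhb.potential_nonneg hx.1.le
  have hf1 := integral_Ioo_fold (hgi x hx1)
  have hf2 := integral_Ioo_fold (hgi (1 - x) hx2)
  have hsub : Ioo (0 : ℝ) (1 / 2) ⊆ Ioo 0 1 := Ioo_subset_Ioo_right (by norm_num)
  have hwI : w = ∫ t in Ioo (0 : ℝ) (1 / 2), powerSymm r f t * min x t := by
    refine (setIntegral_eq_integral_of_forall_compl_eq_zero fun t ht => ?_).symm
    rw [powerSymm, indicator_of_notMem ht, zero_mul]
  have key : S ≤ S ^ (1 / q) * 2 ^ (1 / r) * w := by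
    calc S = α * v + β * v' := by rw [hαv, hβv]
      _ = ∫ t in Ioo (0 : ℝ) (1 / 2), (α * (green x t * f t + green x (1 - t) * f (1 - t)) +
            β * (green (1 - x) t * f t + green (1 - x) (1 - t) * f (1 - t))) := by
          rw [integral_add, integral_const_mul, integral_const_mul, ← hf1.1, ← hf2.1,
            ← navier_eq hi hx1, ← navier_eq hi hx2]
          · exact (((hgi x hx1).mono_set hsub).add hf1.2).const_mul α
          · exact (((hgi _ hx2).mono_set hsub).add hf2.2).const_mul β
      _ ≤ ∫ t in Ioo (0 : ℝ) (1 / 2), S ^ (1 / q) * 2 ^ (1 / r) * (powerSymm r f t * min x t) := by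
          refine setIntegral_mono_on ?_ ?_ measurableSet_Ioo fun t ht => ?_
          · exact ((((hgi x hx1).mono_set hsub).add hf1.2).const_mul α).add
              ((((hgi _ hx2).mono_set hsub).add hf2.2).const_mul β)
          · exact ((hhb.mul_integrable (k := fun t => min x t) (by fun_prop)).const_mul _).integrableOn
          · have ht1 : t ∈ Icc (0 : ℝ) 1 := ⟨ht.1.le, by linarith [ht.2]⟩
            have ht2 : 1 - t ∈ Icc (0 : ℝ) 1 := ⟨by linarith [ht.2], by linarith [ht.1]⟩
            have g1 := green_nonneg hx1 ht1
            have g2 := green_nonneg hx1 ht2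
            have e1 : green (1 - x) (1 - t) = green x t := green_reflect x t
            have e2 : green (1 - x) t = green x (1 - t) := by
              rw [← green_reflect x (1 - t), sub_sub_cancel]
            have H1 := two_term_holder hrq hα0 hβ0 (h0 t) (h0 (1 - t))
            have H2 := two_term_holder hrq hα0 hβ0 (h0 (1 - t)) (h0 t)
            rw [add_comm (f (1 - t) ^ r)] at H2
            rw [hαq, hβq, ← hS] at H1 H2
            have e3 : (f t ^ r + f (1 - t) ^ r) ^ (1 / r) = 2 ^ (1 / r) * powerSymm r f t := by
              have n1 := Real.rpow_nonneg (h0 t) r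
              have n2 := Real.rpow_nonneg (h0 (1 - t)) r
              rw [powerSymm, indicator_of_mem ht, ← Real.mul_rpow two_pos.le (by positivity)]
              congr 1
              ring
            rw [e3] at H1 H2
            rw [e1, e2, ← green_add_green_reflect hx.2.le ht.2.le]
            have := mul_le_mul_of_nonneg_left H1 g1
            have := mul_le_mul_of_nonneg_left H2 g2
            linarith
      _ = _ := by rw [integral_const_mul, hwI]
  rcases hS0.eq_or_lt with hz | hpos
  · rw [← hz]
    exact mul_nonneg two_pos.le (Real.rpow_nonneg hw0 _)
  have hSq : S = S ^ (1 / q) * S ^ (1 / r) := by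
    rw [← Real.rpow_add hpos, one_div, one_div, add_comm, hrq.inv_add_inv_eq_one, Real.rpow_one]
  have h1 : S ^ (1 / r) ≤ 2 ^ (1 / r) * w := by
    have h2 : 0 < S ^ (1 / q) := Real.rpow_pos_of_pos hpos _
    have h3 : S ^ (1 / q) * S ^ (1 / r) ≤ S ^ (1 / q) * (2 ^ (1 / r) * w) := by
      rw [← hSq, ← mul_assoc]; exact key
    exact le_of_mul_le_mul_left h3 h2
  have h2 := Real.rpow_le_rpow (Real.rpow_nonneg hS0 _) h1 hr.le
  rwa [Real.mul_rpow (by positivity) hw0, ← Real.rpow_mul hS0, ← Real.rpow_mul two_pos.le,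
    one_div_mul_cancel hr.ne', Real.rpow_one, Real.rpow_one] at h2

/-- Two half bumps with nearly extremal pairing. -/
theorem exists_halfBumps_of_navier (hrq : r.HolderConjugate q) (hm : Measurable f)
    (h0 : ∀ t, 0 ≤ f t) (hi : IntegrableOn f (Ioo 0 1))
    (hir : IntegrableOn (fun t => f t ^ r) (Ioo 0 1)) (h1 : ∫ t in Ioo (0 : ℝ) 1, f t ^ r = 1)
    (hN : ContinuousOn (navier f) (Icc 0 1)) {c : ℝ} (hc : 0 < c)
    (hcN : c ^ r ≤ ∫ x in Ioo (0 : ℝ) 1, navier f x ^ r) :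
    ∃ u g : ℝ → ℝ, IsHalfBump u ∧ IsHalfBump g ∧ ∫ t, u t ^ r = 1 / 2 ∧ ∫ t, g t ^ q = 1 / 2 ∧
      c ≤ 2 * ∫ t, g t * potential u t := by
  have hr := hrq.pos
  have hq := hrq.symm.pos
  have hhb := isHalfBump_powerSymm hrq.lt.le hm h0 hi
  set u := powerSymm r f with hu
  set w := potential u with hw
  have hwc : Continuous w := hhb.potential_continuous
  have hw0 : ∀ x ∈ Ioo (0 : ℝ) (1 / 2), 0 ≤ w x := fun x hx => hhb.potential_nonneg hx.1.le
  have hint : ∀ s : ℝ, 0 ≤ s → IntegrableOn (fun x => w x ^ s) (Ioo 0 (1 / 2)) := fun s hs =>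
    ((hwc.rpow_const fun _ => Or.inr hs).continuousOn.integrableOn_Icc).mono_set
      Ioo_subset_Icc_self
  set W := ∫ x in Ioo (0 : ℝ) (1 / 2), w x ^ r with hW
  have hNr : IntegrableOn (fun x => navier f x ^ r) (Ioo 0 1) :=
    ((hN.rpow_const fun _ _ => Or.inr hr.le).integrableOn_Icc).mono_set Ioo_subset_Icc_self
  have hcW : c ^ r ≤ 2 * W := by
    refine hcN.trans ?_
    rw [(integral_Ioo_fold hNr).1, hW, ← integral_const_mul]
    refine setIntegral_mono_on ?_ ((hint r hr.le).const_mul 2) measurableSet_Ioo fun x hx =>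
      navier_rpow_add_le hrq hm h0 hi hx
    exact (hNr.mono_set (Ioo_subset_Ioo_right (by norm_num))).add (integral_Ioo_fold hNr).2
  have hW2 : 0 < 2 * W := (Real.rpow_pos_of_pos hc r).trans_le hcW
  have hW0 : 0 < W := by linarith
  -- The test function `k w ^ (r - 1)` is extremal in Hölder's inequality for `w`; this `k` makes
  -- the integral of its `q`-th power `1 / 2`, and its pairing with `w`, doubled, is `(2 W) ^ (1 /
  -- r)`.
  set k := ((2 * W) ^ (1 / q))⁻¹ with hk
  have hk0 : 0 < k := by positivity
  have hkq : k ^ q = (2 * W)⁻¹ := by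
    rw [hk, Real.inv_rpow (by positivity), ← Real.rpow_mul hW2.le, one_div_mul_cancel hq.ne',
      Real.rpow_one]
  have hr1 : 0 ≤ r - 1 := by linarith [hrq.lt]
  refine ⟨u, (Ioo (0 : ℝ) (1 / 2)).indicator fun x => k * w x ^ (r - 1), hhb, ⟨?_, ?_, ?_⟩, ?_, ?_, ?_⟩
  · exact (integrable_indicator_iff measurableSet_Ioo).2 ((hint _ hr1).const_mul k)
  · exact fun t => indicator_nonneg (fun t ht => mul_nonneg hk0.le (Real.rpow_nonneg (hw0 t ht) _)) t
  · intro t ht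
    by_contra h
    exact ht (indicator_of_notMem h _)
  · rw [hu, integral_powerSymm_rpow hr h0 hir, h1]
  · have e : ∀ t, (Ioo (0 : ℝ) (1 / 2)).indicator (fun x => k * w x ^ (r - 1)) t ^ q =
        (Ioo (0 : ℝ) (1 / 2)).indicator (fun x => k ^ q * w x ^ r) t := by
      intro t
      by_cases ht : t ∈ Ioo (0 : ℝ) (1 / 2)
      · rw [indicator_of_mem ht, indicator_of_mem ht,
          Real.mul_rpow hk0.le (Real.rpow_nonneg (hw0 t ht) _), ← Real.rpow_mul (hw0 t ht),
          hrq.sub_one_mul_conj]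
      · rw [indicator_of_notMem ht, indicator_of_notMem ht, Real.zero_rpow hq.ne']
    simp only [e]
    rw [integral_indicator measurableSet_Ioo, integral_const_mul, hkq, ← hW]
    field_simp
  · have e : ∀ t, (Ioo (0 : ℝ) (1 / 2)).indicator (fun x => k * w x ^ (r - 1)) t * w t =
        (Ioo (0 : ℝ) (1 / 2)).indicator (fun x => k * w x ^ r) t := by
      intro t
      by_cases ht : t ∈ Ioo (0 : ℝ) (1 / 2)
      · rw [indicator_of_mem ht, indicator_of_mem ht, mul_assoc]
        congr 1
        rcases (hw0 t ht).eq_or_lt with h | h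
        · rw [← h, mul_zero, Real.zero_rpow hr.ne']
        · rw [← Real.rpow_add_one h.ne']; ring_nf
      · rw [indicator_of_notMem ht, indicator_of_notMem ht, zero_mul]
    change c ≤ 2 * ∫ t, (Ioo (0 : ℝ) (1 / 2)).indicator (fun x => k * w x ^ (r - 1)) t * w t
    simp only [e]
    rw [integral_indicator measurableSet_Ioo, integral_const_mul, ← hW]
    have e2 : 2 * (k * W) = (2 * W) ^ (1 / r) := by
      have : (2 * W) = (2 * W) ^ (1 / q) * (2 * W) ^ (1 / r) := by
        rw [← Real.rpow_add hW2, one_div, one_div, add_comm, hrq.inv_add_inv_eq_one, Real.rpow_one]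
      have hne : (2 * W) ^ (1 / q) ≠ 0 := by positivity
      rw [hk]
      field_simp
      linarith
    rw [e2]
    have := Real.rpow_le_rpow (by positivity) hcW (show 0 ≤ 1 / r by positivity)
    rwa [← Real.rpow_mul hc.le, mul_one_div_cancel hr.ne', Real.rpow_one] at this

end PowerSymm

/-- A nearly extremal function may be replaced by its normalized modulus, because the Green function
is nonnegative. A measurable representative is chosen so that nonnegativity and measurability hold
pointwise, as the symmetrization requires. -/
theorem exists_halfBumps {p : ℝ≥0∞} [hp1 : Fact (1 ≤ p)] (hp : p ≠ ⊤) {q : ℝ}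
    (hrq : p.toReal.HolderConjugate q) {c : ℝ} (hc0 : 0 < c) (hc : c < interpConst p 0 1) :
    ∃ u g : ℝ → ℝ, IsHalfBump u ∧ IsHalfBump g ∧ ∫ t, u t ^ p.toReal = 1 / 2 ∧
      ∫ t, g t ^ q = 1 / 2 ∧ c ≤ 2 * ∫ t, g t * potential u t := by
  obtain ⟨f, hf, hpos, hN⟩ := exists_navier_gt hp hc0.le hc
  set r := p.toReal with hrd
  have hr := hrq.pos
  set I := ∫ x in Ioo (0 : ℝ) 1, |f x| ^ r with hI
  set k := (I ^ (1 / r))⁻¹ with hk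
  have hk0 : 0 < k := by positivity
  have hkr : k ^ r = I⁻¹ := by
    rw [hk, Real.inv_rpow (by positivity), ← Real.rpow_mul hpos.le, one_div_mul_cancel hr.ne',
      Real.rpow_one]
  obtain ⟨f₀, hf₀m, hf₀⟩ := hf.1.aemeasurable
  set f₁ : ℝ → ℝ := fun t => k * |f₀ t| with hf₁
  have hm : Measurable f₁ := by fun_prop
  have h0 : ∀ t, 0 ≤ f₁ t := fun t => by positivity
  have hae : f₁ =ᵐ[intervalMeasure 0 1] fun t => k * |f t| := by
    filter_upwards [hf₀] with t ht
    rw [hf₁, ht]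
  have hmem : MemLp f₁ p (intervalMeasure 0 1) := (memLp_congr_ae hae).2 (hf.abs.const_mul k)
  have hi : IntegrableOn f₁ (Ioo 0 1) := hmem.integrable hp1.out
  have hir : IntegrableOn (fun t => f₁ t ^ r) (Ioo 0 1) := by
    have := integrableOn_rpow_of_memLp hp hmem
    simpa only [abs_of_nonneg (h0 _)] using this
  have h1 : ∫ t in Ioo (0 : ℝ) 1, f₁ t ^ r = 1 := by
    have e : ∫ t in Ioo (0 : ℝ) 1, f₁ t ^ r = ∫ t in Ioo (0 : ℝ) 1, k ^ r * |f t| ^ r := by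
      refine integral_congr_ae ?_
      filter_upwards [hae] with t ht
      rw [ht, Real.mul_rpow hk0.le (abs_nonneg _)]
    rw [e, integral_const_mul, hkr, ← hI, inv_mul_cancel₀ hpos.ne']
  have hle : ∀ x ∈ Icc (0 : ℝ) 1, k * |navier f x| ≤ navier f₁ x := by
    intro x hx
    rw [navier_eq (hf.integrable hp1.out) hx, navier_eq hi hx]
    have e : ∫ t in Ioo (0 : ℝ) 1, green x t * f₁ t = k * ∫ t in Ioo (0 : ℝ) 1, |green x t * f t| := by
      rw [← integral_const_mul]
      refine integral_congr_ae ?_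
      filter_upwards [hae, ae_restrict_mem measurableSet_Ioo] with t ht ht'
      rw [ht, abs_mul, abs_of_nonneg (green_nonneg hx (Ioo_subset_Icc_self ht'))]
      ring
    rw [e]
    exact mul_le_mul_of_nonneg_left abs_integral_le_integral_abs hk0.le
  have hNc := navier_continuousOn hmem
  refine exists_halfBumps_of_navier hrq hm h0 hi hir h1 hNc hc0 ?_
  have e1 : c ^ r = k ^ r * (c ^ r * I) := by
    rw [hkr]; field_simp
  rw [e1]
  refine (mul_le_mul_of_nonneg_left hN (by positivity)).trans ?_
  rw [← integral_const_mul]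
  refine setIntegral_mono_on ?_ ?_ measurableSet_Ioo fun x hx => ?_
  · exact ((((navier_continuousOn hf).abs.rpow_const fun _ _ => Or.inr hr.le).integrableOn_Icc).mono_set
      Ioo_subset_Icc_self).const_mul _
  · exact ((hNc.rpow_const fun _ _ => Or.inr hr.le).integrableOn_Icc).mono_set Ioo_subset_Icc_self
  · rw [← Real.mul_rpow hk0.le (abs_nonneg _)]
    exact Real.rpow_le_rpow (by positivity) (hle x (Ioo_subset_Icc_self hx)) hr.le

/-! ### Affine changes of variable -/

section Scaling

theorem affine_mem_Ioo_iff {h c α β s : ℝ} (hh : 0 < h) :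
    h * s + c ∈ Ioo (h * α + c) (h * β + c) ↔ s ∈ Ioo α β := by
  simp [mem_Ioo, hh]

theorem setIntegral_comp_affine {h : ℝ} (hh : 0 < h) (c : ℝ) {α β : ℝ} (hαβ : α ≤ β) (g : ℝ → ℝ) :
    ∫ x in Ioo α β, g (h * x + c) = h⁻¹ * ∫ y in Ioo (h * α + c) (h * β + c), g y := by
  have h1 : h * α + c ≤ h * β + c := by gcongr
  rw [← integral_Ioc_eq_integral_Ioo, ← integral_Ioc_eq_integral_Ioo,
    ← intervalIntegral.integral_of_le hαβ, ← intervalIntegral.integral_of_le h1,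
    intervalIntegral.integral_comp_mul_add _ hh.ne', smul_eq_mul]

theorem integrableOn_comp_affine {h : ℝ} (hh : 0 < h) (c : ℝ) {α β : ℝ} {g : ℝ → ℝ}
    (hg : IntegrableOn g (Ioo (h * α + c) (h * β + c))) :
    IntegrableOn (fun x => g (h * x + c)) (Ioo α β) := by
  have h1 := (integrable_indicator_iff measurableSet_Ioo).2 hg
  have h2 := (h1.comp_add_right c).comp_mul_left' hh.ne'
  refine (integrable_indicator_iff measurableSet_Ioo).1 (h2.congr (Eventually.of_forall fun x => ?_))
  by_cases hx : x ∈ Ioo α β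
  · simp only [indicator_of_mem hx, indicator_of_mem ((affine_mem_Ioo_iff hh).2 hx)]
  · simp only [indicator_of_notMem hx, indicator_of_notMem (mt (affine_mem_Ioo_iff hh).1 hx)]

theorem memLp_comp_affine {p : ℝ≥0∞} [hp1 : Fact (1 ≤ p)] (hp : p ≠ ⊤) {h : ℝ} (hh : 0 < h) (c : ℝ)
    {α β : ℝ} {f : ℝ → ℝ} (hf : MemLp f p (intervalMeasure (h * α + c) (h * β + c))) :
    MemLp (fun x => f (h * x + c)) p (intervalMeasure α β) :=
  memLp_of_integrableOn_rpow hp (integrableOn_comp_affine hh c (hf.integrable hp1.out)).1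
    (integrableOn_comp_affine hh c (integrableOn_rpow_of_memLp hp hf))

end Scaling

/-! ### The lower bound for the embedding -/

section Sobolev

variable {p : ℝ≥0∞} [hp1 : Fact (1 ≤ p)] {a b : ℝ}

theorem norm_Lp_rpow (hp : p ≠ ⊤) (g : LpInterval p a b) {f : ℝ → ℝ}
    (hf : g =ᵐ[intervalMeasure a b] f) :
    ‖g‖ ^ p.toReal = ∫ x in Ioo a b, |f x| ^ p.toReal := by
  have hr : 0 < p.toReal := ENNReal.toReal_pos (zero_lt_one.trans_le hp1.out).ne' hp
  have h0 : 0 ≤ ∫ x in Ioo a b, |f x| ^ p.toReal :=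
    integral_nonneg fun x => Real.rpow_nonneg (abs_nonneg _) _
  rw [Lp.norm_def, eLpNorm_congr_ae hf, toReal_eLpNorm_eq hp ((memLp_congr_ae hf).1 (Lp.memLp g)),
    ← Real.rpow_mul h0, one_div_mul_cancel hr.ne', Real.rpow_one]

namespace SobolevLeft

theorem inclusion_ae_eq (hab : a ≤ b) (u : SobolevLeft p a b) {f : ℝ → ℝ}
    (hf : secondDeriv p a b u =ᵐ[intervalMeasure a b] f) :
    inclusion p a b u =ᵐ[intervalMeasure a b] prim2 a f := by
  obtain ⟨w, hw, hwe⟩ := exists_primitive hab (secondDeriv p a b u)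
  rw [secondDeriv_injective hw] at hwe
  filter_upwards [hwe, ae_restrict_mem measurableSet_Ioo] with x hx hx'
  rw [hx]
  exact prim2_congr_ae hf (Ioo_subset_Icc_self hx')

theorem norm_rpow_eq (hp : p ≠ ⊤) (u : SobolevLeft p a b) {f : ℝ → ℝ}
    (hf : secondDeriv p a b u =ᵐ[intervalMeasure a b] f) :
    ‖u‖ ^ p.toReal = ∫ x in Ioo a b, |f x| ^ p.toReal := by
  rw [norm_def]
  exact norm_Lp_rpow hp _ hf

theorem norm_embedding_rpow_eq (hp : p ≠ ⊤) (hab : a ≤ b) (u : SobolevLeft p a b) {f : ℝ → ℝ}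
    (hf : secondDeriv p a b u =ᵐ[intervalMeasure a b] f) :
    ‖embedding p a b u‖ ^ p.toReal = ∫ x in Ioo a b, |prim2 a f x| ^ p.toReal :=
  norm_Lp_rpow hp _ (inclusion_ae_eq hab u hf)

/-- The chain on `(0, n)` is transplanted to `(a, b)` by a dilation with ratio `h = (b - a) / n`.
The integrals of `r`-th powers acquire the same factor `h` on both sides, and the twofold primitive
the factor `h ^ 2`. -/
theorem hasLowerBoundOfDim_embedding (hp : p ≠ ⊤) (hp1' : 1 < p) (hab : a < b) {n : ℕ}
    (hn : 1 ≤ n) {c : ℝ} (hc0 : 0 < c) (hc : c < interpConst p 0 1) :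
    HasLowerBoundOfDim (embedding p a b) n (((b - a) / n) ^ 2 * c) := by
  obtain ⟨m, rfl⟩ := Nat.exists_eq_add_of_le' hn
  have hr1 : 1 < p.toReal := by
    rw [← ENNReal.toReal_one]
    exact (ENNReal.toReal_lt_toReal ENNReal.one_ne_top hp).2 hp1'
  have hrq := Real.HolderConjugate.conjExponent hr1
  obtain ⟨u, g, hu, hg, hur, hgq, hl⟩ := exists_halfBumps hp hrq hc0 hc
  obtain ⟨F, hFi, hFs, hF⟩ := exists_chain hrq hu hg hur hgq (hc0.trans_le hl) m
  set r := p.toReal with hrd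
  have hr : 0 < r := by linarith
  set l := 2 * ∫ t, g t * IsHalfBump.potential u t
  have hm0 : (0 : ℝ) < m + 1 := by positivity
  set h : ℝ := (b - a) / (m + 1 : ℕ) with hh
  have hh0 : 0 < h := by
    rw [hh]; push_cast; exact div_pos (by linarith) hm0
  have hhm : h * (m + 1) = b - a := by
    rw [hh]; push_cast; field_simp
  have hmemF : ∀ i, MemLp (F i) p (intervalMeasure 0 (m + 1)) := by
    intro i
    refine memLp_of_integrableOn_rpow hp (hFi i).1.restrict ?_
    -- A unit coefficient vector isolates a single bump.
    have := (hF (Pi.single i 1)).1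
    simp only [Pi.single_apply, ite_mul, one_mul, zero_mul, Finset.sum_ite_eq',
      Finset.mem_univ, if_true] at this
    exact this.integrableOn
  have ea : h⁻¹ * a + -(a / h) = 0 := by field_simp; ring
  have eb : h⁻¹ * b + -(a / h) = m + 1 := by
    field_simp; linarith
  have hmem : ∀ i, MemLp (fun x => F i (h⁻¹ * x + -(a / h))) p (intervalMeasure a b) := by
    intro i
    refine memLp_comp_affine hp (inv_pos.2 hh0) _ ?_
    rw [ea, eb]
    exact hmemF i
  have hex : ∀ i, ∃ w : SobolevLeft p a b, secondDeriv p a b w = (hmem i).toLp _ := fun i =>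
    secondDeriv_surjective _
  choose w hw using hex
  let L : (Fin (m + 1) → ℝ) →ₗ[ℝ] SobolevLeft p a b := Fintype.linearCombination ℝ w
  have hLc : ∀ d, L d = ∑ i, d i • w i := fun d => Fintype.linearCombination_apply _ _ _
  set S : (Fin (m + 1) → ℝ) → ℝ → ℝ := fun d t => ∑ i, d i * F i t with hS
  have hae : ∀ d, secondDeriv p a b (L d) =ᵐ[intervalMeasure a b]
      fun x => S d (h⁻¹ * x + -(a / h)) := by
    intro d
    rw [hLc, map_sum]
    simp only [map_smul, hw]
    have h1 : ∀ᵐ x ∂intervalMeasure a b, ∀ i, (hmem i).toLp _ x = F i (h⁻¹ * x + -(a / h)) :=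
      ae_all_iff.2 fun i => (hmem i).coeFn_toLp
    have h2 : ∀ᵐ x ∂intervalMeasure a b, ∀ i, (d i • (hmem i).toLp _ : LpInterval p a b) x =
        d i • (hmem i).toLp _ x := ae_all_iff.2 fun i => Lp.coeFn_smul _ _
    have h3 := Lp.coeFn_finsetSum Finset.univ fun i => (d i • (hmem i).toLp _ : LpInterval p a b)
    filter_upwards [h1, h2, h3] with x hx1 hx2 hx3
    rw [hx3, Finset.sum_apply]
    refine Finset.sum_congr rfl fun i _ => ?_
    rw [hx2 i, hx1 i, smul_eq_mul]
  have hscale : ∀ G : ℝ → ℝ, ∫ x in Ioo a b, G (h⁻¹ * x + -(a / h)) =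
      h * ∫ y in Ioo (0 : ℝ) (m + 1), G y := by
    intro G
    rw [setIntegral_comp_affine (inv_pos.2 hh0) _ hab.le G, ea, eb, inv_inv]
  have hnorm : ∀ d, ‖L d‖ ^ r = h * ∑ i, |d i| ^ r := by
    intro d
    rw [norm_rpow_eq hp _ (hae d), hscale fun t => |S d t| ^ r, ← (hF d).2.1]
    congr 1
    refine setIntegral_eq_integral_of_forall_compl_eq_zero fun t ht => ?_
    have : S d t = 0 := Finset.sum_eq_zero fun i _ => by
      have : F i t = 0 := by
        by_contra hne
        exact ht (hFs i t hne)
      rw [this, mul_zero]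
    rw [this, abs_zero, Real.zero_rpow hr.ne']
  have hprim : ∀ d x, prim2 a (fun x => S d (h⁻¹ * x + -(a / h))) x =
      h ^ 2 * prim2 0 (S d) (h⁻¹ * x + -(a / h)) := by
    intro d x
    have := prim2_comp_affine (c := a) hh0.ne' (fun x => S d (h⁻¹ * x + -(a / h)))
      (h⁻¹ * x + -(a / h))
    have e1 : ∀ s, h⁻¹ * (h * s + a) + -(a / h) = s := fun s => by field_simp; ring
    have e2 : h * (h⁻¹ * x + -(a / h)) + a = x := by field_simp; ring
    simp only [e1, e2] at this
    rw [this]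
    field_simp
  have hemb : ∀ d, l ^ r * ((h ^ 2) ^ r * ‖L d‖ ^ r) ≤ ‖embedding p a b (L d)‖ ^ r := by
    intro d
    rw [norm_embedding_rpow_eq hp hab.le _ (hae d), hnorm]
    simp only [hprim]
    rw [hscale fun y => |h ^ 2 * prim2 0 (S d) y| ^ r]
    have e : ∀ y, |h ^ 2 * prim2 0 (S d) y| ^ r = (h ^ 2) ^ r * |prim2 0 (S d) y| ^ r := fun y => by
      rw [abs_mul, abs_of_pos (by positivity : 0 < h ^ 2), Real.mul_rpow (by positivity)
        (abs_nonneg _)]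
    simp only [e]
    rw [integral_const_mul]
    have := mul_le_mul_of_nonneg_left (hF d).2.2 (show 0 ≤ h * (h ^ 2) ^ r by positivity)
    calc _ = h * (h ^ 2) ^ r * (l ^ r * ∑ i, |d i| ^ r) := by ring
      _ ≤ _ := this
      _ = _ := by ring
  have hinj : Function.Injective L := by
    rw [injective_iff_map_eq_zero]
    intro d hd
    have h1 := hnorm d
    rw [hd, norm_zero, Real.zero_rpow hr.ne', eq_comm, mul_eq_zero, or_iff_right hh0.ne',
      Finset.sum_eq_zero_iff_of_nonneg fun i _ => Real.rpow_nonneg (abs_nonneg _) _] at h1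
    ext i
    have := h1 i (Finset.mem_univ i)
    rw [Real.rpow_eq_zero (abs_nonneg _) hr.ne', abs_eq_zero] at this
    exact this
  refine ⟨LinearMap.range L, ?_, ?_⟩
  · rw [rank_range_of_injective L hinj]
    simp
  · rintro _ ⟨d, rfl⟩
    have h1 : ((l * h ^ 2) * ‖L d‖) ^ r ≤ ‖embedding p a b (L d)‖ ^ r := by
      rw [Real.mul_rpow (mul_nonneg (hc0.le.trans hl) (by positivity)) (norm_nonneg _),
        Real.mul_rpow (hc0.le.trans hl) (by positivity), mul_assoc]
      exact hemb d
    have h2 := (Real.rpow_le_rpow_iff (mul_nonneg (mul_nonneg (hc0.le.trans hl) (by positivity))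
      (norm_nonneg _)) (norm_nonneg _) hr).1 h1
    refine le_trans ?_ h2
    rw [mul_comm (h ^ 2)]
    gcongr

end SobolevLeft

end Sobolev

open IsHalfBump

/-! ### The norm of the embedding, for the case `n = 1` -/

section NormBound

variable {p : ℝ≥0∞} [hp1 : Fact (1 ≤ p)]

/-- With the symmetric bump as right-hand side, the Navier solution is the potential on the left
half and its mirror image on the right half, so both integrals are doubled. -/
theorem integral_potential_rpow_le (hp : p ≠ ⊤) {u : ℝ → ℝ} (hu : IsHalfBump u)
    (hi : Integrable fun t => u t ^ p.toReal) :
    ∫ x in Ioo (0 : ℝ) (1 / 2), potential u x ^ p.toReal ≤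
      interpConst p 0 1 ^ p.toReal * ∫ t, u t ^ p.toReal := by
  have hr : 0 < p.toReal := ENNReal.toReal_pos (zero_lt_one.trans_le hp1.out).ne' hp
  have habs : ∀ t, |symmBump u t| = symmBump u t := fun t => abs_of_nonneg (hu.symmBump_nonneg t)
  have hS := integrable_symmBump_rpow hu hr hi
  have hmem : MemLp (symmBump u) p (intervalMeasure 0 1) := by
    refine memLp_of_integrableOn_rpow hp hu.symmBump_integrable.1.restrict ?_
    simp only [habs]
    exact hS.integrableOn
  have h1 := integral_navier_rpow_le hp hmem
  have e1 : ∫ x in Ioo (0 : ℝ) 1, |symmBump u x| ^ p.toReal = 2 * ∫ t, u t ^ p.toReal := by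
    simp only [habs]
    rw [← integral_symmBump_rpow hu hr hi]
    refine setIntegral_eq_integral_of_forall_compl_eq_zero fun t ht => ?_
    have : symmBump u t = 0 := by
      by_contra h
      exact ht (hu.symmBump_mem h)
    rw [this, Real.zero_rpow hr.ne']
  have hNi : IntegrableOn (fun x => |navier (symmBump u) x| ^ p.toReal) (Ioo 0 1) :=
    (((navier_continuousOn hmem).abs.rpow_const fun _ _ => Or.inr hr.le).integrableOn_Icc).mono_set
      Ioo_subset_Icc_self
  have e2 : ∫ x in Ioo (0 : ℝ) 1, |navier (symmBump u) x| ^ p.toReal =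
      2 * ∫ x in Ioo (0 : ℝ) (1 / 2), potential u x ^ p.toReal := by
    rw [(integral_Ioo_fold hNi).1, ← integral_const_mul]
    refine setIntegral_congr_fun measurableSet_Ioo fun x hx => ?_
    have f0 : prim2 0 (symmBump u) 1 = ∫ t, u t := by
      have := hu.prim2_symmBump_of_ge (s := 0) (x := 1) le_rfl (by norm_num)
      norm_num at this
      exact this
    have f1 : navier (symmBump u) x = potential u x := by
      have := hu.prim2_symmBump_left (s := 0) le_rfl hx
      simp only [sub_zero, add_zero] at this
      rw [navier, f0, this]; ring
    have f2 : navier (symmBump u) (1 - x) = potential u x := by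
      have := hu.prim2_symmBump_right (s := 0) le_rfl hx
      simp only [sub_zero, add_zero] at this
      rw [navier, f0, this]; ring
    simp only [f1, f2, abs_of_nonneg (hu.potential_nonneg hx.1.le)]
    ring
  rw [e1, e2] at h1
  linarith

theorem setIntegral_comp_one_sub_two_mul (k : ℝ → ℝ) :
    ∫ t in Ioo (0 : ℝ) (1 / 2), k (1 - 2 * t) = 2⁻¹ * ∫ x in Ioo (0 : ℝ) 1, k x := by
  rw [← integral_Ioc_eq_integral_Ioo, ← integral_Ioc_eq_integral_Ioo,
    ← intervalIntegral.integral_of_le (by norm_num), ← intervalIntegral.integral_of_le zero_le_one,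
    intervalIntegral.integral_comp_sub_mul _ two_ne_zero]
  norm_num

theorem integrableOn_comp_one_sub_two_mul {k : ℝ → ℝ} (hk : IntegrableOn k (Ioo 0 1)) :
    IntegrableOn (fun t => k (1 - 2 * t)) (Ioo 0 (1 / 2)) := by
  have h1 := (integrable_indicator_iff measurableSet_Ioo).2 hk
  have h2 := (h1.comp_sub_left 1).comp_mul_left' (two_ne_zero (α := ℝ))
  refine h2.integrableOn.congr_fun (fun t ht => ?_) measurableSet_Ioo
  exact indicator_of_mem (show 1 - 2 * t ∈ Ioo (0 : ℝ) 1 from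
    ⟨by linarith [ht.2], by linarith [ht.1]⟩) _

/-- The twofold primitive on `(0, 1)` is dominated by the constant of the interval of double
length: reflect evenly at the left endpoint. -/
theorem integral_prim2_rpow_le (hp : p ≠ ⊤) {f : ℝ → ℝ} (hf : MemLp f p (intervalMeasure 0 1)) :
    ∫ x in Ioo (0 : ℝ) 1, |prim2 0 f x| ^ p.toReal ≤
      (4 * interpConst p 0 1) ^ p.toReal * ∫ x in Ioo (0 : ℝ) 1, |f x| ^ p.toReal := by
  have hr : 0 < p.toReal := ENNReal.toReal_pos (zero_lt_one.trans_le hp1.out).ne' hp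
  set r := p.toReal with hrd
  have hfi : IntegrableOn (fun x => |f x|) (Ioo 0 1) := (hf.integrable hp1.out).abs
  have hfr := integrableOn_rpow_of_memLp hp hf
  set u : ℝ → ℝ := (Ioo (0 : ℝ) (1 / 2)).indicator fun t => |f (1 - 2 * t)| with hu
  have hur : ∀ t, u t ^ r = (Ioo (0 : ℝ) (1 / 2)).indicator (fun t => |f (1 - 2 * t)| ^ r) t := by
    intro t
    rw [hu]
    by_cases ht : t ∈ Ioo (0 : ℝ) (1 / 2)
    · rw [indicator_of_mem ht, indicator_of_mem ht]
    · rw [indicator_of_notMem ht, indicator_of_notMem ht, Real.zero_rpow hr.ne']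
  have hub : IsHalfBump u := by
    refine ⟨(integrable_indicator_iff measurableSet_Ioo).2 (integrableOn_comp_one_sub_two_mul hfi),
      fun t => indicator_nonneg (fun t _ => abs_nonneg _) t, fun t ht => ?_⟩
    by_contra h
    exact ht (indicator_of_notMem h _)
  have huri : Integrable fun t => u t ^ r := by
    simp only [hur]
    exact (integrable_indicator_iff measurableSet_Ioo).2
      (integrableOn_comp_one_sub_two_mul (k := fun x => |f x| ^ r) hfr)
  have hurI : ∫ t, u t ^ r = 2⁻¹ * ∫ x in Ioo (0 : ℝ) 1, |f x| ^ r := by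
    simp only [hur]
    rw [integral_indicator measurableSet_Ioo,
      setIntegral_comp_one_sub_two_mul fun x => |f x| ^ r]
  -- The kernel `max (y - x) 0` of the twofold primitive is at most `min y (1 - x)`. With `x = 1 - 2
  -- t` the latter becomes `2 * min (y / 2) t`; this factor `2` and the one from `dx = 2 dt` make up
  -- the `4`.
  have hpt : ∀ y ∈ Ioo (0 : ℝ) 1, |prim2 0 f y| ≤ 4 * potential u (2⁻¹ * y + 0) := by
    intro y hy
    have e1 : potential u (2⁻¹ * y + 0) =
        ∫ t in Ioo (0 : ℝ) (1 / 2), (fun x => |f x| * min (2⁻¹ * y) (2⁻¹ * (1 - x))) (1 - 2 * t) := by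
      rw [potential, ← setIntegral_eq_integral_of_forall_compl_eq_zero (s := Ioo (0 : ℝ) (1 / 2))]
      · refine setIntegral_congr_fun measurableSet_Ioo fun t ht => ?_
        simp only [hu, indicator_of_mem ht, add_zero]
        congr 2
        ring
      · intro t ht
        rw [hu, indicator_of_notMem ht, zero_mul]
    rw [e1, setIntegral_comp_one_sub_two_mul
      fun x => |f x| * min (2⁻¹ * y) (2⁻¹ * (1 - x))]
    have hi := intervalIntegrable_of_memLp zero_le_one hf
    have hix : IntervalIntegrable f volume 0 y :=
      hi.mono_set (by
        rw [uIcc_of_le hy.1.le, uIcc_of_le zero_le_one]; exact Icc_subset_Icc_right hy.2.le)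
    have hki : IntegrableOn (fun x => |f x| * min (2⁻¹ * y) (2⁻¹ * (1 - x))) (Ioo 0 1) := by
      refine Integrable.mul_bdd (c := 1) hfi (by fun_prop) ?_
      refine (ae_restrict_iff' measurableSet_Ioo).2 (Eventually.of_forall fun t ht => ?_)
      rw [Real.norm_of_nonneg (le_min (by linarith [hy.1]) (by linarith [ht.2]))]
      exact (min_le_left _ _).trans (by linarith [hy.2])
    have hsub : Ioo 0 y ⊆ Ioo (0 : ℝ) 1 := Ioo_subset_Ioo_right hy.2.le
    rw [prim2_eq hix, intervalIntegral.integral_of_le hy.1.le, integral_Ioc_eq_integral_Ioo]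
    have h0 : ∀ x ∈ Ioo (0 : ℝ) 1, 0 ≤ |f x| * min (2⁻¹ * y) (2⁻¹ * (1 - x)) := fun x hx =>
      mul_nonneg (abs_nonneg _) (le_min (by linarith [hy.1]) (by linarith [hx.2]))
    calc |∫ t in Ioo 0 y, (y - t) * f t|
        ≤ ∫ t in Ioo 0 y, |(y - t) * f t| := abs_integral_le_integral_abs
      _ ≤ ∫ t in Ioo 0 y, 2 * (|f t| * min (2⁻¹ * y) (2⁻¹ * (1 - t))) := by
          refine integral_mono_of_nonneg (Eventually.of_forall fun t => abs_nonneg _)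
            ((hki.mono_set hsub).const_mul 2) ?_
          refine (ae_restrict_iff' measurableSet_Ioo).2 (Eventually.of_forall fun t ht => ?_)
          simp only
          rw [abs_mul, abs_of_pos (by linarith [ht.2])]
          have : 2⁻¹ * (y - t) ≤ min (2⁻¹ * y) (2⁻¹ * (1 - t)) :=
            le_min (by linarith [ht.1]) (by linarith [hy.2])
          nlinarith [abs_nonneg (f t)]
      _ = 2 * ∫ t in Ioo 0 y, |f t| * min (2⁻¹ * y) (2⁻¹ * (1 - t)) := integral_const_mul _ _
      _ ≤ 2 * ∫ t in Ioo (0 : ℝ) 1, |f t| * min (2⁻¹ * y) (2⁻¹ * (1 - t)) := by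
          gcongr ?_ * ?_
          exact setIntegral_mono_set hki ((ae_restrict_iff' measurableSet_Ioo).2
            (Eventually.of_forall h0)) hsub.eventuallyLE
      _ = _ := by ring
  have hPc : Continuous fun y => potential u (2⁻¹ * y + 0) :=
    hub.potential_continuous.comp (by fun_prop)
  have hsc := setIntegral_comp_affine (show (0 : ℝ) < 2⁻¹ by norm_num) 0 zero_le_one
    fun y => potential u y ^ r
  norm_num at hsc
  have hmain := integral_potential_rpow_le hp hub huri
  rw [hurI] at hmain
  have hB : 0 ≤ interpConst p 0 1 := interpConst_nonneg
  calc ∫ x in Ioo (0 : ℝ) 1, |prim2 0 f x| ^ r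
      ≤ ∫ x in Ioo (0 : ℝ) 1, 4 ^ r * potential u (2⁻¹ * x + 0) ^ r := by
        refine setIntegral_mono_on ?_ ?_ measurableSet_Ioo fun x hx => ?_
        · exact ((((isW2_primitive zero_le_one hf).cont).abs.rpow_const
            fun _ _ => Or.inr hr.le).integrableOn_Icc).mono_set Ioo_subset_Icc_self
        · exact (((hPc.rpow_const fun _ => Or.inr hr.le).const_mul
            (4 ^ r)).continuousOn.integrableOn_Icc).mono_set Ioo_subset_Icc_self
        · rw [← Real.mul_rpow (by norm_num) (hub.potential_nonneg (by linarith [hx.1]))]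
          exact Real.rpow_le_rpow (abs_nonneg _) (hpt x hx) hr.le
    _ = 4 ^ r * (2 * ∫ x in Ioo (0 : ℝ) (1 / 2), potential u x ^ r) := by
        rw [integral_const_mul]
        congr 1
        norm_num
        exact hsc
    _ ≤ 4 ^ r * (2 * (interpConst p 0 1 ^ r * (2⁻¹ * ∫ x in Ioo (0 : ℝ) 1, |f x| ^ r))) := by
        gcongr
    _ = _ := by
        rw [Real.mul_rpow (by norm_num) hB]; ring

theorem SobolevLeft.norm_embedding_le (hp : p ≠ ⊤) {a b : ℝ} (hab : a < b) :
    ‖SobolevLeft.embedding p a b‖ ≤ 4 * (b - a) ^ 2 * interpConst p 0 1 := by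
  have hr : 0 < p.toReal := ENNReal.toReal_pos (zero_lt_one.trans_le hp1.out).ne' hp
  have hB : 0 ≤ interpConst p 0 1 := interpConst_nonneg
  set h := b - a with hh
  have hh0 : 0 < h := by linarith
  have ea : h * 0 + a = a := by ring
  have eb : h * 1 + a = b := by rw [hh]; ring
  refine ContinuousLinearMap.opNorm_le_bound _ (by positivity) fun u => ?_
  set f : ℝ → ℝ := ⇑(SobolevLeft.secondDeriv p a b u)
  have hmem : MemLp f p (intervalMeasure a b) := Lp.memLp _
  have hmem' : MemLp (fun s => f (h * s + a)) p (intervalMeasure 0 1) :=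
    memLp_comp_affine hp hh0 a (by rw [ea, eb]; exact hmem)
  have h1 := integral_prim2_rpow_le hp hmem'
  simp only [prim2_comp_affine hh0.ne'] at h1
  rw [setIntegral_comp_affine hh0 a zero_le_one (fun x => |f x| ^ p.toReal),
    setIntegral_comp_affine hh0 a zero_le_one (fun x => |(h ^ 2)⁻¹ * prim2 a f x| ^ p.toReal),
    ea, eb] at h1
  have e : ∀ x, |(h ^ 2)⁻¹ * prim2 a f x| ^ p.toReal =
      ((h ^ 2)⁻¹) ^ p.toReal * |prim2 a f x| ^ p.toReal := fun x => by
    rw [abs_mul, abs_of_pos (by positivity), Real.mul_rpow (by positivity) (abs_nonneg _)]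
  simp only [e] at h1
  rw [integral_const_mul, ← SobolevLeft.norm_embedding_rpow_eq hp hab.le u (EventuallyEq.refl _ _),
    ← SobolevLeft.norm_rpow_eq hp u (EventuallyEq.refl _ _)] at h1
  have h2 : ((h ^ 2)⁻¹ * ‖SobolevLeft.embedding p a b u‖) ^ p.toReal ≤
      (4 * interpConst p 0 1 * ‖u‖) ^ p.toReal := by
    rw [Real.mul_rpow (by positivity) (norm_nonneg _), Real.mul_rpow (by positivity) (norm_nonneg _)]
    have h3 : h⁻¹ * (((h ^ 2)⁻¹) ^ p.toReal * ‖SobolevLeft.embedding p a b u‖ ^ p.toReal) ≤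
        h⁻¹ * ((4 * interpConst p 0 1) ^ p.toReal * ‖u‖ ^ p.toReal) := by linarith
    exact le_of_mul_le_mul_left h3 (by positivity)
  have h3 := (Real.rpow_le_rpow_iff (by positivity) (by positivity) hr).1 h2
  rw [inv_mul_le_iff₀ (by positivity)] at h3
  linarith

end NormBound

/-! ### Piecewise linear interpolation and the upper bound -/

section Interpolation

/-- The hat function, the nodal basis function of piecewise linear interpolation. -/
noncomputable def hat (x : ℝ) : ℝ := max 0 (1 - |x|)

theorem hat_continuous : Continuous hat := by
  unfold hat; fun_prop

/-- Only the hats at the nodes `i` and `i + 1` are nonzero inside the cell. The node `0` is left out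
since `V 0 = 0`, which saves one dimension in the rank. -/
theorem sum_range_mul_hat (V : ℕ → ℝ) (h0 : V 0 = 0) {N i : ℕ} (hi : i < N) {s : ℝ}
    (hs : s ∈ Icc (0 : ℝ) 1) :
    ∑ k ∈ Finset.range N, V (k + 1) * hat (s + i - (k + 1 : ℕ)) = (1 - s) * V i + s * V (i + 1) := by
  have h1 : ∑ k ∈ Finset.range N, V (k + 1) * hat (s + i - (k + 1 : ℕ)) =
      ∑ j ∈ Finset.range (N + 1), V j * hat (s + i - j) := by
    rw [Finset.sum_range_succ', h0, zero_mul, add_zero]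
  rw [h1, Finset.sum_eq_add_of_mem i (i + 1) (by simp; omega) (by simp; omega) (by omega)]
  · have e1 : hat (s + i - (i : ℕ)) = 1 - s := by
      rw [hat, add_sub_cancel_right, abs_of_nonneg hs.1, max_eq_right (by linarith [hs.2])]
    have e2 : hat (s + i - (i + 1 : ℕ)) = s := by
      rw [hat]
      push_cast
      rw [abs_of_nonpos (by linarith [hs.2]), max_eq_right (by linarith [hs.1])]
      ring
    rw [e1, e2]
    ring
  · rintro j - ⟨hji, hji'⟩
    have : 1 ≤ |s + i - j| := by
      rcases lt_or_gt_of_ne hji with h | h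
      · have : (j : ℝ) + 1 ≤ i := by exact_mod_cast h
        exact le_trans (by linarith [hs.1]) (le_abs_self _)
      · have h' : i + 2 ≤ j := by omega
        have : (i : ℝ) + 2 ≤ j := by exact_mod_cast h'
        exact le_trans (by linarith [hs.2]) (neg_le_abs _)
    rw [hat, max_eq_left (by linarith), mul_zero]

/-- Restarting the twofold primitive at `c` changes it by an affine function, which linear
interpolation reproduces. -/
theorem prim2_shift {a c x : ℝ} {f : ℝ → ℝ} (hac : IntervalIntegrable f volume a c)
    (hcx : IntervalIntegrable f volume c x) :
    prim2 a f x = prim2 a f c + (x - c) * (∫ t in a..c, f t) + prim2 c f x := by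
  have hm : ∀ {y z w : ℝ}, IntervalIntegrable f volume y z →
      IntervalIntegrable (fun t => (w - t) * f t) volume y z := fun h =>
    h.continuousOn_mul (by fun_prop)
  rw [prim2_eq (hac.trans hcx), prim2_eq hac, prim2_eq hcx,
    ← intervalIntegral.integral_add_adjacent_intervals (hm hac) (hm hcx),
    ← intervalIntegral.integral_const_mul, ← intervalIntegral.integral_add (hm hac)
      (hac.const_mul _)]
  congr 1
  refine intervalIntegral.integral_congr fun t _ => ?_
  ring

/-- The error of linear interpolation of `prim2 a f` on `[c, c + h]` is a rescaled solution
operator of the Navier problem. -/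
theorem prim2_sub_affine {a c h s : ℝ} {f : ℝ → ℝ} (hh : h ≠ 0)
    (hac : IntervalIntegrable f volume a c) (hs : IntervalIntegrable f volume c (h * s + c))
    (h1 : IntervalIntegrable f volume c (h + c)) :
    prim2 a f (h * s + c) - ((1 - s) * prim2 a f c + s * prim2 a f (h + c)) =
      -(h ^ 2 * navier (fun t => f (h * t + c)) s) := by
  rw [navier, prim2_comp_affine hh, prim2_comp_affine hh, mul_one, prim2_shift hac hs,
    prim2_shift hac h1]
  field_simp
  ring

variable {p : ℝ≥0∞} [hp1 : Fact (1 ≤ p)]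

theorem setIntegral_Ioo_eq_sum {a h : ℝ} (hh : 0 < h) (N : ℕ) {g : ℝ → ℝ}
    (hg : IntegrableOn g (Ioo a (a + N * h))) :
    ∫ x in Ioo a (a + N * h), g x =
      ∑ i ∈ Finset.range N, ∫ x in Ioo (h * 0 + (a + i * h)) (h * 1 + (a + i * h)), g x := by
  have hN : a ≤ a + N * h := by nlinarith [Nat.cast_nonneg (α := ℝ) N]
  have hgi := (intervalIntegrable_iff_integrableOn_Ioo_of_le hN).2 hg
  have h1 := intervalIntegral.sum_integral_adjacent_intervals (f := g) (μ := volume)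
    (a := fun i : ℕ => a + i * h) (n := N) fun k hk => by
      refine hgi.mono_set ?_
      have hk' : (k : ℝ) + 1 ≤ N := by exact_mod_cast hk
      rw [uIcc_of_le hN, uIcc_of_le (by push_cast; linarith)]
      refine Icc_subset_Icc (by nlinarith [Nat.cast_nonneg (α := ℝ) k]) ?_
      push_cast
      nlinarith
  simp only [Nat.cast_zero, zero_mul, add_zero] at h1
  rw [← integral_Ioc_eq_integral_Ioo, ← intervalIntegral.integral_of_le hN, ← h1]
  refine Finset.sum_congr rfl fun i _ => ?_
  rw [intervalIntegral.integral_of_le (by push_cast; linarith), integral_Ioc_eq_integral_Ioo]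
  congr 3
  · ring
  · push_cast; ring

/-- `L_p` error of piecewise linear interpolation on a uniform grid. -/
theorem integral_interp_error_rpow_le (hp : p ≠ ⊤) {a h : ℝ} (hh : 0 < h) (N : ℕ) {f : ℝ → ℝ}
    (hf : MemLp f p (intervalMeasure a (a + N * h))) :
    ∫ x in Ioo a (a + N * h), |prim2 a f x - ∑ k ∈ Finset.range N,
        prim2 a f (a + (k + 1 : ℕ) * h) * hat ((x - a) / h - (k + 1 : ℕ))| ^ p.toReal ≤
      (h ^ 2 * interpConst p 0 1) ^ p.toReal * ∫ x in Ioo a (a + N * h), |f x| ^ p.toReal := by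
  have hr : 0 < p.toReal := ENNReal.toReal_pos (zero_lt_one.trans_le hp1.out).ne' hp
  have hB : 0 ≤ interpConst p 0 1 := interpConst_nonneg
  have hN : a ≤ a + N * h := by nlinarith [Nat.cast_nonneg (α := ℝ) N]
  have hi := intervalIntegrable_of_memLp hN hf
  have hii : ∀ {y z : ℝ}, y ∈ Icc a (a + N * h) → z ∈ Icc a (a + N * h) →
      IntervalIntegrable f volume y z := fun hy hz =>
    hi.mono_set (by rw [uIcc_of_le hN]; exact uIcc_subset_Icc hy hz)
  rw [setIntegral_Ioo_eq_sum hh N, setIntegral_Ioo_eq_sum hh N (integrableOn_rpow_of_memLp hp hf),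
    Finset.mul_sum]
  · refine Finset.sum_le_sum fun i hi' => ?_
    have hiN : i < N := Finset.mem_range.1 hi'
    have hiN' : (i : ℝ) + 1 ≤ N := by exact_mod_cast hiN
    have hi0 : (0 : ℝ) ≤ i := Nat.cast_nonneg i
    set c := a + i * h with hc
    have hca : a ≤ c := by rw [hc]; nlinarith
    have hcb : h + c ≤ a + N * h := by rw [hc]; nlinarith
    have hmem : ∀ s ∈ Icc (0 : ℝ) 1, h * s + c ∈ Icc a (a + N * h) := fun s hs =>
      ⟨by nlinarith [hs.1], by nlinarith [hs.2]⟩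
    have hc0 : c ∈ Icc a (a + N * h) := ⟨hca, by linarith⟩
    have hc1 : h + c ∈ Icc a (a + N * h) := ⟨by linarith, hcb⟩
    have hsub : Ioo (h * 0 + c) (h * 1 + c) ⊆ Ioo a (a + N * h) :=
      Ioo_subset_Ioo (by linarith) (by linarith)
    have hfc : MemLp (fun t => f (h * t + c)) p (intervalMeasure 0 1) :=
      memLp_comp_affine hp hh c (hf.mono_measure (Measure.restrict_mono hsub le_rfl))
    have key := integral_navier_rpow_le hp hfc
    rw [setIntegral_comp_affine hh c zero_le_one fun t => |f t| ^ p.toReal] at key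
    have e : ∫ x in Ioo (0 : ℝ) 1, |prim2 a f (h * x + c) - ∑ k ∈ Finset.range N,
        prim2 a f (a + (k + 1 : ℕ) * h) * hat ((h * x + c - a) / h - (k + 1 : ℕ))| ^ p.toReal =
        (h ^ 2) ^ p.toReal * ∫ x in Ioo (0 : ℝ) 1,
          |navier (fun t => f (h * t + c)) x| ^ p.toReal := by
      rw [← integral_const_mul]
      refine setIntegral_congr_fun measurableSet_Ioo fun s hs => ?_
      have hs' := Ioo_subset_Icc_self hs
      have e1 : (h * s + c - a) / h = s + i := by rw [hc]; field_simp; ring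
      have e2 := sum_range_mul_hat (fun k => prim2 a f (a + k * h)) (by simp [prim2]) hiN hs'
      have e3 : a + (i + 1 : ℕ) * h = h + c := by rw [hc]; push_cast; ring
      simp only [e1]
      simp only [e3, ← hc] at e2
      rw [e2, prim2_sub_affine hh.ne' (hii (left_mem_Icc.2 hN) hc0) (hii hc0 (hmem s hs'))
        (hii hc0 hc1), abs_neg, abs_mul, abs_of_pos (by positivity),
        Real.mul_rpow (by positivity) (abs_nonneg _)]
    rw [setIntegral_comp_affine hh c zero_le_one fun y => |prim2 a f y - ∑ k ∈ Finset.range N,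
        prim2 a f (a + (k + 1 : ℕ) * h) * hat ((y - a) / h - (k + 1 : ℕ))| ^ p.toReal] at e
    have h2 := mul_le_mul_of_nonneg_left key (show 0 ≤ (h ^ 2) ^ p.toReal by positivity)
    rw [← e, mul_left_comm (interpConst p 0 1 ^ p.toReal), mul_left_comm ((h ^ 2) ^ p.toReal)] at h2
    rw [Real.mul_rpow (by positivity) hB, mul_assoc]
    exact le_of_mul_le_mul_left h2 (by positivity)
  · refine IntegrableOn.mono_set (t := Icc a (a + N * h)) ?_ Ioo_subset_Icc_self
    refine ContinuousOn.integrableOn_Icc (ContinuousOn.rpow_const ?_ fun _ _ => Or.inr hr.le)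
    refine ((isW2_primitive hN hf).cont.sub (Continuous.continuousOn ?_)).abs
    exact continuous_finsetSum _ fun k _ => (hat_continuous.comp (by fun_prop)).const_mul _

end Interpolation

namespace SobolevLeft

variable {p : ℝ≥0∞} [hp1 : Fact (1 ≤ p)] {a b : ℝ}

/-- Evaluation of the continuous representative at a point of `[a, b]`. -/
noncomputable def eval (x : ℝ) (hx : x ∈ Icc a b) : SobolevLeft p a b →ₗ[ℝ] ℝ where
  toFun u := prim2 a (secondDeriv p a b u) x
  map_add' u v := by
    have hi : ∀ w : SobolevLeft p a b,
        IntervalIntegrable (secondDeriv p a b w) volume a x := fun w =>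
      (intervalIntegrable_of_memLp (hx.1.trans hx.2) (Lp.memLp _)).mono_set
        (by rw [uIcc_of_le hx.1, uIcc_of_le (hx.1.trans hx.2)]; exact Icc_subset_Icc_right hx.2)
    have hm : ∀ w : SobolevLeft p a b,
        IntervalIntegrable (fun t => (x - t) * secondDeriv p a b w t) volume a x := fun w =>
      (hi w).continuousOn_mul (by fun_prop)
    rw [map_add, prim2_congr_ae (Lp.coeFn_add _ _) hx,
      prim2_eq (f := ⇑(secondDeriv p a b u) + ⇑(secondDeriv p a b v)) ((hi u).add (hi v)),
      prim2_eq (hi u), prim2_eq (hi v), ← intervalIntegral.integral_add (hm u) (hm v)]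
    refine intervalIntegral.integral_congr fun t _ => ?_
    simp only [Pi.add_apply]
    ring
  map_smul' c u := by
    rw [map_smul, prim2_congr_ae (Lp.coeFn_smul _ _) hx]
    simp only [prim2, Pi.smul_apply, smul_eq_mul, intervalIntegral.integral_const_mul,
      RingHom.id_apply]

theorem eval_apply (x : ℝ) (hx : x ∈ Icc a b) (u : SobolevLeft p a b) :
    eval x hx u = prim2 a (secondDeriv p a b u) x := rfl

theorem exists_rank_lt_norm_sub_le_interp (hp : p ≠ ⊤) (hab : a < b) {N : ℕ} (hN : 1 ≤ N) :
    ∃ F : SobolevLeft p a b →L[ℝ] LpInterval p a b,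
      LinearMap.rank (F : SobolevLeft p a b →ₗ[ℝ] LpInterval p a b) < (N + 1 : ℕ) ∧
      ‖embedding p a b - F‖ ≤ ((b - a) / N) ^ 2 * interpConst p 0 1 := by
  have hr : 0 < p.toReal := ENNReal.toReal_pos (zero_lt_one.trans_le hp1.out).ne' hp
  have hB : 0 ≤ interpConst p 0 1 := interpConst_nonneg
  have hN0 : (0 : ℝ) < N := by exact_mod_cast hN
  set h := (b - a) / N with hh
  have hh0 : 0 < h := div_pos (by linarith) hN0
  have hb : a + N * h = b := by rw [hh]; field_simp; ring
  have hx : ∀ k : Fin N, a + (k + 1 : ℕ) * h ∈ Icc a b := by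
    intro k
    have : ((k + 1 : ℕ) : ℝ) ≤ N := by exact_mod_cast k.2
    exact ⟨by nlinarith [Nat.cast_nonneg (α := ℝ) (k + 1 : ℕ)], by nlinarith⟩
  have hm : ∀ k : Fin N, MemLp (fun x => hat ((x - a) / h - (k + 1 : ℕ))) p
      (intervalMeasure a b) := fun k =>
    memLp_of_continuousOn (hat_continuous.comp (by fun_prop)).continuousOn
  let P : SobolevLeft p a b →ₗ[ℝ] LpInterval p a b :=
    ∑ k : Fin N, (eval _ (hx k)).smulRight ((hm k).toLp _)
  have hP : ∀ u, inclusion p a b u - P u =ᵐ[intervalMeasure a b] fun x =>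
      prim2 a (secondDeriv p a b u) x - ∑ k ∈ Finset.range N,
        prim2 a (secondDeriv p a b u) (a + (k + 1 : ℕ) * h) *
          hat ((x - a) / h - (k + 1 : ℕ)) := by
    intro u
    have h0 : P u = ∑ k : Fin N, eval _ (hx k) u • (hm k).toLp _ := by
      simp only [P, LinearMap.sum_apply, LinearMap.smulRight_apply]
    have h1 : ∀ᵐ x ∂intervalMeasure a b, ∀ k,
        (hm k).toLp _ x = hat ((x - a) / h - (k + 1 : ℕ)) :=
      ae_all_iff.2 fun i => (hm i).coeFn_toLp
    have h2 : ∀ᵐ x ∂intervalMeasure a b, ∀ k,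
        (eval _ (hx k) u • (hm k).toLp _ : LpInterval p a b) x =
          eval _ (hx k) u • (hm k).toLp _ x := ae_all_iff.2 fun i => Lp.coeFn_smul _ _
    have h3 := Lp.coeFn_finsetSum Finset.univ
      fun k => (eval _ (hx k) u • (hm k).toLp _ : LpInterval p a b)
    filter_upwards [h1, h2, h3, Lp.coeFn_sub (inclusion p a b u) (P u),
      inclusion_ae_eq hab.le u (EventuallyEq.refl _ _)] with x hx1 hx2 hx3 hx4 hx5
    rw [hx4, Pi.sub_apply, hx5, h0, hx3, Finset.sum_apply, Finset.sum_range]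
    congr 1
    refine Finset.sum_congr rfl fun k _ => ?_
    rw [hx2 k, hx1 k, smul_eq_mul, eval_apply]
  have hbound : ∀ u, ‖(inclusion p a b - P) u‖ ≤ h ^ 2 * interpConst p 0 1 * ‖u‖ := by
    intro u
    rw [← Real.rpow_le_rpow_iff (norm_nonneg _) (by positivity) hr, LinearMap.sub_apply,
      norm_Lp_rpow hp _ (hP u), Real.mul_rpow (by positivity) (norm_nonneg _),
      norm_rpow_eq hp u (EventuallyEq.refl _ _)]
    have := integral_interp_error_rpow_le (p := p) (a := a) hp hh0 N
      (f := secondDeriv p a b u) (by rw [hb]; exact Lp.memLp _)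
    rwa [hb] at this
  -- `P` is given as a linear map only. Boundedness of the error makes `embedding p a b - D` a
  -- continuous version of it, with no separate estimate for point evaluations.
  let D := (inclusion p a b - P).mkContinuous _ hbound
  refine ⟨embedding p a b - D, ?_, ?_⟩
  · have e : ((embedding p a b - D : SobolevLeft p a b →L[ℝ] LpInterval p a b) :
        SobolevLeft p a b →ₗ[ℝ] LpInterval p a b) = P := by
      ext1 u
      change inclusion p a b u - (inclusion p a b u - P u) = P u
      abel
    rw [e]
    refine lt_of_le_of_lt (b := (N : Cardinal)) ?_ (by exact_mod_cast N.lt_succ_self)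
    refine (LinearMap.rank_finsetSum_le _ _).trans ?_
    refine (Finset.sum_le_card_nsmul _ _ 1 fun k _ => ?_).trans (by simp)
    refine (Submodule.rank_mono (t := Submodule.span ℝ {(hm k).toLp _}) ?_).trans
      ((rank_span_le _).trans (by simp))
    rintro _ ⟨u, rfl⟩
    exact Submodule.smul_mem _ _ (Submodule.mem_span_singleton_self _)
  · rw [sub_sub_cancel]
    exact LinearMap.mkContinuous_norm_le _ (by positivity) _

/-- For `n ≥ 2` the interpolation uses `n - 1` cells, and `n - 1 ≥ n - 3 / 2 > 0`. For `n = 1` the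
map is zero, and `n - 3 / 2 = -1 / 2` turns the right side into `4 (b - a) ^ 2 B`, the bound of the
norm. -/
theorem exists_rank_lt_norm_sub_le (hp : p ≠ ⊤) (hab : a < b) {n : ℕ} (hn : 1 ≤ n) :
    ∃ F : SobolevLeft p a b →L[ℝ] LpInterval p a b,
      LinearMap.rank (F : SobolevLeft p a b →ₗ[ℝ] LpInterval p a b) < (n : Cardinal) ∧
      ‖embedding p a b - F‖ ≤ ((b - a) / (n - 3 / 2)) ^ 2 * interpConst p 0 1 := by
  have hB : 0 ≤ interpConst p 0 1 := interpConst_nonneg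
  obtain ⟨N, rfl⟩ := Nat.exists_eq_add_of_le' hn
  rcases Nat.eq_zero_or_pos N with rfl | hN
  · refine ⟨0, ?_, ?_⟩
    · have : ((0 : SobolevLeft p a b →L[ℝ] LpInterval p a b) :
        SobolevLeft p a b →ₗ[ℝ] LpInterval p a b) = 0 := rfl
      rw [this, LinearMap.rank_zero]
      simp
    · rw [sub_zero]
      refine (norm_embedding_le hp hab).trans_eq ?_
      push_cast
      ring
  · obtain ⟨F, hF, hle⟩ := exists_rank_lt_norm_sub_le_interp (p := p) hp hab hN
    refine ⟨F, hF, hle.trans ?_⟩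
    have hN1 : (1 : ℝ) ≤ N := by exact_mod_cast hN
    have : (0 : ℝ) < (N + 1 : ℕ) - 3 / 2 := by push_cast; linarith
    have hba : 0 < b - a := by linarith
    gcongr
    push_cast
    linarith

end SobolevLeft

/-! ### Passage to the limit -/

section Limits

/-- The lower bounds are available for `c` below the constant only and are extended to it by
approximation. As `0 ≤ v` takes care of `c ≤ 0`, it need not be known that the constant is positive.
-/
theorem mul_interpConst_le {p : ℝ≥0∞} {k v : ℝ} (hk : 0 < k) (hv : 0 ≤ v)
    (h : ∀ c, 0 < c → c < interpConst p 0 1 → k * c ≤ v) : k * interpConst p 0 1 ≤ v := by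
  rw [← le_div_iff₀' hk]
  refine le_of_forall_lt fun c hc => ?_
  obtain ⟨d, hcd, hd⟩ := exists_between hc
  rcases le_or_gt d 0 with hd0 | hd0
  · exact (hcd.trans_le hd0).trans_le (by positivity)
  · exact hcd.trans_le ((le_div_iff₀' hk).2 (h d hd0 hd))

theorem tendsto_sq_mul_of_bounds {L B : ℝ} {v : ℕ → ℝ}
    (h : ∀ n : ℕ, 1 ≤ n → (L / n) ^ 2 * B ≤ v n ∧ v n ≤ (L / (n - 3 / 2)) ^ 2 * B) :
    Tendsto (fun n : ℕ => (n : ℝ) ^ 2 * v n) atTop (𝓝 (L ^ 2 * B)) := by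
  have h1 : Tendsto (fun n : ℕ => (n : ℝ) / (n + (-(3 / 2)))) atTop (𝓝 1) :=
    tendsto_natCast_div_add_atTop _
  have h2 : Tendsto (fun n : ℕ => ((n : ℝ) / (n + (-(3 / 2)))) ^ 2 * (L ^ 2 * B)) atTop
      (𝓝 (L ^ 2 * B)) := by
    simpa using (h1.pow 2).mul_const (L ^ 2 * B)
  refine tendsto_of_tendsto_of_tendsto_of_le_of_le' tendsto_const_nhds h2 ?_ ?_
  · filter_upwards [eventually_ge_atTop 1] with n hn
    have hn0 : (0 : ℝ) < n := by exact_mod_cast hn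
    calc L ^ 2 * B = n ^ 2 * ((L / n) ^ 2 * B) := by field_simp
      _ ≤ _ := by gcongr; exact (h n hn).1
  · filter_upwards [eventually_ge_atTop 1] with n hn
    calc (n : ℝ) ^ 2 * v n ≤ n ^ 2 * ((L / (n - 3 / 2)) ^ 2 * B) := by
          gcongr; exact (h n hn).2
      _ = _ := by rw [← sub_eq_add_neg]; ring

end Limits

end EmbeddingNumbers

theorem theorem3p6 (p : ℝ≥0∞) [Fact (1 ≤ p)] (hp1 : 1 < p) (hp : p ≠ ⊤) (a b : ℝ) (hab : a < b) :
    ((∀ n : ℕ, 1 ≤ n →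
        ((b - a) / n) ^ 2 * interpConst p 0 1 ≤ approxNumber (SobolevLeft.embedding p a b) n ∧
        approxNumber (SobolevLeft.embedding p a b) n ≤
          ((b - a) / (n - 3 / 2)) ^ 2 * interpConst p 0 1) ∧
      Tendsto (fun n : ℕ => (n : ℝ) ^ 2 * approxNumber (SobolevLeft.embedding p a b) n) atTop
        (𝓝 ((b - a) ^ 2 * interpConst p 0 1))) ∧
    (∀ n : ℕ, 1 ≤ n →
      ((b - a) / n) ^ 2 * interpConst p 0 1 ≤ bernsteinNumber (SobolevLeft.embedding p a b) n) ∧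
    ∀ s : OperatorSequence, IsStrictSNumber s → IsInjectiveSNumber s →
      (∀ n : ℕ, 1 ≤ n →
        ((b - a) / n) ^ 2 * interpConst p 0 1 ≤
          s (SobolevLeft p a b) (LpInterval p a b) (SobolevLeft.embedding p a b) n ∧
        s (SobolevLeft p a b) (LpInterval p a b) (SobolevLeft.embedding p a b) n ≤
          ((b - a) / (n - 3 / 2)) ^ 2 * interpConst p 0 1) ∧
      Tendsto (fun n : ℕ => (n : ℝ) ^ 2 *
          s (SobolevLeft p a b) (LpInterval p a b) (SobolevLeft.embedding p a b) n) atTop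
        (𝓝 ((b - a) ^ 2 * interpConst p 0 1)) := by
  have hba : 0 < b - a := by linarith
  -- The same subspaces serve all three kinds of numbers, so `v` stands for any of them.
  have hlow : ∀ n : ℕ, 1 ≤ n → ∀ v : ℝ, 0 ≤ v →
      (∀ c, HasLowerBoundOfDim (SobolevLeft.embedding p a b) n c → c ≤ v) →
      ((b - a) / n) ^ 2 * interpConst p 0 1 ≤ v := fun n hn v hv h => by
    have hn0 : (0 : ℝ) < n := by exact_mod_cast hn
    exact mul_interpConst_le (by positivity) hv fun c hc0 hc =>
      h _ (SobolevLeft.hasLowerBoundOfDim_embedding hp hp1 hab hn hc0 hc)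
  have happrox : ∀ n : ℕ, 1 ≤ n →
      ((b - a) / n) ^ 2 * interpConst p 0 1 ≤ approxNumber (SobolevLeft.embedding p a b) n ∧
      approxNumber (SobolevLeft.embedding p a b) n ≤
        ((b - a) / (n - 3 / 2)) ^ 2 * interpConst p 0 1 := fun n hn => by
    obtain ⟨F, hF, hle⟩ := SobolevLeft.exists_rank_lt_norm_sub_le (p := p) hp hab hn
    refine ⟨hlow n hn _ (Real.sInf_nonneg ?_) fun c hc => hc.le_approxNumber hn,
      (approxNumber_le F hF).trans hle⟩
    rintro r ⟨G, -, rfl⟩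
    exact norm_nonneg _
  refine ⟨⟨happrox, tendsto_sq_mul_of_bounds happrox⟩, fun n hn =>
    hlow n hn _ (Real.sSup_nonneg ?_) fun c hc => hc.le_bernsteinNumber hn, fun s hs hi => ?_⟩
  · rintro r ⟨V, -, rfl⟩
    refine Real.sInf_nonneg ?_
    rintro t ⟨x, -, -, rfl⟩
    positivity
  · have hsn : ∀ n : ℕ, 1 ≤ n →
        ((b - a) / n) ^ 2 * interpConst p 0 1 ≤
          s (SobolevLeft p a b) (LpInterval p a b) (SobolevLeft.embedding p a b) n ∧
        s (SobolevLeft p a b) (LpInterval p a b) (SobolevLeft.embedding p a b) n ≤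
          ((b - a) / (n - 3 / 2)) ^ 2 * interpConst p 0 1 := fun n hn => by
      obtain ⟨F, hF, hle⟩ := SobolevLeft.exists_rank_lt_norm_sub_le (p := p) hp hab hn
      exact ⟨hlow n hn _ (hs.nonneg _ _ _ n hn) fun c hc => hc.le_sNumber hs hi hn,
        (hs.le_norm_sub hn F hF).trans hle⟩
    exact ⟨hsn, tendsto_sq_mul_of_bounds hsn⟩
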